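/- Let $D\subset\mathbb R^d$ be a bounded open set with Lipschitz boundary, let $(N,h)$ be a connected, complete (smooth, finite-dimensional, second countable, boundaryless) Riemannian manifold with Riemannian distance $d_h$, and let $p\in(1,\infty)$. A function $D\to\mathbb R$ is called weakly differentiable if it belongs to $L^1_{\mathrm{loc}}(D)$ and has a weak derivative in $L^1_{\mathrm{loc}}(D;(\mathbb R^d)^*)$. A map $u:D\to N$ is called colocally weakly differentiable if $f\circ u$ is weakly differentiable for every $f\in C^1_c(N)$. A colocal weak derivative of $u$ is a family of linear maps $du_x:\mathbb R^d\to T_{u(x)}N$, $x\in D$, such that for every $f\in C_c^1(N)$ one has $d(f\circ u)_x=df_{u(x)}\circ du_x$ for a.e. $x\in D$; it is unique up to null sets. We write $|du_x|_{e_d,h}=\bigl(\sum_{i=1}^d|du_x(e_i)|_h^2\bigr)^{1/2}$ for its Frobenius norm, where $(e_i)$ is the standard basis of $\mathbb R^d$, and $u\in\dot W^{1,p}(D;N)$ if $u$ is colocally weakly differentiable with $|du|_{e_d,h}\in L^p(D)$. Let $(u_k)_{k\in\mathbb N}\subset\dot W^{1,p}(D;N)$, and assume that there exist $q_0\in N$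 and $C>0$ such that for all $k\in\mathbb N$ $$\int_D d_h^p(u_k,q_0)\,dx\le C,\qquad \int_D|du_k|_{e_d,h}^p\,dx\le C.$$ Then there exist a subsequence $(u_{k_l})_{l\in\mathbb N}$ and a map $u\in\dot W^{1,p}(D;N)$ such that $d_h(u_{k_l},u)\to0$ in $L^p(D)$ as $l\to\infty$. -/

import Mathlib

open MeasureTheory Filter Topology Bundle
open scoped Manifold ContDiff ENNReal NNReal

/-- `D ⊆ ℝ^d` has Lipschitz boundary: near each boundary point, for a suitable unit vector `e`
(the "vertical" direction), `D` is the strict epigraph of a Lipschitz function of the component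
`y - ⟪e, y⟫ e` of `y` orthogonal to `e`. -/
def HasLipschitzBoundary {d : ℕ} (D : Set (EuclideanSpace ℝ (Fin d))) : Prop :=
  ∀ x ∈ frontier D, ∃ (e : EuclideanSpace ℝ (Fin d)) (r : ℝ) (K : ℝ≥0)
    (γ : EuclideanSpace ℝ (Fin d) → ℝ), ‖e‖ = 1 ∧ 0 < r ∧ LipschitzWith K γ ∧
      ∀ y ∈ Metric.ball x r, (y ∈ D ↔ γ (y - inner ℝ e y • e) < inner ℝ e y)

/-- `g ∈ L¹_loc(D)` is the weak derivative of `f ∈ L¹_loc(D)` in `D`. -/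
def HasWeakDerivOn {d : ℕ} (D : Set (EuclideanSpace ℝ (Fin d)))
    (f : EuclideanSpace ℝ (Fin d) → ℝ)
    (g : EuclideanSpace ℝ (Fin d) → EuclideanSpace ℝ (Fin d) →L[ℝ] ℝ) : Prop :=
  LocallyIntegrableOn f D volume ∧ LocallyIntegrableOn g D volume ∧
    ∀ φ : EuclideanSpace ℝ (Fin d) → ℝ, ContDiff ℝ ∞ φ → HasCompactSupport φ → tsupport φ ⊆ D →
      ∀ v : EuclideanSpace ℝ (Fin d),
        ∫ x in D, f x * fderiv ℝ φ x v = - ∫ x in D, g x v * φ x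

/-- `f` is weakly differentiable in the open set `D ⊆ ℝ^d`. -/
def IsWeaklyDifferentiableOn {d : ℕ} (D : Set (EuclideanSpace ℝ (Fin d)))
    (f : EuclideanSpace ℝ (Fin d) → ℝ) : Prop :=
  ∃ g, HasWeakDerivOn D f g

section Colocal

variable {d : ℕ} {N : Type*} [TopologicalSpace N]

/-- The map `u : D → N` is colocally weakly differentiable: `f ∘ u` is weakly differentiable for
every `f ∈ C_c^1(N)`. Maps on `D` are represented by maps on `ℝ^d` of which only the values on `D`
are used. -/
def IsColocallyWeaklyDifferentiableOn (n : ℕ)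
    [ChartedSpace (EuclideanSpace ℝ (Fin n)) N] (D : Set (EuclideanSpace ℝ (Fin d)))
    (u : EuclideanSpace ℝ (Fin d) → N) : Prop :=
  ∀ f : N → ℝ, ContMDiff (𝓡 n) 𝓘(ℝ, ℝ) 1 f → HasCompactSupport f →
    IsWeaklyDifferentiableOn D (fun x => f (u x))

/-- `du` is a colocal weak derivative of `u : D → N`: a family of linear maps
`du x : ℝ^d → T_{u x} N` such that, for every `f ∈ C_c^1(N)`, the weak derivative of `f ∘ u` is
`x ↦ df_{u x} ∘ du x` (for almost every `x ∈ D`). -/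
def IsColocalWeakDerivOn {n : ℕ} [ChartedSpace (EuclideanSpace ℝ (Fin n)) N]
    (D : Set (EuclideanSpace ℝ (Fin d)))
    (u : EuclideanSpace ℝ (Fin d) → N)
    (du : ∀ x, EuclideanSpace ℝ (Fin d) →L[ℝ] TangentSpace (𝓡 n) (u x)) : Prop :=
  ∀ f : N → ℝ, ContMDiff (𝓡 n) 𝓘(ℝ, ℝ) 1 f → HasCompactSupport f →
    HasWeakDerivOn D (fun x => f (u x))
      (fun x => (mfderiv (𝓡 n) 𝓘(ℝ, ℝ) f (u x)).comp (du x))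

/-- The Frobenius norm `|T|` of a linear map `T : ℝ^d → T_q N`, with respect to the Euclidean
metric on `ℝ^d` and the Riemannian metric of `N` at `q`. -/
noncomputable def frobeniusNormAt {n : ℕ} [ChartedSpace (EuclideanSpace ℝ (Fin n)) N]
    [RiemannianBundle (fun q : N => TangentSpace (𝓡 n) q)]
    (q : N)
    (T : EuclideanSpace ℝ (Fin d) →L[ℝ] TangentSpace (𝓡 n) q) : ℝ :=
  √(∑ i : Fin d, ‖T (EuclideanSpace.basisFun (Fin d) ℝ i)‖ ^ 2)

/-- The `p`-energy `∫_D |du|^p dx` of a field `du` of linear maps along `u`. -/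
noncomputable def derivEnergy {n : ℕ} [ChartedSpace (EuclideanSpace ℝ (Fin n)) N]
    [RiemannianBundle (fun q : N => TangentSpace (𝓡 n) q)]
    (D : Set (EuclideanSpace ℝ (Fin d))) (p : ℝ)
    (u : EuclideanSpace ℝ (Fin d) → N)
    (du : ∀ x, EuclideanSpace ℝ (Fin d) →L[ℝ] TangentSpace (𝓡 n) (u x)) : ℝ≥0∞ :=
  ∫⁻ x in D, ENNReal.ofReal (frobeniusNormAt (u x) (du x)) ^ p

/-- `u` belongs to the homogeneous Sobolev space `Ẇ^{1,p}(D; N)`: it is colocally weakly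
differentiable, and its colocal weak derivative `du` satisfies `|du| ∈ L^p(D)`. -/
def MemHomogeneousSobolev (n : ℕ) [ChartedSpace (EuclideanSpace ℝ (Fin n)) N]
    [RiemannianBundle (fun q : N => TangentSpace (𝓡 n) q)] (D : Set (EuclideanSpace ℝ (Fin d))) (p : ℝ)
    (u : EuclideanSpace ℝ (Fin d) → N) : Prop :=
  IsColocallyWeaklyDifferentiableOn n D u ∧
    ∃ du : ∀ x, EuclideanSpace ℝ (Fin d) →L[ℝ] TangentSpace (𝓡 n) (u x),
      IsColocalWeakDerivOn D u du ∧
        MemLp (fun x => frobeniusNormAt (u x) (du x)) (ENNReal.ofReal p) (volume.restrict D)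

end Colocal

/-!
A Rellich type compactness theorem for maps from a bounded Lipschitz domain `D` into a complete
Riemannian manifold `N`, whose derivatives are only defined colocally, that is, through the
compositions with functions in `C^1_c(N)`. The proof reduces to real functions by means of a
countable family of `C^1_c` functions with gradients bounded by a universal constant, which
approximate the truncated distance functions `max (R - d(·, q)) 0` (`exists_isApproxFamily`); such
functions are obtained by smoothing in charts that are nearly isometric. Their supports are
compact because `N` is proper, by the Hopf–Rinow theorem (`properSpace_of_isRiemannianManifold`).

*Estimate on translates.* A weakly differentiable function satisfies the fundamental theorem of
calculus along almost all segments in a given direction (`HasWeakDerivOn.ae_translate_sub_eq`).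
Applied to the compositions of `u` with the approximate distance functions, this bounds `d(u(y +
h), u(y))` by the integral of `|du|` over the segment, and the `L^p` distance between `u` and its
translate by the energy (`IsColocalWeakDerivOn.lintegral_edist_translate_le`). The translates can
be compared only as long as the segments stay in `D`. This is where the Lipschitz boundary enters:
`D` is a finite union of open sets `U`, each with small balls of vectors `h` along which all the
points of `U` can be moved inside `D` (`HasInwardBalls`). No extension of `u` across the boundary
is needed.

*Compactness.* The truncated distances of `u k` to the points of a dense sequence converge weakly
along a subsequence. By the estimate on translates they are uniformly close in `L¹` to their
averages over small balls of translations, which converge pointwise; hence they converge strongly,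
and almost everywhere along a further subsequence. With Fatou's lemma and properness, this gives
the almost everywhere convergence of the maps to some `v` (`exists_subseq_ae_tendsto`). Averaging
`d(u k, q₀)^p` over the same translations shows that these functions are uniformly integrable, and
convergence in `L^p` follows (`tendsto_lintegral_edist_rpow`).

*The derivative of the limit.* In local coordinates given by functions in `C^1_c(N)`
(`IsCoordinateSystem`), the components of `du k` are bounded in `L^p`, so that they converge
weakly in `L¹` along a subsequence. The weak limits define a field `dv`. For an arbitrary `F ∈
C^1_c(N)`, the derivative of `F ∘ u k` is a combination of these components with coefficients
which are continuous functions of `u k`; as `u k` converges almost everywhere, the relation passes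
to the weak limit (`IsCoordinateSystem.ae_dirDeriv_eq`), so `dv` is a colocal weak derivative of
`v`. The weak limit `Γ` of `|du k|` lies in `L^p` because `p > 1` (`TendstoWeakly.memLp`) and
dominates `|dv|` up to a constant (`IsColocalWeakDerivOn.exists_limit`).
-/

/-! ### Complete Riemannian manifolds are proper -/

/-- A complete, locally compact metric space in which every pair of points has approximate
intermediate points at all distances is proper: if not all closed balls around `x` were compact,
the closed ball of the critical radius would be compact, and hence so would be a larger one. -/
theorem ProperSpace.of_exists_intermediate {X : Type*} [MetricSpace X] [CompleteSpace X]
    [LocallyCompactSpace X]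
    (hX : ∀ (x y : X) (s t : ℝ), 0 ≤ s → 0 < t → dist x y < s + t →
      ∃ z, dist x z ≤ s ∧ dist z y < t) : ProperSpace X := by
  refine ⟨fun x => ?_⟩
  by_contra! hcon
  obtain ⟨r₁, hr₁⟩ := hcon
  have hmono : ∀ {r r' : ℝ}, r ≤ r' → IsCompact (Metric.closedBall x r') →
      IsCompact (Metric.closedBall x r) := fun h h' =>
    h'.of_isClosed_subset Metric.isClosed_closedBall (Metric.closedBall_subset_closedBall h)
  let S : Set ℝ := {r | IsCompact (Metric.closedBall x r)}
  have hS0 : (0 : ℝ) ∈ S := by simp [S]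
  have hSb : ∀ r ∈ S, r ≤ r₁ := fun r hr => by
    by_contra! h
    exact hr₁ (hmono h.le hr)
  have hbdd : BddAbove S := ⟨r₁, hSb⟩
  set R := sSup S with hR
  have hR0 : 0 ≤ R := le_csSup hbdd hS0
  have hlt : ∀ r < R, IsCompact (Metric.closedBall x r) := fun r hr => by
    obtain ⟨r', hr', h⟩ := exists_lt_of_lt_csSup ⟨0, hS0⟩ hr
    exact hmono h.le hr'
  -- the closed ball of critical radius is totally bounded, as it lies close to smaller balls
  have hRc : IsCompact (Metric.closedBall x R) := by
    rw [isCompact_iff_totallyBounded_isComplete]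
    refine ⟨?_, Metric.isClosed_closedBall.isComplete⟩
    rcases hR0.eq_or_lt with h0 | h0
    · rw [← h0]; simp
    rw [Metric.totallyBounded_iff]
    intro ε hε
    obtain ⟨η, hη0, hηε, hηR⟩ : ∃ η, 0 < η ∧ η < ε / 2 ∧ η < R :=
      ⟨min (ε / 2) R / 2, by positivity, by
        have := min_le_left (ε / 2) R; linarith [hε], by
        have := min_le_right (ε / 2) R; linarith⟩
    obtain ⟨t, ht, hcov⟩ := Metric.totallyBounded_iff.1 (hlt (R - η) (by linarith)).totallyBounded
      (ε / 2) (by positivity)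
    refine ⟨t, ht, fun y hy => ?_⟩
    obtain ⟨z, hz1, hz2⟩ := hX x y (R - η) (ε / 2) (by linarith) (by positivity) (by
      rw [Metric.mem_closedBall, dist_comm] at hy; linarith)
    have := hcov (show z ∈ Metric.closedBall x (R - η) by rwa [Metric.mem_closedBall, dist_comm])
    simp only [Set.mem_iUnion, exists_prop, Metric.mem_ball] at this ⊢
    obtain ⟨c, hc, hzc⟩ := this
    refine ⟨c, hc, ?_⟩
    have := dist_triangle y z c
    rw [dist_comm y z] at this
    linarith
  obtain ⟨K, hK, hKR⟩ := exists_compact_superset hRc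
  obtain ⟨δ, hδ, hδK⟩ := hRc.exists_thickening_subset_open isOpen_interior hKR
  have : R + δ / 2 ∈ S := by
    refine hK.of_isClosed_subset Metric.isClosed_closedBall fun y hy => interior_subset (hδK ?_)
    obtain ⟨z, hz1, hz2⟩ := hX x y R δ hR0 hδ (by
      rw [Metric.mem_closedBall, dist_comm] at hy; linarith)
    rw [Metric.mem_thickening_iff]
    exact ⟨z, by rwa [Metric.mem_closedBall, dist_comm], by rwa [dist_comm]⟩
  linarith [le_csSup hbdd this]

/-- A point of a Riemannian manifold at a given distance from `x`, lying on a path from `x` to `y`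
which is almost minimizing. -/
theorem exists_intermediate_of_isRiemannianManifold (n : ℕ) {N : Type*} [MetricSpace N]
    [ChartedSpace (EuclideanSpace ℝ (Fin n)) N] [IsManifold (𝓡 n) ∞ N]
    [RiemannianBundle (fun q : N => TangentSpace (𝓡 n) q)]
    [IsRiemannianManifold (𝓡 n) N] (x y : N) (s t : ℝ) (hs : 0 ≤ s) (ht : 0 < t)
    (hxy : dist x y < s + t) : ∃ z, dist x z ≤ s ∧ dist z y < t := by
  by_cases h : dist x y ≤ s
  · exact ⟨y, h, by simpa using ht⟩
  push Not at h
  have he : Manifold.riemannianEDist (𝓡 n) x y < ENNReal.ofReal (s + t) := by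
    rw [← IsRiemannianManifold.out (I := 𝓡 n) x y, edist_dist]
    exact (ENNReal.ofReal_lt_ofReal_iff (by linarith)).2 hxy
  obtain ⟨γ, hγ0, hγ1, hγ, hlen⟩ := Manifold.exists_lt_of_riemannianEDist_lt he
  have hc : ContinuousOn (fun τ => dist x (γ τ)) (Set.Icc 0 1) :=
    (continuous_const.dist continuous_id).comp_continuousOn hγ.continuousOn
  obtain ⟨τ, hτ, hτs⟩ := intermediate_value_Icc zero_le_one hc
    (show s ∈ Set.Icc (dist x (γ 0)) (dist x (γ 1)) by
      rw [hγ0, hγ1, dist_self]; exact ⟨hs, h.le⟩)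
  refine ⟨γ τ, hτs.le, ?_⟩
  have h1 : edist x (γ τ) ≤ Manifold.pathELength (𝓡 n) γ 0 τ := by
    rw [IsRiemannianManifold.out (I := 𝓡 n) x (γ τ)]
    exact Manifold.riemannianEDist_le_pathELength
      (hγ.mono (Set.Icc_subset_Icc_right hτ.2)) hγ0 rfl hτ.1
  have h2 : edist (γ τ) y ≤ Manifold.pathELength (𝓡 n) γ τ 1 := by
    rw [IsRiemannianManifold.out (I := 𝓡 n) (γ τ) y]
    exact Manifold.riemannianEDist_le_pathELength
      (hγ.mono (Set.Icc_subset_Icc_left hτ.1)) rfl hγ1 hτ.2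
  have h3 : edist x (γ τ) + edist (γ τ) y < ENNReal.ofReal (s + t) := by
    refine lt_of_le_of_lt (add_le_add h1 h2) ?_
    rwa [Manifold.pathELength_add hτ.1 hτ.2]
  rw [edist_dist, edist_dist, ← ENNReal.ofReal_add dist_nonneg dist_nonneg,
    ENNReal.ofReal_lt_ofReal_iff (by linarith)] at h3
  have : dist x (γ τ) = s := hτs
  linarith

/-- The part of the Hopf–Rinow theorem that is needed: a complete Riemannian manifold is proper. -/
theorem properSpace_of_isRiemannianManifold (n : ℕ) (N : Type*) [MetricSpace N]
    [ChartedSpace (EuclideanSpace ℝ (Fin n)) N] [IsManifold (𝓡 n) ∞ N]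
    [RiemannianBundle (fun q : N => TangentSpace (𝓡 n) q)]
    [IsRiemannianManifold (𝓡 n) N] [CompleteSpace N] : ProperSpace N := by
  have : LocallyCompactSpace N := Manifold.locallyCompact_of_finiteDimensional (𝓡 n)
  exact .of_exists_intermediate (exists_intermediate_of_isRiemannianManifold n)

/-! ### Charts adapted to the Riemannian metric -/

/-- The chart `c` of `N` is a `C^1` diffeomorphism onto a convex open set, whose differential `τ`
distorts the Riemannian norm by a factor at most `2`; moreover the Riemannian metric has continuous
coefficients in the chart. The maps `τ q` have to be isomorphisms at every `q`, but only their values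
over the source of `c` matter. -/
structure IsAdaptedChart {n : ℕ} {N : Type*} [TopologicalSpace N]
    [ChartedSpace (EuclideanSpace ℝ (Fin n)) N]
    [RiemannianBundle (fun q : N => TangentSpace (𝓡 n) q)]
    (c : OpenPartialHomeomorph N (EuclideanSpace ℝ (Fin n)))
    (τ : ∀ q : N, TangentSpace (𝓡 n) q ≃L[ℝ] EuclideanSpace ℝ (Fin n)) : Prop where
  contMDiffOn : ContMDiffOn (𝓡 n) (𝓡 n) 1 c c.source
  contMDiffOn_symm : ContMDiffOn (𝓡 n) (𝓡 n) 1 c.symm c.target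
  convex_target : Convex ℝ c.target
  mfderiv_eq : ∀ q ∈ c.source, ∀ ξ : TangentSpace (𝓡 n) q, mfderiv (𝓡 n) (𝓡 n) c q ξ = τ q ξ
  norm_le : ∀ q ∈ c.source, ∀ ξ : TangentSpace (𝓡 n) q, ‖τ q ξ‖ ≤ 2 * ‖ξ‖
  le_norm : ∀ q ∈ c.source, ∀ ξ : TangentSpace (𝓡 n) q, ‖ξ‖ ≤ 2 * ‖τ q ξ‖
  metric : ∃ g : Fin n → Fin n → N → ℝ, (∀ i j, ContinuousOn (g i j) c.source) ∧
    ∀ q ∈ c.source, ∀ ξ : TangentSpace (𝓡 n) q,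
      ‖ξ‖ ^ 2 = ∑ i, ∑ j, g i j q * τ q ξ i * τ q ξ j

section AdaptedChart

variable {n : ℕ} {N : Type*} [TopologicalSpace N]
    [ChartedSpace (EuclideanSpace ℝ (Fin n)) N] [IsManifold (𝓡 n) ∞ N]
    [RiemannianBundle (fun q : N => TangentSpace (𝓡 n) q)]
    [IsContinuousRiemannianBundle (EuclideanSpace ℝ (Fin n))
      (fun q : N => TangentSpace (𝓡 n) q)]

theorem norm_sq_sum_smul {V ι : Type*} [Fintype ι] [NormedAddCommGroup V] [InnerProductSpace ℝ V]
    (a : ι → ℝ) (v : ι → V) :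
    ‖∑ i, a i • v i‖ ^ 2 = ∑ i, ∑ j, inner ℝ (v i) (v j) * a i * a j := by
  rw [← real_inner_self_eq_norm_sq, sum_inner]
  simp only [inner_sum, real_inner_smul_left, real_inner_smul_right]
  refine Finset.sum_congr rfl fun i _ => Finset.sum_congr rfl fun j _ => by ring

/-- Adapted charts exist around every point: compose the preferred chart at `x` with a linear map
that makes its differential at `x` isometric, and restrict it to the preimage of a small ball. -/
theorem exists_isAdaptedChart (x : N) :
    ∃ (c : OpenPartialHomeomorph N (EuclideanSpace ℝ (Fin n)))
      (τ : ∀ q : N, TangentSpace (𝓡 n) q ≃L[ℝ] EuclideanSpace ℝ (Fin n)),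
      IsAdaptedChart c τ ∧ x ∈ c.source := by
  set T := trivializationAt (EuclideanSpace ℝ (Fin n)) (fun q : N => TangentSpace (𝓡 n) q) x
  have hx : x ∈ T.baseSet := FiberBundle.mem_baseSet_trivializationAt' x
  have hfr : Module.finrank ℝ (TangentSpace (𝓡 n) x) = n := by
    have := (T.continuousLinearEquivAt ℝ x hx).toLinearEquiv.finrank_eq
    rw [this]; simp
  have : FiniteDimensional ℝ (TangentSpace (𝓡 n) x) :=
    (T.continuousLinearEquivAt ℝ x hx).symm.toLinearEquiv.finiteDimensional
  let Λ : TangentSpace (𝓡 n) x ≃ₗᵢ[ℝ] EuclideanSpace ℝ (Fin n) :=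
    ((stdOrthonormalBasis ℝ (TangentSpace (𝓡 n) x)).reindex (finCongr hfr)).repr
  let A : EuclideanSpace ℝ (Fin n) ≃L[ℝ] EuclideanSpace ℝ (Fin n) :=
    (T.continuousLinearEquivAt ℝ x hx).symm.trans Λ.toContinuousLinearEquiv
  have h1 := eventually_norm_symmL_trivializationAt_self_comp_lt (EuclideanSpace ℝ (Fin n))
    (fun q : N => TangentSpace (𝓡 n) q) x one_lt_two
  have h2 := eventually_norm_symmL_trivializationAt_comp_self_lt (EuclideanSpace ℝ (Fin n))
    (fun q : N => TangentSpace (𝓡 n) q) x one_lt_two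
  have h3 : (chartAt (EuclideanSpace ℝ (Fin n)) x).source ∈ 𝓝 x := chart_source_mem_nhds _ x
  let c₁ := (chartAt (EuclideanSpace ℝ (Fin n)) x).transHomeomorph A.toHomeomorph
  have hxc₁ : x ∈ c₁.source := mem_chart_source _ x
  obtain ⟨r, hr, hrs⟩ := Metric.mem_nhds_iff.1 (c₁.symm.continuousAt (c₁.map_source hxc₁)
    (by rw [c₁.left_inv hxc₁]; exact inter_mem (inter_mem h1 h2) h3))
  have hrt : Metric.ball (c₁ x) r ∩ c₁.target ∈ 𝓝 (c₁ x) :=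
    inter_mem (Metric.ball_mem_nhds _ hr) (c₁.open_target.mem_nhds (c₁.map_source hxc₁))
  obtain ⟨r', hr', hrs'⟩ := Metric.mem_nhds_iff.1 hrt
  let c := (c₁.symm.restrOpen (Metric.ball (c₁ x) r') Metric.isOpen_ball).symm
  have hct : c.target = Metric.ball (c₁ x) r' := by
    simp only [c, OpenPartialHomeomorph.symm_target, OpenPartialHomeomorph.restrOpen_source]
    exact Set.inter_eq_right.2 fun y hy => (hrs' hy).2
  have hcs' : c.source = c₁.source ∩ c₁ ⁻¹' Metric.ball (c₁ x) r' := by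
    simp only [c, OpenPartialHomeomorph.symm_source]
    rw [OpenPartialHomeomorph.restrOpen_toPartialEquiv, PartialEquiv.restr_target]
    rfl
  have hcs : c.source ⊆ c₁.source := hcs' ▸ Set.inter_subset_left
  have hnear : ∀ q ∈ c.source, ‖T.symmL ℝ x ∘L T.continuousLinearMapAt ℝ q‖ < 2 ∧
      ‖T.symmL ℝ q ∘L T.continuousLinearMapAt ℝ x‖ < 2 := by
    intro q hq
    rw [hcs'] at hq
    have := hrs (hrs' hq.2).1
    rw [Set.mem_preimage, c₁.left_inv hq.1] at this
    exact this.1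
  have hsb : ∀ q ∈ c.source, q ∈ T.baseSet := fun q hq => hcs hq
  classical
  let τ : ∀ q : N, TangentSpace (𝓡 n) q ≃L[ℝ] EuclideanSpace ℝ (Fin n) := fun q =>
    if hq : q ∈ T.baseSet then (T.continuousLinearEquivAt ℝ q hq).trans A
    else (trivializationAt (EuclideanSpace ℝ (Fin n))
      (fun q : N => TangentSpace (𝓡 n) q) q).continuousLinearEquivAt ℝ q
      (FiberBundle.mem_baseSet_trivializationAt' q)
  have hτ : ∀ q ∈ c.source, ∀ ξ : TangentSpace (𝓡 n) q,
      τ q ξ = A (T.continuousLinearMapAt ℝ q ξ) := by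
    intro q hq ξ
    simp only [τ]
    rw [dif_pos (hsb q hq)]
    rw [ContinuousLinearEquiv.trans_apply, Trivialization.coe_continuousLinearEquivAt_eq]
  have hτ' : ∀ q ∈ c.source, ∀ ξ : TangentSpace (𝓡 n) q,
      ‖τ q ξ‖ = ‖(T.symmL ℝ x) (T.continuousLinearMapAt ℝ q ξ)‖ := by
    intro q hq ξ
    rw [hτ q hq]
    have := Λ.norm_map ((T.continuousLinearEquivAt ℝ x hx).symm (T.continuousLinearMapAt ℝ q ξ))
    rw [Trivialization.symm_continuousLinearEquivAt_eq] at this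
    refine Eq.trans ?_ this
    simp only [A, ContinuousLinearEquiv.trans_apply]
    rw [Trivialization.symm_continuousLinearEquivAt_eq]
    rfl
  refine ⟨c, τ, ⟨?_, ?_, ?_, ?_, ?_, ?_, ?_⟩, ?_⟩
  · have : ContMDiffOn (𝓡 n) (𝓡 n) 1 c₁ c₁.source := by
      refine A.contDiff.contMDiff.comp_contMDiffOn (contMDiffOn_chart)
    exact this.mono hcs
  · have : ContMDiffOn (𝓡 n) (𝓡 n) 1 c₁.symm c₁.target := by
      refine (contMDiffOn_chart_symm).comp A.symm.contDiff.contMDiff.contMDiffOn fun y hy => hy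
    exact this.mono (hct ▸ fun y hy => (hrs' hy).2)
  · rw [hct]; exact convex_ball _ _
  · intro q hq ξ
    rw [hτ q hq, TangentBundle.continuousLinearMapAt_trivializationAt (hsb q hq)]
    have h5 : MDifferentiableAt (𝓡 n) (𝓡 n) (extChartAt (𝓡 n) x) q :=
      mdifferentiableAt_extChartAt (hsb q hq)
    have h6 := h5.hasMFDerivAt
    have h7 := (A : EuclideanSpace ℝ (Fin n) →L[ℝ] EuclideanSpace ℝ (Fin n)).hasMFDerivAt
      (x := extChartAt (𝓡 n) x q)
    have h8 := (h7.comp q h6).mfderiv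
    exact congr($h8 ξ)
  · intro q hq ξ
    rw [hτ' q hq]
    have h4 := ContinuousLinearMap.le_of_opNorm_le (T.symmL ℝ x ∘L T.continuousLinearMapAt ℝ q)
      (hnear q hq).1.le ξ
    exact h4
  · intro q hq ξ
    rw [hτ' q hq]
    have h4 := ContinuousLinearMap.le_of_opNorm_le (T.symmL ℝ q ∘L T.continuousLinearMapAt ℝ x)
      (hnear q hq).2.le (T.symmL ℝ x (T.continuousLinearMapAt ℝ q ξ))
    rw [ContinuousLinearMap.comp_apply, T.continuousLinearMapAt_symmL hx,
      T.symmL_continuousLinearMapAt (hsb q hq)] at h4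
    exact h4
  -- the coefficients of the metric: the frame given by the trivialization is continuous
  · let b : Fin n → EuclideanSpace ℝ (Fin n) := fun i => A.symm (EuclideanSpace.basisFun (Fin n) ℝ i)
    have hb : ∀ i, ContinuousOn
        (fun q => (⟨q, T.symm q (b i)⟩ : TotalSpace (EuclideanSpace ℝ (Fin n))
        (fun q : N => TangentSpace (𝓡 n) q))) T.baseSet := fun i =>
      T.continuousOn_symm.comp (continuousOn_id.prodMk continuousOn_const)
        fun q hq => ⟨hq, Set.mem_univ _⟩
    refine ⟨fun i j q => inner ℝ (T.symm q (b i)) (T.symm q (b j)), fun i j =>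
      ((hb i).inner_bundle (hb j)).mono hsb, fun q hq ξ => ?_⟩
    have h5 : ξ = ∑ i, τ q ξ i • T.symmL ℝ q (b i) := by
      have h6 : T.continuousLinearMapAt ℝ q ξ = ∑ i, τ q ξ i • b i := by
        apply A.injective
        rw [← hτ q hq]
        simp only [map_sum, map_smul, b, A.apply_symm_apply]
        exact ((EuclideanSpace.basisFun (Fin n) ℝ).sum_repr (τ q ξ)).symm
      calc ξ = T.symmL ℝ q (T.continuousLinearMapAt ℝ q ξ) :=
            (T.symmL_continuousLinearMapAt (hsb q hq) ξ).symm
        _ = T.symmL ℝ q (∑ i, τ q ξ i • b i) := by rw [h6]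
        _ = _ := by simp only [map_sum, map_smul]
    have h7 := norm_sq_sum_smul (fun i => τ q ξ i) (fun i => T.symmL ℝ q (b i))
    rw [← h5] at h7
    simp only [T.symmL_apply (hsb q hq)] at h7
    exact h7
  · rw [hcs']; exact ⟨hxc₁, Metric.mem_ball_self hr'⟩

end AdaptedChart

namespace IsAdaptedChart

variable {n : ℕ} {N : Type*}

section Topological

variable [TopologicalSpace N]
    [ChartedSpace (EuclideanSpace ℝ (Fin n)) N]
    [RiemannianBundle (fun q : N => TangentSpace (𝓡 n) q)]
    {c : OpenPartialHomeomorph N (EuclideanSpace ℝ (Fin n))}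
    {τ : ∀ q : N, TangentSpace (𝓡 n) q ≃L[ℝ] EuclideanSpace ℝ (Fin n)}

theorem mdifferentiableAt (h : IsAdaptedChart c τ) {q : N} (hq : q ∈ c.source) :
    MDifferentiableAt (𝓡 n) (𝓡 n) c q :=
  ((h.contMDiffOn q hq).contMDiffAt (c.open_source.mem_nhds hq)).mdifferentiableAt one_ne_zero

theorem mdifferentiableAt_symm (h : IsAdaptedChart c τ) {a : EuclideanSpace ℝ (Fin n)}
    (ha : a ∈ c.target) : MDifferentiableAt (𝓡 n) (𝓡 n) c.symm a :=
  ((h.contMDiffOn_symm a ha).contMDiffAt (c.open_target.mem_nhds ha)).mdifferentiableAt one_ne_zero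

theorem mfderiv_comp (h : IsAdaptedChart c τ) {q : N} (hq : q ∈ c.source)
    {G : EuclideanSpace ℝ (Fin n) → ℝ} (hG : DifferentiableAt ℝ G (c q))
    (ξ : TangentSpace (𝓡 n) q) :
    mfderiv (𝓡 n) 𝓘(ℝ, ℝ) (fun y => G (c y)) q ξ = fderiv ℝ G (c q) (τ q ξ) := by
  have h1 := (hG.hasFDerivAt.hasMFDerivAt.comp q (h.mdifferentiableAt hq).hasMFDerivAt).mfderiv
  refine (congr($h1 ξ)).trans ?_
  rw [← h.mfderiv_eq q hq ξ]
  rfl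

theorem mfderiv_apply (h : IsAdaptedChart c τ) {q : N} (hq : q ∈ c.source) {f : N → ℝ}
    (hf : MDifferentiableAt (𝓡 n) 𝓘(ℝ, ℝ) f q) (ξ : TangentSpace (𝓡 n) q) :
    mfderiv (𝓡 n) 𝓘(ℝ, ℝ) f q ξ = fderiv ℝ (fun a => f (c.symm a)) (c q) (τ q ξ) := by
  have hd : DifferentiableAt ℝ (fun a => f (c.symm a)) (c q) := by
    rw [← mdifferentiableAt_iff_differentiableAt]
    have := h.mdifferentiableAt_symm (c.map_source hq)
    rw [← c.left_inv hq] at hf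
    exact hf.comp (c q) this
  rw [← h.mfderiv_comp hq hd]
  have : f =ᶠ[𝓝 q] fun y => f (c.symm (c y)) := by
    filter_upwards [c.open_source.mem_nhds hq] with y hy
    rw [c.left_inv hy]
  rw [this.mfderiv_eq]
  rfl

theorem contDiffOn_comp_symm (h : IsAdaptedChart c τ) {f : N → ℝ}
    (hf : ContMDiff (𝓡 n) 𝓘(ℝ, ℝ) 1 f) : ContDiffOn ℝ 1 (fun a => f (c.symm a)) c.target := by
  rw [← contMDiffOn_iff_contDiffOn]
  exact hf.comp_contMDiffOn h.contMDiffOn_symm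

theorem norm_mfderiv_symm_le (h : IsAdaptedChart c τ) {a : EuclideanSpace ℝ (Fin n)}
    (ha : a ∈ c.target) (v : EuclideanSpace ℝ (Fin n)) :
    ‖(mfderiv (𝓡 n) (𝓡 n) c.symm a v : TangentSpace (𝓡 n) (c.symm a))‖ ≤ 2 * ‖v‖ := by
  refine (h.le_norm _ (c.map_target ha) _).trans_eq ?_
  rw [← h.mfderiv_eq _ (c.map_target ha)]
  have h1 := ((h.mdifferentiableAt (c.map_target ha)).hasMFDerivAt.comp a
    (h.mdifferentiableAt_symm ha).hasMFDerivAt).mfderiv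
  have h2 : (c ∘ c.symm) =ᶠ[𝓝 a] id := by
    filter_upwards [c.open_target.mem_nhds ha] with y hy
    exact c.right_inv hy
  rw [h2.mfderiv_eq, mfderiv_id] at h1
  have h3 := congr($h1 v)
  have h4 : mfderiv (𝓡 n) (𝓡 n) c (c.symm a) (mfderiv (𝓡 n) (𝓡 n) c.symm a v) = v := h3.symm
  rw [h4]

end Topological

variable [MetricSpace N]
    [ChartedSpace (EuclideanSpace ℝ (Fin n)) N]
    [RiemannianBundle (fun q : N => TangentSpace (𝓡 n) q)]
    [IsRiemannianManifold (𝓡 n) N]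
    {c : OpenPartialHomeomorph N (EuclideanSpace ℝ (Fin n))}
    {τ : ∀ q : N, TangentSpace (𝓡 n) q ≃L[ℝ] EuclideanSpace ℝ (Fin n)}

/-- The inverse of an adapted chart is Lipschitz, since the images of the segments in the convex
target have a controlled Riemannian length. -/
theorem lipschitzOnWith_symm (h : IsAdaptedChart c τ) : LipschitzOnWith 2 c.symm c.target := by
  intro a ha b hb
  let η := ContinuousAffineMap.lineMap (R := ℝ) a b
  have hη : Set.Icc 0 1 ⊆ η ⁻¹' c.target := by
    rw [← Set.image_subset_iff, ContinuousAffineMap.coe_lineMap_eq, ← segment_eq_image_lineMap]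
    exact h.convex_target.segment_subset ha hb
  have η_smooth : ContMDiffOn 𝓘(ℝ, ℝ) (𝓡 n) 1 η (Set.Icc 0 1) := by
    apply ContMDiff.contMDiffOn
    rw [contMDiff_iff_contDiff]
    exact ContinuousAffineMap.contDiff _
  have h1 : Manifold.riemannianEDist (𝓡 n) (c.symm a) (c.symm b) ≤
      Manifold.pathELength (𝓡 n) (c.symm ∘ η) 0 1 := by
    apply Manifold.riemannianEDist_le_pathELength _ _ _ zero_le_one
    · exact h.contMDiffOn_symm.comp η_smooth hη
    · simp [η, ContinuousAffineMap.coe_lineMap_eq]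
    · simp [η, ContinuousAffineMap.coe_lineMap_eq]
  rw [IsRiemannianManifold.out (I := 𝓡 n)]
  refine h1.trans ?_
  rw [← lintegral_fderiv_lineMap_eq_edist,
    Manifold.pathELength_eq_lintegral_mfderivWithin_Icc,
    ← lintegral_const_mul' _ _ ENNReal.coe_ne_top]
  apply setLIntegral_mono' measurableSet_Icc (fun t ht ↦ ?_)
  have h2 : mfderivWithin 𝓘(ℝ, ℝ) (𝓡 n) (c.symm ∘ η) (Set.Icc 0 1) t =
      (mfderiv (𝓡 n) (𝓡 n) c.symm (η t)) ∘L
        (mfderivWithin 𝓘(ℝ, ℝ) (𝓡 n) η (Set.Icc 0 1) t) := by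
    apply mfderiv_comp_mfderivWithin
    · exact h.mdifferentiableAt_symm (hη ht)
    · exact η_smooth.mdifferentiableOn one_ne_zero t ht
    · rw [uniqueMDiffWithinAt_iff_uniqueDiffWithinAt]
      exact uniqueDiffOn_Icc zero_lt_one t ht
  have h3 : mfderivWithin 𝓘(ℝ, ℝ) (𝓡 n) (c.symm ∘ η) (Set.Icc 0 1) t 1 =
      (mfderiv (𝓡 n) (𝓡 n) c.symm (η t))
        (mfderivWithin 𝓘(ℝ, ℝ) (𝓡 n) η (Set.Icc 0 1) t 1) := congr($h2 1)
  rw [h3]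
  have h4 := h.norm_mfderiv_symm_le (hη ht) (mfderivWithin 𝓘(ℝ, ℝ) (𝓡 n) η (Set.Icc 0 1) t 1)
  rw [mfderivWithin_eq_fderivWithin] at h4 ⊢
  rw [← ofReal_norm, ← ofReal_norm, ← ENNReal.ofReal_coe_nnreal,
    ← ENNReal.ofReal_mul (by positivity)]
  exact ENNReal.ofReal_le_ofReal h4

end IsAdaptedChart

/-! ### Gradient bounds and local smoothing -/

section DirDeriv

variable {n : ℕ} {N : Type*} [TopologicalSpace N]
    [ChartedSpace (EuclideanSpace ℝ (Fin n)) N]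

/-- The derivative `df_q(ξ)` of a real function `f` at `q` in the direction `ξ ∈ T_q N`, as a real
number. -/
noncomputable def dirDeriv (f : N → ℝ) (q : N) (ξ : TangentSpace (𝓡 n) q) : ℝ :=
  mfderiv (𝓡 n) 𝓘(ℝ, ℝ) f q ξ

theorem dirDeriv_eq_zero_of_notMem_tsupport {f : N → ℝ} {q : N} (hq : q ∉ tsupport f)
    (ξ : TangentSpace (𝓡 n) q) : dirDeriv f q ξ = 0 := by
  have h1 : f =ᶠ[𝓝 q] fun _ => 0 := notMem_tsupport_iff_eventuallyEq.1 hq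
  unfold dirDeriv
  rw [h1.mfderiv_eq, mfderiv_const]
  rfl

variable [RiemannianBundle (fun q : N => TangentSpace (𝓡 n) q)]

variable (n) in
/-- The differential of `f` has norm at most `L` everywhere, for the Riemannian metric. -/
def HasGradientBound (f : N → ℝ) (L : ℝ) : Prop :=
  ∀ (q : N) (ξ : TangentSpace (𝓡 n) q), |dirDeriv f q ξ| ≤ L * ‖ξ‖

theorem IsAdaptedChart.dirDeriv_eq {c : OpenPartialHomeomorph N (EuclideanSpace ℝ (Fin n))}
    {τ : ∀ q : N, TangentSpace (𝓡 n) q ≃L[ℝ] EuclideanSpace ℝ (Fin n)}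
    (h : IsAdaptedChart c τ) {q : N} (hq : q ∈ c.source) {f : N → ℝ}
    (hf : ContMDiff (𝓡 n) 𝓘(ℝ, ℝ) 1 f) (ξ : TangentSpace (𝓡 n) q) :
    dirDeriv f q ξ = fderiv ℝ (fun a => f (c.symm a)) (c q) (τ q ξ) :=
  h.mfderiv_apply hq (hf.mdifferentiable one_ne_zero q) ξ

variable [IsManifold (𝓡 n) ∞ N]
    [IsContinuousRiemannianBundle (EuclideanSpace ℝ (Fin n))
      (fun q : N => TangentSpace (𝓡 n) q)]

theorem exists_hasGradientBound {f : N → ℝ} (hf : ContMDiff (𝓡 n) 𝓘(ℝ, ℝ) 1 f)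
    (hfc : HasCompactSupport f) : ∃ L, 0 ≤ L ∧ HasGradientBound n f L := by
  have key : ∃ L, 0 ≤ L ∧ ∀ q ∈ tsupport f, ∀ ξ : TangentSpace (𝓡 n) q,
      |dirDeriv f q ξ| ≤ L * ‖ξ‖ := by
    refine hfc.isCompact.induction_on (p := fun s => ∃ L, 0 ≤ L ∧ ∀ q ∈ s,
      ∀ ξ : TangentSpace (𝓡 n) q, |dirDeriv f q ξ| ≤ L * ‖ξ‖) ⟨0, le_rfl, by simp⟩ ?_ ?_ ?_
    · rintro s t hst ⟨L, hL, h⟩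
      exact ⟨L, hL, fun q hq => h q (hst hq)⟩
    · rintro s t ⟨L, hL, h⟩ ⟨L', hL', h'⟩
      refine ⟨max L L', le_max_of_le_left hL, fun q hq ξ => ?_⟩
      rcases hq with hq | hq
      · exact (h q hq ξ).trans (by gcongr; exact le_max_left _ _)
      · exact (h' q hq ξ).trans (by gcongr; exact le_max_right _ _)
    · intro x _
      obtain ⟨c, τ, h, hx⟩ := exists_isAdaptedChart (n := n) x
      have hcont : ContinuousAt (fun q => fderiv ℝ (fun a => f (c.symm a)) (c q)) x := by
        have h1 := (h.contDiffOn_comp_symm hf).continuousOn_fderiv_of_isOpen c.open_target le_rfl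
        exact ContinuousAt.comp (h1.continuousAt (c.open_target.mem_nhds (c.map_source hx)))
          (c.continuousAt hx)
      set B := ‖fderiv ℝ (fun a => f (c.symm a)) (c x)‖ + 1 with hB
      have h2 : ∀ᶠ q in 𝓝 x, ‖fderiv ℝ (fun a => f (c.symm a)) (c q)‖ < B :=
        hcont.norm.eventually_lt_const (by rw [hB]; linarith)
      have hB0 : 0 ≤ B := by positivity
      refine ⟨_, mem_nhdsWithin_of_mem_nhds (inter_mem h2 (c.open_source.mem_nhds hx)),
        B * 2, by positivity, fun q hq ξ => ?_⟩
      rw [h.dirDeriv_eq hq.2 hf, ← Real.norm_eq_abs, mul_assoc]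
      exact (ContinuousLinearMap.le_opNorm _ _).trans
        (mul_le_mul (le_of_lt hq.1) (h.norm_le q hq.2 ξ) (norm_nonneg _) hB0)
  obtain ⟨L, hL, h⟩ := key
  refine ⟨L, hL, fun q ξ => ?_⟩
  by_cases hq : q ∈ tsupport f
  · exact h q hq ξ
  · rw [dirDeriv_eq_zero_of_notMem_tsupport hq, abs_zero]; positivity

end DirDeriv

open scoped Convolution in
/-- Lipschitz functions on `ℝ^n` are approximated uniformly by their mollifications, which have the
same Lipschitz constant. -/
theorem LipschitzWith.exists_contDiff_approx {n : ℕ} {K : ℝ≥0}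
    {F : EuclideanSpace ℝ (Fin n) → ℝ} (hF : LipschitzWith K F) {ε : ℝ} (hε : 0 < ε) :
    ∃ G : EuclideanSpace ℝ (Fin n) → ℝ, ContDiff ℝ 1 G ∧ LipschitzWith K G ∧
      ∀ a, |G a - F a| ≤ ε := by
  set δ := ε / (K + 1) with hδ
  have hδ0 : 0 < δ := by positivity
  let φ : ContDiffBump (0 : EuclideanSpace ℝ (Fin n)) := ⟨δ / 2, δ, by positivity, by linarith⟩
  let G := φ.normed volume ⋆[ContinuousLinearMap.lsmul ℝ ℝ, volume] F
  have hex : ∀ a, Integrable (fun t => φ.normed volume t * F (a - t)) volume := fun a =>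
    (φ.continuous_normed.mul (hF.continuous.comp (by fun_prop))).integrable_of_hasCompactSupport
      (φ.hasCompactSupport_normed.mul_right)
  refine ⟨G, ?_, ?_, ?_⟩
  · exact φ.hasCompactSupport_normed.contDiff_convolution_left _ φ.contDiff_normed
      hF.continuous.locallyIntegrable
  · refine LipschitzWith.of_dist_le_mul fun a b => ?_
    have hG : ∀ a, G a = ∫ t, φ.normed volume t * F (a - t) := fun a => rfl
    rw [Real.dist_eq, hG, hG, ← integral_sub (hex a) (hex b), ← Real.norm_eq_abs]
    refine (norm_integral_le_of_norm_le (g := fun t => φ.normed volume t * (K * dist a b))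
      (φ.integrable_normed.mul_const _) (ae_of_all _ fun t => ?_)).trans_eq ?_
    · rw [← mul_sub, norm_mul, Real.norm_of_nonneg (φ.nonneg_normed t)]
      refine mul_le_mul_of_nonneg_left ?_ (φ.nonneg_normed t)
      have := hF.dist_le_mul (a - t) (b - t)
      rwa [dist_sub_right, Real.dist_eq, ← Real.norm_eq_abs] at this
    · rw [integral_mul_const, φ.integral_normed, one_mul]
  · intro a
    rw [← Real.dist_eq]
    refine φ.dist_normed_convolution_le hF.continuous.aestronglyMeasurable fun x hx => ?_
    refine (hF.dist_le_mul x a).trans ?_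
    have h1 : dist x a ≤ δ := le_of_lt hx
    calc (K : ℝ) * dist x a ≤ (K + 1) * δ := by gcongr; linarith
      _ = ε := by rw [hδ]; field_simp

section

variable {n : ℕ} {N : Type*} [MetricSpace N]
    [ChartedSpace (EuclideanSpace ℝ (Fin n)) N]
    [RiemannianBundle (fun q : N => TangentSpace (𝓡 n) q)]
    [IsRiemannianManifold (𝓡 n) N]
    {c : OpenPartialHomeomorph N (EuclideanSpace ℝ (Fin n))}
    {τ : ∀ q : N, TangentSpace (𝓡 n) q ≃L[ℝ] EuclideanSpace ℝ (Fin n)}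

theorem IsAdaptedChart.exists_contDiff_approx (h : IsAdaptedChart c τ) {f : N → ℝ}
    (hf : LipschitzWith 1 f) {ε : ℝ} (hε : 0 < ε) :
    ∃ G : EuclideanSpace ℝ (Fin n) → ℝ, ContDiff ℝ 1 G ∧ (∀ a, ‖fderiv ℝ G a‖ ≤ 2) ∧
      ∀ q ∈ c.source, |G (c q) - f q| ≤ ε := by
  obtain ⟨F, hF, hFf⟩ := (hf.comp_lipschitzOnWith h.lipschitzOnWith_symm).extend_real
  obtain ⟨G, hG, hGL, hGF⟩ := hF.exists_contDiff_approx hε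
  refine ⟨G, hG, fun a => ?_, fun q hq => ?_⟩
  · simpa using norm_fderiv_le_of_lipschitz ℝ (x₀ := a) hGL
  · have := hGF (c q)
    rwa [← hFf (c.map_source hq), Function.comp_apply, c.left_inv hq] at this

end

/-! ### Smooth approximation of the truncated distance functions -/

/-- The functions `Φ m ∈ C^1_c(N)` have gradients bounded by `5` and approximate the truncated
distance functions. -/
structure IsApproxFamily (n : ℕ) {N : Type*} [MetricSpace N]
    [ChartedSpace (EuclideanSpace ℝ (Fin n)) N]
    [RiemannianBundle (fun q : N => TangentSpace (𝓡 n) q)] (Φ : ℕ → N → ℝ) : Prop where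
  contMDiff : ∀ m, ContMDiff (𝓡 n) 𝓘(ℝ, ℝ) 1 (Φ m)
  hasCompactSupport : ∀ m, HasCompactSupport (Φ m)
  hasGradientBound : ∀ m, HasGradientBound n (Φ m) 5
  exists_approx : ∀ (q : N) (R δ : ℝ), 0 < R → 0 < δ → ∃ m, ∀ b, |Φ m b - max (R - dist b q) 0| ≤ δ

section

variable {n : ℕ} {N : Type*} [MetricSpace N] [SecondCountableTopology N] [ProperSpace N]
    [ChartedSpace (EuclideanSpace ℝ (Fin n)) N] [IsManifold (𝓡 n) ∞ N]
    [RiemannianBundle (fun q : N => TangentSpace (𝓡 n) q)]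
    [IsContinuousRiemannianBundle (EuclideanSpace ℝ (Fin n))
      (fun q : N => TangentSpace (𝓡 n) q)]
    [IsRiemannianManifold (𝓡 n) N]

/-- A compactly supported `1`-Lipschitz function `f` on `N` is approximated uniformly by `C^1_c`
functions with a universal gradient bound. Local smoothings `G i` of `f` in adapted charts are glued
by a partition of unity `ρ i`: as `∑ ρ i = 1` where `f ≠ 0`, the differential of `∑ ρ i * G i`
differs from `∑ ρ i * dG i` by `∑ (G i - f) * dρ i`, which is small if the `G i` are close to `f`. -/
theorem exists_contMDiff_approx {f : N → ℝ} (hf : LipschitzWith 1 f) (hfc : HasCompactSupport f)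
    {ε : ℝ} (hε : 0 < ε) :
    ∃ F : N → ℝ, ContMDiff (𝓡 n) 𝓘(ℝ, ℝ) 1 F ∧ HasCompactSupport F ∧ HasGradientBound n F 5 ∧
      ∀ q, |F q - f q| ≤ ε := by
  classical
  choose c τ hc hxc using fun x : N => exists_isAdaptedChart (n := n) x
  obtain ⟨ρ, hρ⟩ := SmoothPartitionOfUnity.exists_isSubordinate (𝓡 n) (s := Set.univ)
    isClosed_univ (fun x : N => (c x).source ∩ Metric.ball x 1)
    (fun x => (c x).open_source.inter Metric.isOpen_ball)
    (fun x _ => Set.mem_iUnion.2 ⟨x, hxc x, Metric.mem_ball_self one_pos⟩)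
  have hρ1 : ∀ i, ContMDiff (𝓡 n) 𝓘(ℝ, ℝ) 1 (ρ i) := fun i => (ρ i).contMDiff.of_le (by simp)
  have hρc : ∀ i, HasCompactSupport (ρ i) := fun i =>
    (isCompact_closedBall i 1).of_isClosed_subset (isClosed_tsupport _)
      ((hρ i).trans (Set.inter_subset_right.trans Metric.ball_subset_closedBall))
  have hfin : {i | (Function.support (ρ i) ∩ tsupport f).Nonempty}.Finite :=
    ρ.locallyFinite.finite_nonempty_inter_compact hfc.isCompact
  let s := hfin.toFinset
  have hsum : ∀ q, f q ≠ 0 → ∑ i ∈ s, ρ i q = 1 := by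
    intro q hq
    rw [← ρ.sum_eq_one (Set.mem_univ q)]
    refine (finsum_eq_sum_of_support_subset _ fun i hi => ?_).symm
    simp only [s, Set.Finite.coe_toFinset, Set.mem_ofPred_eq]
    exact ⟨q, hi, subset_tsupport _ hq⟩
  have hsum_le : ∀ q, ∑ i ∈ s, ρ i q ≤ 1 := by
    intro q
    refine le_trans ?_ (ρ.sum_le_one q)
    rw [finsum_eq_sum_of_support_subset (s := s ∪ (ρ.locallyFinite.point_finite q).toFinset)]
    · exact Finset.sum_le_sum_of_subset_of_nonneg Finset.subset_union_left
        fun i _ _ => ρ.nonneg i q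
    · intro i hi
      simpa using Or.inr hi
  choose L hL0 hL using fun i => exists_hasGradientBound (n := n) (hρ1 i) (hρc i)
  set B := 1 + ∑ i ∈ s, L i with hB
  have hB1 : 1 ≤ B := by
    have := Finset.sum_nonneg fun i (_ : i ∈ s) => hL0 i
    linarith
  set η := min ε (1 / B) with hη
  have hη0 : 0 < η := by positivity
  choose G hG hG2 hGf using fun i => (hc i).exists_contDiff_approx hf hη0
  let F : N → ℝ := fun q => ∑ i ∈ s, ρ i q * G i (c i q)
  have hterm : ∀ i, ContMDiff (𝓡 n) 𝓘(ℝ, ℝ) 1 (fun q => ρ i q * G i (c i q)) := by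
    intro i
    refine contMDiff_of_tsupport fun q hq => ?_
    have hq' : q ∈ (c i).source := (hρ i (tsupport_mul_subset_left hq)).1
    have h1 : ContMDiffAt (𝓡 n) 𝓘(ℝ, ℝ) 1 (fun q => G i (c i q)) q :=
      ((hG i).contMDiff.contMDiffAt (x := c i q)).comp q
        (((hc i).contMDiffOn q hq').contMDiffAt ((c i).open_source.mem_nhds hq'))
    exact (hρ1 i q).mul h1
  have hF : ContMDiff (𝓡 n) 𝓘(ℝ, ℝ) 1 F := contMDiff_finsetSum fun i _ => hterm i
  refine ⟨F, hF, ?_, ?_, ?_⟩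
  · refine HasCompactSupport.intro (s.isCompact_biUnion fun i _ => (hρc i).isCompact) fun q hq => ?_
    refine Finset.sum_eq_zero fun i hi => ?_
    have : q ∉ tsupport (ρ i) := fun h => hq (Set.mem_biUnion hi h)
    rw [image_eq_zero_of_notMem_tsupport this, zero_mul]
  · intro q ξ
    obtain ⟨κ, σ, hκ, hq⟩ := exists_isAdaptedChart (n := n) q
    have hdiff : ∀ {g : N → ℝ}, ContMDiff (𝓡 n) 𝓘(ℝ, ℝ) 1 g →
        DifferentiableAt ℝ (fun a => g (κ.symm a)) (κ q) := fun hg =>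
      ((hκ.contDiffOn_comp_symm hg).contDiffAt
        (κ.open_target.mem_nhds (κ.map_source hq))).differentiableAt one_ne_zero
    have h1 : dirDeriv F q ξ = ∑ i ∈ s, dirDeriv (fun q => ρ i q * G i (c i q)) q ξ := by
      simp only [hκ.dirDeriv_eq hq (hterm _), hκ.dirDeriv_eq hq hF, F]
      rw [fderiv_fun_sum fun i _ => hdiff (hterm i)]
      simp
    have h2 : ∑ i ∈ s, f q * dirDeriv (ρ i) q ξ = 0 := by
      rw [← Finset.mul_sum]
      by_cases hfq : f q = 0
      · rw [hfq, zero_mul]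
      have h3 : (fun a => ∑ i ∈ s, ρ i (κ.symm a)) =ᶠ[𝓝 (κ q)] fun _ => (1 : ℝ) := by
        have h4 : ContinuousAt (fun a => f (κ.symm a)) (κ q) := by
          refine ContinuousAt.comp hf.continuous.continuousAt
            (κ.continuousAt_symm (κ.map_source hq))
        have h5 : f (κ.symm (κ q)) ≠ 0 := by rwa [κ.left_inv hq]
        filter_upwards [h4.eventually_ne h5] with a ha using hsum _ ha
      have h4 : ∑ i ∈ s, dirDeriv (ρ i) q ξ = 0 := by
        simp only [hκ.dirDeriv_eq hq (hρ1 _)]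
        rw [← sum_apply, ← fderiv_fun_sum fun i _ => hdiff (hρ1 i), h3.fderiv_eq]
        simp
      rw [h4, mul_zero]
    have h3 : ∀ i ∈ s, |dirDeriv (fun q => ρ i q * G i (c i q)) q ξ - f q * dirDeriv (ρ i) q ξ| ≤
        (4 * ρ i q + η * L i) * ‖ξ‖ := by
      intro i _
      by_cases hqi : q ∈ tsupport (ρ i)
      · have hqc : q ∈ (c i).source := (hρ i hqi).1
        have h4 : dirDeriv (fun q => ρ i q * G i (c i q)) q ξ =
            ρ i q * fderiv ℝ (G i) (c i q) (τ i q ξ) + G i (c i q) * dirDeriv (ρ i) q ξ := by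
          rw [(hc i).dirDeriv_eq hqc (hterm i), (hc i).dirDeriv_eq hqc (hρ1 i)]
          have h5 : (fun a => ρ i ((c i).symm a) * G i (c i ((c i).symm a))) =ᶠ[𝓝 (c i q)]
              fun a => ρ i ((c i).symm a) * G i a := by
            filter_upwards [(c i).open_target.mem_nhds ((c i).map_source hqc)] with a ha
            rw [(c i).right_inv ha]
          rw [h5.fderiv_eq, fderiv_fun_mul]
          · simp [(c i).left_inv hqc]
          · exact (((hc i).contDiffOn_comp_symm (hρ1 i)).contDiffAt ((c i).open_target.mem_nhds
              ((c i).map_source hqc))).differentiableAt one_ne_zero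
          · exact (hG i).differentiable one_ne_zero _
        have h5 : |fderiv ℝ (G i) (c i q) (τ i q ξ)| ≤ 4 * ‖ξ‖ := by
          rw [← Real.norm_eq_abs]
          refine (ContinuousLinearMap.le_of_opNorm_le _ (hG2 i _) _).trans ?_
          have := (hc i).norm_le q hqc ξ
          linarith
        rw [h4, show ρ i q * fderiv ℝ (G i) (c i q) (τ i q ξ) + G i (c i q) * dirDeriv (ρ i) q ξ
          - f q * dirDeriv (ρ i) q ξ = ρ i q * fderiv ℝ (G i) (c i q) (τ i q ξ) +
            (G i (c i q) - f q) * dirDeriv (ρ i) q ξ by ring]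
        refine (abs_add_le _ _).trans ?_
        rw [abs_mul, abs_mul, abs_of_nonneg (ρ.nonneg i q), add_mul]
        refine add_le_add ?_ ?_
        · calc ρ i q * |fderiv ℝ (G i) (c i q) (τ i q ξ)| ≤ ρ i q * (4 * ‖ξ‖) :=
                mul_le_mul_of_nonneg_left h5 (ρ.nonneg i q)
            _ = _ := by ring
        · rw [mul_assoc]
          exact mul_le_mul (hGf i q hqc) (hL i q ξ) (abs_nonneg _) hη0.le
      · have h4 : q ∉ tsupport (fun q => ρ i q * G i (c i q)) := fun h =>
          hqi (tsupport_mul_subset_left h)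
        rw [dirDeriv_eq_zero_of_notMem_tsupport h4, dirDeriv_eq_zero_of_notMem_tsupport hqi]
        have := ρ.nonneg i q
        have := hL0 i
        simp only [mul_zero, sub_self, abs_zero]
        positivity
    calc |dirDeriv F q ξ|
        = |∑ i ∈ s, (dirDeriv (fun q => ρ i q * G i (c i q)) q ξ - f q * dirDeriv (ρ i) q ξ)| := by
          rw [Finset.sum_sub_distrib, h2, sub_zero, h1]
      _ ≤ ∑ i ∈ s, (4 * ρ i q + η * L i) * ‖ξ‖ :=
          (Finset.abs_sum_le_sum_abs _ _).trans (Finset.sum_le_sum h3)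
      _ = (4 * ∑ i ∈ s, ρ i q + η * ∑ i ∈ s, L i) * ‖ξ‖ := by
          rw [← Finset.sum_mul, Finset.sum_add_distrib, ← Finset.mul_sum, ← Finset.mul_sum]
      _ ≤ 5 * ‖ξ‖ := by
          have h4 := hsum_le q
          have h5 : η * ∑ i ∈ s, L i ≤ 1 := by
            calc η * ∑ i ∈ s, L i ≤ 1 / B * B :=
                  mul_le_mul (min_le_right _ _) (by rw [hB]; linarith)
                    (Finset.sum_nonneg fun i _ => hL0 i) (by positivity)
              _ = 1 := by field_simp
          gcongr
          linarith
  · intro q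
    have h1 : f q = ∑ i ∈ s, ρ i q * f q := by
      by_cases hfq : f q = 0
      · simp [hfq]
      · rw [← Finset.sum_mul, hsum q hfq, one_mul]
    have h2 : ∀ i ∈ s, |ρ i q * G i (c i q) - ρ i q * f q| ≤ ρ i q * η := by
      intro i _
      by_cases hqi : q ∈ tsupport (ρ i)
      · rw [← mul_sub, abs_mul, abs_of_nonneg (ρ.nonneg i q)]
        exact mul_le_mul_of_nonneg_left (hGf i q (hρ i hqi).1) (ρ.nonneg i q)
      · simp [image_eq_zero_of_notMem_tsupport hqi]
    calc |F q - f q| = |∑ i ∈ s, (ρ i q * G i (c i q) - ρ i q * f q)| := by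
          rw [Finset.sum_sub_distrib, ← h1]
      _ ≤ ∑ i ∈ s, ρ i q * η := (Finset.abs_sum_le_sum_abs _ _).trans (Finset.sum_le_sum h2)
      _ = (∑ i ∈ s, ρ i q) * η := by rw [Finset.sum_mul]
      _ ≤ 1 * η := by gcongr; exact hsum_le q
      _ ≤ ε := by rw [one_mul]; exact min_le_left _ _

theorem lipschitzWith_max_sub_dist {X : Type*} [PseudoMetricSpace X] (q : X) (R : ℝ) :
    LipschitzWith 1 fun b => max (R - dist b q) 0 := by
  refine LipschitzWith.of_dist_le_mul fun a b => ?_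
  rw [Real.dist_eq, NNReal.coe_one, one_mul]
  refine (abs_max_sub_max_le_abs _ _ _).trans ?_
  rw [show R - dist a q - (R - dist b q) = dist b q - dist a q by ring, dist_comm a b]
  exact abs_dist_sub_le _ _ _

variable (n N) in
theorem exists_isApproxFamily [Nonempty N] : ∃ Φ : ℕ → N → ℝ, IsApproxFamily n Φ := by
  have key : ∀ k : ℕ × ℕ × ℕ, ∃ F : N → ℝ, ContMDiff (𝓡 n) 𝓘(ℝ, ℝ) 1 F ∧ HasCompactSupport F ∧
      HasGradientBound n F 5 ∧ ∀ b, |F b - max ((k.2.1 : ℝ) / (k.2.2 + 1) -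
        dist b (TopologicalSpace.denseSeq N k.1)) 0| ≤ 1 / (k.2.2 + 1) := by
    intro k
    refine exists_contMDiff_approx (lipschitzWith_max_sub_dist _ _) ?_ (by positivity)
    refine HasCompactSupport.intro (isCompact_closedBall (TopologicalSpace.denseSeq N k.1)
      ((k.2.1 : ℝ) / (k.2.2 + 1))) fun b hb => ?_
    rw [Metric.mem_closedBall, not_le] at hb
    exact max_eq_right (by linarith)
  choose F hF1 hF2 hF3 hF4 using key
  obtain ⟨e, he⟩ := exists_surjective_nat (ℕ × ℕ × ℕ)
  refine ⟨fun m => F (e m), fun m => hF1 _, fun m => hF2 _, fun m => hF3 _, ?_⟩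
  intro q R δ hR hδ
  obtain ⟨l, hl⟩ := exists_nat_one_div_lt (show 0 < δ / 3 by positivity)
  obtain ⟨i, hi⟩ := (TopologicalSpace.denseRange_denseSeq N).exists_dist_lt q
    (show 0 < δ / 3 by positivity)
  obtain ⟨m, hm⟩ := he (i, ⌊R * (l + 1)⌋₊, l)
  refine ⟨m, fun b => ?_⟩
  show |F (e m) b - _| ≤ δ
  rw [hm]
  have h1 := hF4 (i, ⌊R * (l + 1)⌋₊, l) b
  simp only at h1
  have h2 : |R - (⌊R * (l + 1)⌋₊ : ℝ) / (l + 1)| ≤ 1 / ((l : ℝ) + 1) := by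
    have hl0 : (0 : ℝ) < l + 1 := by positivity
    rw [show R - (⌊R * (l + 1)⌋₊ : ℝ) / (l + 1) = (R * (l + 1) - ⌊R * (l + 1)⌋₊) / (l + 1) by
      field_simp, abs_div, abs_of_pos hl0]
    gcongr
    rw [abs_of_nonneg (sub_nonneg.2 (Nat.floor_le (by positivity)))]
    linarith [Nat.lt_floor_add_one (R * ((l : ℝ) + 1))]
  set R' := (⌊R * (l + 1)⌋₊ : ℝ) / (l + 1)
  set q' := TopologicalSpace.denseSeq N i
  have h3 : |max (R' - dist b q') 0 - max (R - dist b q) 0| ≤ |R - R'| + dist q q' := by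
    refine (abs_max_sub_max_le_abs _ _ _).trans ?_
    rw [show R' - dist b q' - (R - dist b q) = (R' - R) + (dist b q - dist b q') by ring,
      abs_sub_comm R]
    refine (abs_add_le _ _).trans (add_le_add le_rfl ?_)
    rw [dist_comm b q, dist_comm b q']
    exact abs_dist_sub_le _ _ _
  calc |F (i, ⌊R * (l + 1)⌋₊, l) b - max (R - dist b q) 0|
      ≤ |F (i, ⌊R * (l + 1)⌋₊, l) b - max (R' - dist b q') 0|
        + |max (R' - dist b q') 0 - max (R - dist b q) 0| := abs_sub_le _ _ _
    _ ≤ δ := by linarith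

end

/-! ### Weakly differentiable functions along segments -/

section Translation

variable {d : ℕ}

theorem measurePreserving_shear (v : EuclideanSpace ℝ (Fin d)) (ν : Measure ℝ) [SFinite ν] :
    MeasurePreserving (fun p : ℝ × EuclideanSpace ℝ (Fin d) => (p.1, p.2 + p.1 • v))
      (ν.prod volume) (ν.prod volume) :=
  (MeasurePreserving.id ν).skew_product (g := fun s x => x + s • v) (by fun_prop)
    (ae_of_all _ fun s => (measurePreserving_add_right volume (s • v)).map_eq)

theorem MeasureTheory.Integrable.comp_add_smul {g : EuclideanSpace ℝ (Fin d) → ℝ}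
    (hg : Integrable g) (v : EuclideanSpace ℝ (Fin d)) (ν : Measure ℝ) [IsFiniteMeasure ν] :
    Integrable (fun p : ℝ × EuclideanSpace ℝ (Fin d) => g (p.2 + p.1 • v)) (ν.prod volume) :=
  (measurePreserving_shear v ν).integrable_comp_of_integrable (hg.comp_snd ν)

/-- Fundamental theorem of calculus along segments, for smooth compactly supported functions,
tested against an integrable function. -/
theorem integral_integral_mul_fderiv_translate {w : EuclideanSpace ℝ (Fin d) → ℝ}
    (hw : Integrable w) {φ : EuclideanSpace ℝ (Fin d) → ℝ} (hφ : ContDiff ℝ ∞ φ)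
    (hφc : HasCompactSupport φ) (v : EuclideanSpace ℝ (Fin d)) :
    ∫ s in Set.Icc (0 : ℝ) 1, ∫ x, w x * fderiv ℝ φ (x - s • v) v =
      ∫ x, w x * (φ x - φ (x - v)) := by
  have hφ' : Continuous fun x => fderiv ℝ φ x v :=
    (hφ.continuous_fderiv (by simp)).clm_apply continuous_const
  have hφs : HasCompactSupport fun x => fderiv ℝ φ x v := by
    exact hφc.fderiv_apply ℝ v
  obtain ⟨B, hB⟩ := hφs.exists_bound_of_continuous hφ'
  rw [integral_integral_swap]
  · refine integral_congr_ae (ae_of_all _ fun x => ?_)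
    simp only
    rw [integral_const_mul]
    congr 1
    have h1 : ∀ s ∈ Set.uIcc (0 : ℝ) 1,
        HasDerivAt (fun s : ℝ => - φ (x - s • v)) (fderiv ℝ φ (x - s • v) v) s := by
      intro s _
      have h2 : HasDerivAt (fun s : ℝ => x - s • v) (-v) s := by
        simpa using ((hasDerivAt_id s).smul_const v).const_sub x
      have h3 := ((hφ.differentiable (by simp) (x - s • v)).hasFDerivAt.comp_hasDerivAt s h2).neg
      rw [map_neg, neg_neg] at h3
      exact h3
    have h4 := intervalIntegral.integral_eq_sub_of_hasDerivAt h1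
      ((hφ'.comp (by fun_prop : Continuous fun s : ℝ => x - s • v)).intervalIntegrable _ _)
    rw [integral_Icc_eq_integral_Ioc, ← intervalIntegral.integral_of_le zero_le_one, h4]
    simp
    ring
  · refine (hw.comp_snd _).mul_bdd (c := B) (Continuous.aestronglyMeasurable ?_)
      (ae_of_all _ fun p => hB _)
    exact hφ'.comp (by fun_prop)

theorem isCompact_image_segment {K : Set (EuclideanSpace ℝ (Fin d))} (hK : IsCompact K)
    (v : EuclideanSpace ℝ (Fin d)) :
    IsCompact ((fun p : ℝ × EuclideanSpace ℝ (Fin d) => p.2 + p.1 • v) '' (Set.Icc 0 1 ×ˢ K)) :=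
  (isCompact_Icc.prod hK).image (by fun_prop)

/-- Weakly differentiable functions satisfy the fundamental theorem of calculus along almost every
segment with a given direction vector. -/
theorem HasWeakDerivOn.ae_translate_sub_eq {D : Set (EuclideanSpace ℝ (Fin d))}
    {w : EuclideanSpace ℝ (Fin d) → ℝ}
    {g : EuclideanSpace ℝ (Fin d) → EuclideanSpace ℝ (Fin d) →L[ℝ] ℝ}
    (h : HasWeakDerivOn D w g) {U : Set (EuclideanSpace ℝ (Fin d))} (hU : IsOpen U)
    (v : EuclideanSpace ℝ (Fin d)) (hUD : ∀ y ∈ U, ∀ s ∈ Set.Icc (0 : ℝ) 1, y + s • v ∈ D) :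
    ∀ᵐ y, y ∈ U → w (y + v) - w y = ∫ s in Set.Icc (0 : ℝ) 1, g (y + s • v) v := by
  obtain ⟨hw, hg, hwg⟩ := h
  -- truncations of `w` and of the derivative of `w` in the direction `v` to compact sets
  have key : ∀ K ⊆ U, IsCompact K → ∃ K' ⊆ D, (∀ y ∈ K, ∀ s ∈ Set.Icc (0 : ℝ) 1, y + s • v ∈ K') ∧
      MeasurableSet K' ∧
      Integrable (K'.indicator w) ∧ Integrable (K'.indicator fun x => g x v) := by
    intro K hKU hK
    have hK' := isCompact_image_segment hK v
    refine ⟨(fun p : ℝ × EuclideanSpace ℝ (Fin d) => p.2 + p.1 • v) '' (Set.Icc 0 1 ×ˢ K), ?_,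
      fun y hy s hs => ⟨(s, y), ⟨hs, hy⟩, rfl⟩, hK'.measurableSet,
      (integrable_indicator_iff hK'.measurableSet).2 (hw.integrableOn_compact_subset ?_ hK'),
      (integrable_indicator_iff hK'.measurableSet).2 ?_⟩
    · rintro _ ⟨p, hp, rfl⟩; exact hUD _ (hKU hp.2) _ hp.1
    · rintro _ ⟨p, hp, rfl⟩; exact hUD _ (hKU hp.2) _ hp.1
    · refine (ContinuousLinearMap.apply ℝ ℝ v).integrable_comp (hg.integrableOn_compact_subset ?_ hK')
      rintro _ ⟨p, hp, rfl⟩; exact hUD _ (hKU hp.2) _ hp.1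
  have h0 : (0 : ℝ) ∈ Set.Icc (0 : ℝ) 1 := by simp
  have h1 : (1 : ℝ) ∈ Set.Icc (0 : ℝ) 1 := by simp
  suffices hz : ∀ᵐ y, y ∈ U →
      w (y + v) - w y - ∫ s in Set.Icc (0 : ℝ) 1, g (y + s • v) v = 0 by
    filter_upwards [hz] with y hy hyU using sub_eq_zero.1 (hy hyU)
  refine hU.ae_eq_zero_of_integral_contDiff_smul_eq_zero ?_ ?_
  · rw [locallyIntegrableOn_iff hU.isLocallyClosed]
    intro K hKU hK
    obtain ⟨K', hK'D, hKK', hK'm, hwi, hgi⟩ := key K hKU hK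
    have h2 : Integrable fun y => K'.indicator w (y + v) - K'.indicator w y -
        ∫ s in Set.Icc (0 : ℝ) 1, K'.indicator (fun x => g x v) (y + s • v) :=
      ((hwi.comp_add_right v).sub hwi).sub (hgi.comp_add_smul v _).integral_prod_right
    refine h2.integrableOn.congr_fun (fun y hy => ?_) hK.measurableSet
    have h3 := hKK' y hy 1 h1
    have h4 := hKK' y hy 0 h0
    rw [one_smul] at h3
    rw [zero_smul, add_zero] at h4
    simp only [Set.indicator_of_mem h3, Set.indicator_of_mem h4]
    congr 1
    exact setIntegral_congr_fun measurableSet_Icc fun s hs =>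
      Set.indicator_of_mem (hKK' y hy s hs) _
  · intro φ hφ hφc hφU
    obtain ⟨K', hK'D, hKK', hK'm, hwi, hgi⟩ := key _ hφU hφc.isCompact
    set w' := K'.indicator w with hw'
    set g' := K'.indicator (fun x => g x v) with hg'
    obtain ⟨B, hB⟩ := hφc.exists_bound_of_continuous hφ.continuous
    have hweak : ∀ s ∈ Set.Icc (0 : ℝ) 1,
        ∫ x, w' x * fderiv ℝ φ (x - s • v) v = - ∫ x, g' (x + s • v) * φ x := by
      intro s hs
      have hsupp : tsupport (fun x => φ (x - s • v)) ⊆ K' := by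
        intro x hx
        have h2 : x - s • v ∈ tsupport φ := by
          have := tsupport_comp_subset_preimage φ (f := fun x => x - s • v) (by fun_prop) hx
          exact this
        simpa using hKK' _ h2 s hs
      have hcs : HasCompactSupport (fun x => φ (x - s • v)) :=
        hφc.comp_homeomorph (Homeomorph.subRight (s • v))
      have h2 := hwg (fun x => φ (x - s • v)) (hφ.comp (by fun_prop)) hcs (hsupp.trans hK'D) v
      have h3 : ∀ x, fderiv ℝ (fun x => φ (x - s • v)) x v = fderiv ℝ φ (x - s • v) v := fun x => by
        rw [fderiv_comp_sub]
      simp only [h3] at h2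
      have h4 : ∫ x, w' x * fderiv ℝ φ (x - s • v) v =
          ∫ x in D, w x * fderiv ℝ φ (x - s • v) v := by
        rw [setIntegral_eq_integral_of_forall_compl_eq_zero]
        · refine integral_congr_ae (ae_of_all _ fun x => ?_)
          by_cases hx : x ∈ K'
          · simp [hw', Set.indicator_of_mem hx]
          · have : fderiv ℝ (fun x => φ (x - s • v)) x = 0 :=
              fderiv_of_notMem_tsupport ℝ fun h => hx (hsupp h)
            simp [← h3, this]
        · intro x hx
          have : fderiv ℝ (fun x => φ (x - s • v)) x = 0 :=
            fderiv_of_notMem_tsupport ℝ fun h => hx (hK'D (hsupp h))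
          simp [← h3, this]
      have h5 : ∫ x, g' (x + s • v) * φ x = ∫ x in D, g x v * φ (x - s • v) := by
        have h6 := integral_add_right_eq_self (μ := volume) (fun x => g' x * φ (x - s • v)) (s • v)
        simp only [add_sub_cancel_right] at h6
        have h7 : ∀ x ∉ K', φ (x - s • v) = 0 := fun x hx =>
          image_eq_zero_of_notMem_tsupport (f := fun x => φ (x - s • v)) fun h => hx (hsupp h)
        rw [h6, setIntegral_eq_integral_of_forall_compl_eq_zero]
        · refine integral_congr_ae (ae_of_all _ fun x => ?_)
          by_cases hx : x ∈ K'
          · simp [hg', Set.indicator_of_mem hx]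
          · simp [h7 x hx]
        · intro x hx
          simp [h7 x fun h => hx (hK'D h)]
      rw [h4, h2, h5]
    have hI : ∫ x, w' x * (φ x - φ (x - v)) =
        - ∫ x, φ x * ∫ s in Set.Icc (0 : ℝ) 1, g' (x + s • v) := by
      rw [← integral_integral_mul_fderiv_translate hwi hφ hφc v,
        setIntegral_congr_fun measurableSet_Icc hweak, integral_neg, integral_integral_swap]
      · congr 1
        refine integral_congr_ae (ae_of_all _ fun x => ?_)
        simp only
        rw [integral_mul_const, mul_comm]
      · exact (hgi.comp_add_smul v _).mul_bdd (c := B)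
          (hφ.continuous.comp continuous_snd).aestronglyMeasurable (ae_of_all _ fun p => hB _)
    have hφm : AEStronglyMeasurable φ volume := hφ.continuous.aestronglyMeasurable
    have i1 : Integrable fun x => φ x * w' x := hwi.bdd_mul hφm (ae_of_all _ hB)
    have i2 : Integrable fun x => φ x * w' (x + v) :=
      (hwi.comp_add_right v).bdd_mul hφm (ae_of_all _ hB)
    have i3 : Integrable fun x => φ x * ∫ s in Set.Icc (0 : ℝ) 1, g' (x + s • v) :=
      (hgi.comp_add_smul v _).integral_prod_right.bdd_mul hφm (ae_of_all _ hB)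
    have hII : ∫ x, w' x * (φ x - φ (x - v)) = (∫ x, φ x * w' x) - ∫ x, φ x * w' (x + v) := by
      have i2' : Integrable fun x => w' x * φ (x - v) := by
        have := i2.comp_sub_right v
        simpa [mul_comm] using this
      have : ∫ x, φ x * w' (x + v) = ∫ x, w' x * φ (x - v) := by
        rw [← integral_add_right_eq_self (fun x => w' x * φ (x - v)) v]
        simp [mul_comm]
      rw [this, ← integral_sub i1 i2']
      refine integral_congr_ae (ae_of_all _ fun x => ?_)
      simp only
      ring
    have hfin : ∫ x, φ x • (w (x + v) - w x - ∫ s in Set.Icc (0 : ℝ) 1, g (x + s • v) v) =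
        ∫ x, (φ x * w' (x + v) - φ x * w' x - φ x * ∫ s in Set.Icc (0 : ℝ) 1, g' (x + s • v)) := by
      refine integral_congr_ae (ae_of_all _ fun x => ?_)
      simp only [smul_eq_mul]
      by_cases hx : x ∈ tsupport φ
      · have h3 := hKK' x hx 1 h1
        have h4 := hKK' x hx 0 h0
        rw [one_smul] at h3
        rw [zero_smul, add_zero] at h4
        rw [hw', Set.indicator_of_mem h3, Set.indicator_of_mem h4,
          setIntegral_congr_fun measurableSet_Icc fun s hs =>
            Set.indicator_of_mem (hKK' x hx s hs) (fun x => g x v)]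
        ring
      · simp [image_eq_zero_of_notMem_tsupport hx]
    have e1 := integral_sub (i2.sub i1) i3
    have e2 := integral_sub i2 i1
    simp only [Pi.sub_apply] at e1
    rw [hfin, e1, e2]
    linarith

end Translation

/-! ### Interior cones of Lipschitz domains -/

section Cone

variable {d : ℕ}

/-- The open set `U ⊆ D` satisfies a uniform interior cone condition in `D`: there are arbitrarily
small balls of vectors `h` (not centred at the origin, in general) such that all the segments from
`y ∈ U` to `y + h` stay in `D`. -/
structure HasInwardBalls (D U : Set (EuclideanSpace ℝ (Fin d))) : Prop where
  isOpen : IsOpen U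
  subset : U ⊆ D
  exists_ball : ∀ ε : ℝ, 0 < ε → ∃ (h₀ : EuclideanSpace ℝ (Fin d)) (r : ℝ), 0 < r ∧
    Metric.ball h₀ r ⊆ Metric.ball 0 ε ∧
    ∀ y ∈ U, ∀ h ∈ Metric.ball h₀ r, ∀ s ∈ Set.Icc (0 : ℝ) 1, y + s • h ∈ D

theorem exists_hasInwardBalls_of_mem {D : Set (EuclideanSpace ℝ (Fin d))} (hD : IsOpen D)
    {x : EuclideanSpace ℝ (Fin d)} (hx : x ∈ D) :
    ∃ ρ, 0 < ρ ∧ HasInwardBalls D (D ∩ Metric.ball x ρ) := by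
  obtain ⟨r, hr, hrD⟩ := Metric.isOpen_iff.1 hD x hx
  refine ⟨r / 2, by positivity, hD.inter Metric.isOpen_ball, Set.inter_subset_left,
    fun ε hε => ⟨0, min ε (r / 2), by positivity, Metric.ball_subset_ball (min_le_left _ _), ?_⟩⟩
  intro y hy h hh s hs
  apply hrD
  rw [Metric.mem_ball, dist_eq_norm]
  have h1 : ‖y - x‖ < r / 2 := by rw [← dist_eq_norm]; exact hy.2
  have h2 : ‖h‖ < r / 2 := by
    rw [mem_ball_zero_iff] at hh; exact hh.trans_le (min_le_right _ _)
  have h3 : ‖s • h‖ ≤ ‖h‖ := by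
    rw [norm_smul, Real.norm_of_nonneg hs.1]
    exact mul_le_of_le_one_left (norm_nonneg _) hs.2
  calc ‖y + s • h - x‖ = ‖(y - x) + s • h‖ := by congr 1; abel
    _ ≤ ‖y - x‖ + ‖s • h‖ := norm_add_le _ _
    _ < r := by linarith

/-- Near a boundary point, the vectors close to a positive multiple of the vertical direction `e`
point into the epigraph. -/
theorem HasLipschitzBoundary.exists_hasInwardBalls {D : Set (EuclideanSpace ℝ (Fin d))}
    (hD : IsOpen D) (hDL : HasLipschitzBoundary D) {x : EuclideanSpace ℝ (Fin d)}
    (hx : x ∈ frontier D) : ∃ ρ, 0 < ρ ∧ HasInwardBalls D (D ∩ Metric.ball x ρ) := by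
  obtain ⟨e, r, K, γ, he, hr, hγ, hDγ⟩ := hDL x hx
  refine ⟨r / 2, by positivity, hD.inter Metric.isOpen_ball, Set.inter_subset_left, fun ε hε => ?_⟩
  set c : ℝ := 1 / (2 * K + 1) with hc
  have hc0 : 0 < c := by positivity
  have hcK : c * (2 * K + 1) = 1 := by rw [hc]; field_simp
  have hc1 : c ≤ 1 := by
    have : 0 ≤ c * K := by positivity
    linarith
  set t : ℝ := min ε (r / 2) / 2 with ht
  have ht0 : 0 < t := by positivity
  have htε : 2 * t ≤ ε := by rw [ht]; linarith [min_le_left ε (r / 2)]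
  have htr : 2 * t ≤ r / 2 := by rw [ht]; linarith [min_le_right ε (r / 2)]
  have hct : c * t ≤ t := mul_le_of_le_one_left ht0.le hc1
  have hnorm : ∀ h ∈ Metric.ball (t • e) (c * t), ‖h‖ < 2 * t := by
    intro h hh
    rw [Metric.mem_ball, dist_eq_norm] at hh
    calc ‖h‖ = ‖(h - t • e) + t • e‖ := by rw [sub_add_cancel]
      _ ≤ ‖h - t • e‖ + ‖t • e‖ := norm_add_le _ _
      _ < 2 * t := by rw [norm_smul, he, mul_one, Real.norm_of_nonneg ht0.le]; linarith
  refine ⟨t • e, c * t, by positivity, fun h hh => ?_, fun y hy h hh s hs => ?_⟩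
  · rw [mem_ball_zero_iff]; exact (hnorm h hh).trans_le htε
  have hy2 : ‖y - x‖ < r / 2 := by rw [← dist_eq_norm]; exact hy.2
  have h2 := hnorm h hh
  have h3 : ‖s • h‖ ≤ ‖h‖ := by
    rw [norm_smul, Real.norm_of_nonneg hs.1]
    exact mul_le_of_le_one_left (norm_nonneg _) hs.2
  have hball : y + s • h ∈ Metric.ball x r := by
    rw [Metric.mem_ball, dist_eq_norm]
    calc ‖y + s • h - x‖ = ‖(y - x) + s • h‖ := by congr 1; abel
      _ ≤ ‖y - x‖ + ‖s • h‖ := norm_add_le _ _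
      _ < r := by linarith
  have hyD : γ (y - inner ℝ e y • e) < inner ℝ e y :=
    (hDγ y (by rw [Metric.mem_ball, dist_eq_norm]; linarith)).1 hy.1
  refine (hDγ _ hball).2 ?_
  obtain ⟨k, hk⟩ : ∃ k, k = h - t • e := ⟨_, rfl⟩
  have hkn : ‖k‖ < c * t := by rw [hk, ← dist_eq_norm]; exact hh
  have hhk : h = t • e + k := by rw [hk]; abel
  have hee : inner ℝ e e = (1 : ℝ) := by rw [real_inner_self_eq_norm_sq, he]; norm_num
  have hek : |inner ℝ e k| ≤ ‖k‖ := by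
    simpa [he] using abs_real_inner_le_norm e k
  have h4 : inner ℝ e (y + s • h) = inner ℝ e y + s * (t + inner ℝ e k) := by
    rw [hhk, inner_add_right, real_inner_smul_right, inner_add_right, real_inner_smul_right, hee,
      mul_one]
  have h5 : ‖(y + s • h - inner ℝ e (y + s • h) • e) - (y - inner ℝ e y • e)‖ ≤
      s * (2 * ‖k‖) := by
    have : (y + s • h - inner ℝ e (y + s • h) • e) - (y - inner ℝ e y • e) =
        s • (k - inner ℝ e k • e) := by
      rw [h4, hhk]; module
    rw [this, norm_smul, Real.norm_of_nonneg hs.1]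
    refine mul_le_mul_of_nonneg_left ?_ hs.1
    refine (norm_sub_le _ _).trans ?_
    rw [norm_smul, he, mul_one, Real.norm_eq_abs]
    linarith
  have h6 := hγ.dist_le_mul (y + s • h - inner ℝ e (y + s • h) • e) (y - inner ℝ e y • e)
  rw [Real.dist_eq, dist_eq_norm] at h6
  have h7 := (le_abs_self _).trans (h6.trans (mul_le_mul_of_nonneg_left h5 K.coe_nonneg))
  have h8 : K * (2 * ‖k‖) ≤ t + inner ℝ e k := by
    have h9 : (2 * K + 1) * ‖k‖ ≤ t := by
      calc (2 * (K : ℝ) + 1) * ‖k‖ ≤ (2 * K + 1) * (c * t) := by gcongr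
        _ = c * (2 * K + 1) * t := by ring
        _ = t := by rw [hcK, one_mul]
    linarith [(abs_le.1 hek).1]
  have h9 := mul_le_mul_of_nonneg_left h8 hs.1
  have h10 : (K : ℝ) * (s * (2 * ‖k‖)) = s * (K * (2 * ‖k‖)) := by ring
  linarith

theorem HasLipschitzBoundary.exists_finite_cover {D : Set (EuclideanSpace ℝ (Fin d))}
    (hD : IsOpen D) (hDb : Bornology.IsBounded D) (hDL : HasLipschitzBoundary D) :
    ∃ (s : Finset (EuclideanSpace ℝ (Fin d))) (U : EuclideanSpace ℝ (Fin d) →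
      Set (EuclideanSpace ℝ (Fin d))), (∀ x ∈ s, HasInwardBalls D (U x)) ∧ D ⊆ ⋃ x ∈ s, U x := by
  have key : ∀ x ∈ closure D, ∃ ρ, 0 < ρ ∧ HasInwardBalls D (D ∩ Metric.ball x ρ) := by
    intro x hx
    by_cases hxD : x ∈ D
    · exact exists_hasInwardBalls_of_mem hD hxD
    · exact hDL.exists_hasInwardBalls hD ⟨hx, fun h => hxD (interior_subset h)⟩
  choose! ρ hρ hin using key
  obtain ⟨s, hs, hcov⟩ := hDb.isCompact_closure.elim_nhds_subcover (fun x => Metric.ball x (ρ x))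
    fun x hx => Metric.ball_mem_nhds x (hρ x hx)
  refine ⟨s, fun x => D ∩ Metric.ball x (ρ x), fun x hx => hin x (hs x hx), fun y hy => ?_⟩
  have := hcov (subset_closure hy)
  simp only [Set.mem_iUnion, exists_prop] at this ⊢
  obtain ⟨x, hx, hyx⟩ := this
  exact ⟨x, hx, hy, hyx⟩

end Cone

/-! ### Weak convergence in L¹ -/

section WeakConvergence

theorem exists_subseq_tendsto_weakDual {ι H : Type*} [Countable ι] [NormedAddCommGroup H]
    [NormedSpace ℝ H] [TopologicalSpace.SeparableSpace H]
    (x : ι → ℕ → WeakDual ℝ H) (K : ι → Set (WeakDual ℝ H)) (hK : ∀ i, IsCompact (K i))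
    (hx : ∀ i k, x i k ∈ K i) :
    ∃ φ : ℕ → ℕ, StrictMono φ ∧ ∃ y : ι → WeakDual ℝ H, ∀ i,
      Tendsto (fun k => x i (φ k)) atTop (𝓝 (y i)) := by
  have : ∀ i, CompactSpace (K i) := fun i => isCompact_iff_compactSpace.1 (hK i)
  have : ∀ i, TopologicalSpace.MetrizableSpace (K i) := fun i =>
    WeakDual.metrizable_of_isCompact ℝ H _ (hK i)
  let X : ℕ → ∀ i, K i := fun k i => ⟨x i k, hx i k⟩
  obtain ⟨Y, φ, hφ, hY⟩ := SeqCompactSpace.tendsto_subseq X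
  refine ⟨φ, hφ, fun i => (Y i).1, fun i => ?_⟩
  exact (continuous_subtype_val.comp (continuous_apply i)).continuousAt.tendsto.comp hY

/-- Countably many bounded sequences in a separable Hilbert space converge weakly along a common
subsequence. -/
theorem exists_subseq_tendsto_inner {ι H : Type*} [Countable ι] [NormedAddCommGroup H]
    [InnerProductSpace ℝ H] [CompleteSpace H] [TopologicalSpace.SeparableSpace H]
    (x : ι → ℕ → H) (M : ι → ℝ) (hM : ∀ i k, ‖x i k‖ ≤ M i) :
    ∃ φ : ℕ → ℕ, StrictMono φ ∧ ∃ y : ι → H, ∀ i z,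
      Tendsto (fun k => inner ℝ (x i (φ k)) z) atTop (𝓝 (inner ℝ (y i) z)) := by
  obtain ⟨φ, hφ, y, hy⟩ := exists_subseq_tendsto_weakDual
    (fun i k => StrongDual.toWeakDual (InnerProductSpace.toDual ℝ H (x i k)))
    (fun i => WeakDual.toStrongDual ⁻¹' Metric.closedBall (0 : StrongDual ℝ H) (M i))
    (fun i => WeakDual.isCompact_closedBall (0 : StrongDual ℝ H) (M i)) (fun i k => by
      rw [Set.mem_preimage, mem_closedBall_zero_iff]
      exact ((InnerProductSpace.toDual ℝ H).norm_map _).trans_le (hM i k))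
  refine ⟨φ, hφ, fun i => (InnerProductSpace.toDual ℝ H).symm (WeakDual.toStrongDual (y i)),
    fun i z => ?_⟩
  have h1 := ((WeakDual.eval_continuous z).tendsto (y i)).comp (hy i)
  rw [InnerProductSpace.toDual_symm_apply]
  exact h1

variable {X : Type*} [MeasurableSpace X] {μ : Measure X}

theorem MeasureTheory.Integrable.test_mul {f ψ : X → ℝ} (hf : Integrable f μ)
    (hψ : AEStronglyMeasurable ψ μ) {B : ℝ} (hB : ∀ x, |ψ x| ≤ B) :
    Integrable (fun x => ψ x * f x) μ :=
  hf.bdd_mul (c := B) hψ (ae_of_all _ hB)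

theorem MeasureTheory.Integrable.abs_integral_test_mul_le {f ψ : X → ℝ} (hf : Integrable f μ)
    {B : ℝ} (hB : ∀ x, |ψ x| ≤ B) :
    |∫ x, ψ x * f x ∂μ| ≤ B * ∫ x, |f x| ∂μ := by
  rw [← Real.norm_eq_abs, ← integral_const_mul]
  refine norm_integral_le_of_norm_le (hf.abs.const_mul B) (ae_of_all _ fun x => ?_)
  rw [norm_mul]
  exact mul_le_mul_of_nonneg_right (hB x) (norm_nonneg _)

theorem aestronglyMeasurable_sign {f : X → ℝ} (hf : AEStronglyMeasurable f μ) :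
    AEStronglyMeasurable (fun x => (SignType.sign (f x) : ℝ)) μ := by
  have h1 : Measurable fun t : ℝ => (SignType.sign t : ℝ) := by
    have : (fun t : ℝ => (SignType.sign t : ℝ)) =
        fun t => if 0 < t then 1 else if t < 0 then -1 else 0 := by
      ext t
      rw [sign_apply]
      split_ifs <;> simp
    rw [this]
    exact Measurable.ite measurableSet_Ioi measurable_const
      (Measurable.ite measurableSet_Iio measurable_const measurable_const)
  exact (h1.comp_aemeasurable hf.aemeasurable).aestronglyMeasurable

theorem abs_sign_le_one (t : ℝ) : |(SignType.sign t : ℝ)| ≤ 1 := by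
  rcases lt_trichotomy t 0 with h | h | h <;> simp [h]

/-- Weak convergence of a sequence of integrable functions, tested against bounded functions, that
is, weak convergence in `L¹`. -/
def TendstoWeakly (μ : Measure X) (g : ℕ → X → ℝ) (G : X → ℝ) : Prop :=
  ∀ ψ : X → ℝ, AEStronglyMeasurable ψ μ → ∀ B : ℝ, (∀ x, |ψ x| ≤ B) →
    Tendsto (fun k => ∫ x, ψ x * g k x ∂μ) atTop (𝓝 (∫ x, ψ x * G x ∂μ))

namespace TendstoWeakly

variable {g h : ℕ → X → ℝ} {G H : X → ℝ}

theorem comp_strictMono (hg : TendstoWeakly μ g G) {φ : ℕ → ℕ} (hφ : StrictMono φ) :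
    TendstoWeakly μ (fun k => g (φ k)) G := fun ψ hψ B hB =>
  (hg ψ hψ B hB).comp hφ.tendsto_atTop

theorem sub (hg : TendstoWeakly μ g G) (hh : TendstoWeakly μ h H)
    (hgi : ∀ k, Integrable (g k) μ) (hhi : ∀ k, Integrable (h k) μ)
    (hG : Integrable G μ) (hH : Integrable H μ) :
    TendstoWeakly μ (fun k x => g k x - h k x) (fun x => G x - H x) := by
  intro ψ hψ B hB
  have h1 := (hg ψ hψ B hB).sub (hh ψ hψ B hB)
  simp only [mul_sub]
  rw [integral_sub (hG.test_mul hψ hB) (hH.test_mul hψ hB)]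
  refine h1.congr fun k => ?_
  rw [integral_sub ((hgi k).test_mul hψ hB) ((hhi k).test_mul hψ hB)]

/-- Weak limits are monotone. -/
theorem ae_le (hg : TendstoWeakly μ g G) (hh : TendstoWeakly μ h H)
    (hgi : ∀ k, Integrable (g k) μ) (hhi : ∀ k, Integrable (h k) μ)
    (hG : Integrable G μ) (hH : Integrable H μ) (hle : ∀ k, g k ≤ᵐ[μ] h k) : G ≤ᵐ[μ] H := by
  refine ae_le_of_forall_setIntegral_le hG hH fun s hs _ => ?_
  have hB : ∀ x, |s.indicator (fun _ => (1 : ℝ)) x| ≤ 1 := fun x => by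
    by_cases hx : x ∈ s <;> simp [hx]
  have hm : AEStronglyMeasurable (s.indicator fun _ => (1 : ℝ)) μ :=
    (stronglyMeasurable_const.indicator hs).aestronglyMeasurable
  have e : ∀ f : X → ℝ, ∫ x, s.indicator (fun _ => (1 : ℝ)) x * f x ∂μ = ∫ x in s, f x ∂μ := by
    intro f
    rw [← integral_indicator hs]
    refine integral_congr_ae (ae_of_all _ fun x => ?_)
    by_cases hx : x ∈ s <;> simp [hx]
  have h1 := hg _ hm 1 hB
  have h2 := hh _ hm 1 hB
  simp only [e] at h1 h2
  exact le_of_tendsto_of_tendsto' h1 h2 fun k =>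
    setIntegral_mono_ae (hgi k).integrableOn (hhi k).integrableOn (hle k)

/-- Weak lower semicontinuity of the `L¹` norm. -/
theorem integral_abs_le (hg : TendstoWeakly μ g G) (hgi : ∀ k, Integrable (g k) μ)
    (hG : Integrable G μ) {c : ℝ} (hc : ∀ k, ∫ x, |g k x| ∂μ ≤ c) : ∫ x, |G x| ∂μ ≤ c := by
  have h1 := hg _ (aestronglyMeasurable_sign hG.1) 1 fun x => abs_sign_le_one _
  have h2 : ∫ x, |G x| ∂μ = ∫ x, (SignType.sign (G x) : ℝ) * G x ∂μ := by
    simp only [sign_mul_self]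
  rw [h2]
  refine le_of_tendsto' h1 fun k => ?_
  refine (le_abs_self _).trans (((hgi k).abs_integral_test_mul_le fun x => abs_sign_le_one _).trans ?_)
  rw [one_mul]
  exact hc k

end TendstoWeakly

/-- Truncation of a real number at height `m`. -/
def truncate (m t : ℝ) : ℝ := max (-m) (min t m)

theorem abs_truncate_le {m : ℝ} (hm : 0 ≤ m) (t : ℝ) : |truncate m t| ≤ m := by
  unfold truncate
  rw [abs_le]
  exact ⟨le_max_left _ _, max_le (by linarith) (min_le_right _ _)⟩

theorem continuous_truncate (m : ℝ) : Continuous (truncate m) := by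
  unfold truncate; fun_prop

theorem mul_rpow_le_rpow {m t p : ℝ} (hm : 0 < m) (hp : 1 < p) (ht : m ≤ t) :
    t ≤ m ^ (1 - p) * t ^ p := by
  have ht0 : 0 < t := hm.trans_le ht
  have h1 : t ^ (1 - p) ≤ m ^ (1 - p) := Real.rpow_le_rpow_of_nonpos hm ht (by linarith)
  calc t = t ^ (1 - p) * t ^ p := by rw [← Real.rpow_add ht0]; simp
    _ ≤ _ := by gcongr

theorem abs_sub_truncate_le {m t p : ℝ} (hm : 0 < m) (hp : 1 < p) :
    |t - truncate m t| ≤ m ^ (1 - p) * |t| ^ p := by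
  have h0 : 0 ≤ m ^ (1 - p) * |t| ^ p := by positivity
  by_cases h : |t| ≤ m
  · have h1 := abs_le.1 h
    have : truncate m t = t := by
      unfold truncate
      rw [min_eq_left h1.2, max_eq_right h1.1]
    rw [this, sub_self, abs_zero]
    exact h0
  · push Not at h
    refine le_trans ?_ (mul_rpow_le_rpow hm hp h.le)
    unfold truncate
    rcases le_total 0 t with ht | ht
    · rw [abs_of_nonneg ht] at h ⊢
      rw [min_eq_right h.le, max_eq_right (by linarith), abs_of_nonneg (by linarith)]
      linarith
    · rw [abs_of_nonpos ht] at h ⊢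
      rw [min_eq_left (by linarith), max_eq_left (by linarith), abs_of_nonpos (by linarith)]
      linarith

theorem le_add_rpow {m t p : ℝ} (hm : 0 < m) (hp : 1 < p) (ht : 0 ≤ t) :
    t ≤ m + m ^ (1 - p) * t ^ p := by
  rcases le_total t m with h | h
  · have : 0 ≤ m ^ (1 - p) * t ^ p := by positivity
    linarith
  · linarith [mul_rpow_le_rpow hm hp h]

end WeakConvergence

section WeakConvergence

variable {X : Type*} [MeasurableSpace X] {μ : Measure X}

/-- The functions `g k` are measurable, with `∫ |g k| ^ p ≤ C`. -/
structure BoundedInLp (μ : Measure X) (p C : ℝ) (g : ℕ → X → ℝ) : Prop where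
  aestronglyMeasurable : ∀ k, AEStronglyMeasurable (g k) μ
  integrable_rpow : ∀ k, Integrable (fun x => |g k x| ^ p) μ
  integral_rpow_le : ∀ k, ∫ x, |g k x| ^ p ∂μ ≤ C

theorem BoundedInLp.of_lintegral {p : ℝ} (hp : 0 ≤ p) {C : ℝ≥0} {g : ℕ → X → ℝ}
    (hg : ∀ k, AEStronglyMeasurable (g k) μ) (hC : ∀ k, ∫⁻ x, ENNReal.ofReal |g k x| ^ p ∂μ ≤ C) :
    BoundedInLp μ p C g := by
  have hm : ∀ k, AEStronglyMeasurable (fun x => |g k x| ^ p) μ := fun k =>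
    ((hg k).aemeasurable.abs.pow_const p).aestronglyMeasurable
  have hpos : ∀ k x, 0 ≤ |g k x| ^ p := fun k x => by positivity
  have hL : ∀ k, ∫⁻ x, ENNReal.ofReal (|g k x| ^ p) ∂μ ≤ C := fun k => by
    refine le_trans (le_of_eq ?_) (hC k)
    exact lintegral_congr fun x => (ENNReal.ofReal_rpow_of_nonneg (abs_nonneg _) hp).symm
  refine ⟨hg, fun k => ⟨hm k, ?_⟩, fun k => ?_⟩
  · rw [hasFiniteIntegral_iff_ofReal (ae_of_all _ (hpos k))]
    exact (hL k).trans_lt ENNReal.coe_lt_top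
  · rw [integral_eq_lintegral_of_nonneg_ae (ae_of_all _ (hpos k)) (hm k)]
    exact ENNReal.toReal_le_of_le_ofReal C.coe_nonneg (by simpa using hL k)

namespace BoundedInLp

variable {p C : ℝ} {g : ℕ → X → ℝ}

theorem nonneg (hg : BoundedInLp μ p C g) : 0 ≤ C :=
  (integral_nonneg fun x => by positivity).trans (hg.integral_rpow_le 0)

theorem comp (hg : BoundedInLp μ p C g) (φ : ℕ → ℕ) : BoundedInLp μ p C fun k => g (φ k) :=
  ⟨fun _ => hg.1 _, fun _ => hg.2 _, fun _ => hg.3 _⟩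

variable [IsFiniteMeasure μ]

theorem integrable (hg : BoundedInLp μ p C g) (hp : 1 < p) (k : ℕ) : Integrable (g k) μ := by
  refine ((integrable_const (1 : ℝ)).add ((hg.integrable_rpow k).const_mul (1 ^ (1 - p)))).mono'
    (hg.aestronglyMeasurable k) (ae_of_all _ fun x => ?_)
  exact le_add_rpow one_pos hp (abs_nonneg _)

theorem integrable_truncate (hg : BoundedInLp μ p C g) {m : ℝ} (hm : 0 ≤ m) (k : ℕ) :
    Integrable (fun x => truncate m (g k x)) μ :=
  (integrable_const m).mono' ((continuous_truncate m).comp_aestronglyMeasurable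
    (hg.aestronglyMeasurable k)) (ae_of_all _ fun _ => abs_truncate_le hm _)

theorem integral_abs_sub_truncate_le (hg : BoundedInLp μ p C g) (hp : 1 < p) {m : ℝ} (hm : 0 < m)
    (k : ℕ) : ∫ x, |g k x - truncate m (g k x)| ∂μ ≤ m ^ (1 - p) * C := by
  calc ∫ x, |g k x - truncate m (g k x)| ∂μ ≤ ∫ x, m ^ (1 - p) * |g k x| ^ p ∂μ :=
        integral_mono ((hg.integrable hp k).sub (hg.integrable_truncate hm.le k)).abs
          ((hg.integrable_rpow k).const_mul _) fun x => abs_sub_truncate_le hm hp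
    _ = m ^ (1 - p) * ∫ x, |g k x| ^ p ∂μ := integral_const_mul _ _
    _ ≤ m ^ (1 - p) * C := by gcongr; exact hg.integral_rpow_le k

end BoundedInLp

variable [IsFiniteMeasure μ]

/-- Countably many bounded sequences of functions converge weakly along a common subsequence, by the
weak compactness of balls in `L²`. -/
theorem exists_subseq_tendstoWeakly_of_bounded [MeasurableSpace.CountablyGenerated X] {ι : Type*}
    [Countable ι] {g : ι → ℕ → X → ℝ} (hg : ∀ i k, AEStronglyMeasurable (g i k) μ) {M : ι → ℝ}
    (hM : ∀ i k x, |g i k x| ≤ M i) :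
    ∃ φ : ℕ → ℕ, StrictMono φ ∧ ∃ G : ι → X → ℝ, ∀ i, Integrable (G i) μ ∧
      TendstoWeakly μ (fun k => g i (φ k)) (G i) := by
  have hL : ∀ i k, MemLp (g i k) 2 μ := fun i k =>
    MemLp.of_bound (hg i k) (M i) (ae_of_all _ (hM i k))
  have hb : ∀ i k, ‖(hL i k).toLp (g i k)‖ ≤ (measureUnivNNReal μ : ℝ) ^ (2 : ℝ≥0∞).toReal⁻¹ * |M i| := by
    intro i k
    refine Lp.norm_le_of_ae_bound (abs_nonneg _) ?_
    filter_upwards [(hL i k).coeFn_toLp] with x hx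
    rw [hx]
    exact (hM i k x).trans (le_abs_self _)
  have : Fact ((2 : ℝ≥0∞) ≠ ⊤) := ⟨by norm_num⟩
  obtain ⟨φ, hφ, y, hy⟩ := exists_subseq_tendsto_inner (fun i k => (hL i k).toLp (g i k)) _ hb
  refine ⟨φ, hφ, fun i => y i, fun i => ⟨(Lp.memLp (y i)).integrable (by norm_num), ?_⟩⟩
  intro ψ hψ B hB
  have hψL : MemLp ψ 2 μ := MemLp.of_bound hψ B (ae_of_all _ hB)
  have h1 := hy i (hψL.toLp ψ)
  have e : ∀ f : Lp ℝ 2 μ, inner ℝ f (hψL.toLp ψ) = ∫ x, ψ x * f x ∂μ := by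
    intro f
    rw [L2.inner_def]
    refine integral_congr_ae ?_
    filter_upwards [hψL.coeFn_toLp] with x hx
    simp [hx]
  simp only [e] at h1
  refine h1.congr fun k => integral_congr_ae ?_
  filter_upwards [(hL i (φ k)).coeFn_toLp] with x hx
  rw [hx]

/-- A sequence that is bounded in `L^p` converges weakly as soon as its truncations do, because the
truncations at height `m` are uniformly close in `L¹` to the sequence. -/
theorem BoundedInLp.exists_tendstoWeakly_of_truncate {p C : ℝ} (hp : 1 < p) {g : ℕ → X → ℝ}
    (hg : BoundedInLp μ p C g) {G : ℕ → X → ℝ} (hG : ∀ m, Integrable (G m) μ)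
    (hw : ∀ m : ℕ, TendstoWeakly μ (fun k x => truncate (m + 1) (g k x)) (G m)) :
    ∃ L, Integrable L μ ∧ TendstoWeakly μ g L := by
  have hC := hg.nonneg
  have hdecay : Tendsto (fun m : ℕ => ((m : ℝ) + 1) ^ (1 - p) * C) atTop (𝓝 0) := by
    have h1 : Tendsto (fun m : ℕ => ((m : ℝ) + 1) ^ (-(p - 1))) atTop (𝓝 0) :=
      (tendsto_rpow_neg_atTop (by linarith : 0 < p - 1)).comp
        (tendsto_natCast_atTop_atTop.atTop_add tendsto_const_nhds)
    simpa [neg_sub] using h1.mul_const C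
  have hpos : ∀ m : ℕ, (0 : ℝ) < m + 1 := fun m => by positivity
  -- the limits of the truncations form a Cauchy sequence in `L¹`
  have hdist : ∀ m l : ℕ, ∫ x, |G m x - G l x| ∂μ ≤
      ((m : ℝ) + 1) ^ (1 - p) * C + ((l : ℝ) + 1) ^ (1 - p) * C := by
    intro m l
    have ht := fun (m : ℕ) k => hg.integrable_truncate (hpos m).le k
    refine ((hw m).sub (hw l) (ht m) (ht l) (hG m) (hG l)).integral_abs_le
      (fun k => (ht m k).sub (ht l k)) ((hG m).sub (hG l)) fun k => ?_
    have i1 : Integrable (fun x => |g k x - truncate (m + 1) (g k x)|) μ :=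
      ((hg.integrable hp k).sub (ht m k)).abs
    have i2 : Integrable (fun x => |g k x - truncate (l + 1) (g k x)|) μ :=
      ((hg.integrable hp k).sub (ht l k)).abs
    refine le_trans ?_ (add_le_add (hg.integral_abs_sub_truncate_le hp (hpos m) k)
      (hg.integral_abs_sub_truncate_le hp (hpos l) k))
    rw [← integral_add i1 i2]
    refine integral_mono ((ht m k).sub (ht l k)).abs (i1.add i2) fun x => ?_
    rw [abs_sub_comm (g k x) (truncate (m + 1) (g k x))]
    exact abs_sub_le _ _ _
  have hcauchy : CauchySeq fun m => (hG m).toL1 (G m) := by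
    rw [Metric.cauchySeq_iff']
    intro ε hε
    obtain ⟨n, hn⟩ := ((tendsto_order.1 hdecay).2 (ε / 2) (by positivity)).exists_forall_of_atTop
    refine ⟨n, fun m hm => ?_⟩
    refine lt_of_eq_of_lt ?_ (((hdist m n).trans_lt (add_lt_add (hn m hm) (hn n le_rfl))).trans_eq
      (add_halves ε))
    rw [L1.dist_eq_integral_dist]
    refine integral_congr_ae ?_
    filter_upwards [(hG m).coeFn_toL1, (hG n).coeFn_toL1] with x h1 h2
    rw [h1, h2, Real.dist_eq]
  obtain ⟨L, hL⟩ := cauchySeq_tendsto_of_complete hcauchy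
  have hLi : Integrable (L : X → ℝ) μ := L1.integrable_coeFn L
  have hGL : Tendsto (fun m => ∫ x, |G m x - L x| ∂μ) atTop (𝓝 0) := by
    refine (tendsto_iff_dist_tendsto_zero.1 hL).congr fun m => ?_
    rw [L1.dist_eq_integral_dist]
    refine integral_congr_ae ?_
    filter_upwards [(hG m).coeFn_toL1] with x h1
    rw [h1, Real.dist_eq]
  refine ⟨L, hLi, fun ψ hψ B' hB' => ?_⟩
  obtain ⟨B, hB0, hB⟩ : ∃ B, 0 ≤ B ∧ ∀ x, |ψ x| ≤ B :=
    ⟨|B'|, abs_nonneg _, fun x => (hB' x).trans (le_abs_self _)⟩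
  rw [Metric.tendsto_atTop]
  intro ε hε
  obtain ⟨m, hm1, hm2⟩ : ∃ m : ℕ, B * (((m : ℝ) + 1) ^ (1 - p) * C) < ε / 3 ∧
      B * ∫ x, |G m x - L x| ∂μ < ε / 3 := by
    have h1 : Tendsto (fun m : ℕ => B * (((m : ℝ) + 1) ^ (1 - p) * C)) atTop (𝓝 0) := by
      simpa using hdecay.const_mul B
    have h2 : Tendsto (fun m : ℕ => B * ∫ x, |G m x - L x| ∂μ) atTop (𝓝 0) := by
      simpa using hGL.const_mul B
    exact (((tendsto_order.1 h1).2 _ (by positivity : 0 < ε / 3)).and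
      ((tendsto_order.1 h2).2 _ (by positivity))).exists
  obtain ⟨n, hn⟩ := Metric.tendsto_atTop.1 (hw m ψ hψ B hB) (ε / 3) (by positivity)
  refine ⟨n, fun k hk => ?_⟩
  have h1 := hn k hk
  rw [Real.dist_eq] at h1 ⊢
  have ht := hg.integrable_truncate (hpos m).le k
  have h2 : |(∫ x, ψ x * g k x ∂μ) - ∫ x, ψ x * truncate (m + 1) (g k x) ∂μ| ≤
      B * (((m : ℝ) + 1) ^ (1 - p) * C) := by
    rw [← integral_sub ((hg.integrable hp k).test_mul hψ hB) (ht.test_mul hψ hB)]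
    simp only [← mul_sub]
    refine (((hg.integrable hp k).sub ht).abs_integral_test_mul_le hB).trans ?_
    exact mul_le_mul_of_nonneg_left (hg.integral_abs_sub_truncate_le hp (hpos m) k) hB0
  have h3 : |(∫ x, ψ x * G m x ∂μ) - ∫ x, ψ x * L x ∂μ| ≤ B * ∫ x, |G m x - L x| ∂μ := by
    rw [← integral_sub ((hG m).test_mul hψ hB) (hLi.test_mul hψ hB)]
    simp only [← mul_sub]
    exact ((hG m).sub hLi).abs_integral_test_mul_le hB
  have h4 := abs_le.1 h2
  have h5 := abs_le.1 h3
  have h6 := abs_lt.1 h1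
  rw [abs_lt]
  constructor <;> linarith

/-- A version of the Dunford–Pettis theorem: countably many sequences, each of them bounded in
`L^p` with `p > 1`, converge weakly in `L¹` along a common subsequence. -/
theorem BoundedInLp.exists_subseq_tendstoWeakly [MeasurableSpace.CountablyGenerated X] {ι : Type*}
    [Countable ι] {p : ℝ} (hp : 1 < p) {C : ι → ℝ} {g : ι → ℕ → X → ℝ}
    (hg : ∀ i, BoundedInLp μ p (C i) (g i)) :
    ∃ φ : ℕ → ℕ, StrictMono φ ∧ ∃ G : ι → X → ℝ, ∀ i, Integrable (G i) μ ∧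
      TendstoWeakly μ (fun k => g i (φ k)) (G i) := by
  obtain ⟨φ, hφ, G, hG⟩ := exists_subseq_tendstoWeakly_of_bounded (ι := ι × ℕ)
    (g := fun i k x => truncate (i.2 + 1) (g i.1 k x)) (μ := μ)
    (fun i k => (continuous_truncate _).comp_aestronglyMeasurable
      ((hg i.1).aestronglyMeasurable k))
    (M := fun i => i.2 + 1) (fun i k x => abs_truncate_le (by positivity) _)
  have h := fun i => ((hg i).comp φ).exists_tendstoWeakly_of_truncate hp
    (G := fun m => G (i, m)) (fun m => (hG (i, m)).1) (fun m => (hG (i, m)).2)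
  choose L hL using h
  exact ⟨φ, hφ, L, hL⟩

/-- If the `g k` are bounded in `L^p` and the `c k` are bounded and tend to `0` almost everywhere,
then `c k * g k` tends to `0` in `L¹`. -/
theorem BoundedInLp.tendsto_integral_abs_mul {p C : ℝ} (hp : 1 < p) {g : ℕ → X → ℝ}
    (hg : BoundedInLp μ p C g) {c : ℕ → X → ℝ} (hc : ∀ k, AEStronglyMeasurable (c k) μ) {B : ℝ}
    (hB : ∀ k x, |c k x| ≤ B) (hlim : ∀ᵐ x ∂μ, Tendsto (fun k => c k x) atTop (𝓝 0)) :
    Tendsto (fun k => ∫ x, |c k x * g k x| ∂μ) atTop (𝓝 0) := by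
  have hC := hg.nonneg
  obtain ⟨B, hB0, hB⟩ : ∃ B, 0 ≤ B ∧ ∀ k x, |c k x| ≤ B :=
    ⟨|B|, abs_nonneg _, fun k x => (hB k x).trans (le_abs_self _)⟩
  have h0 : Tendsto (fun k => ∫ x, |c k x| ∂μ) atTop (𝓝 0) := by
    have := tendsto_integral_of_dominated_convergence (μ := μ) (F := fun k x => |c k x|)
      (f := fun _ => 0) (fun _ => B) (fun k => (hc k).norm) (integrable_const _)
      (fun k => ae_of_all _ fun x => by simpa using hB k x)
      (hlim.mono fun x hx => by simpa using hx.abs)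
    simpa using this
  have hci : ∀ k, Integrable (fun x => |c k x|) μ := fun k =>
    ((integrable_const B).mono' (hc k) (ae_of_all _ (hB k))).abs
  have hbound : ∀ M : ℝ, 0 < M → ∀ k, ∫ x, |c k x * g k x| ∂μ ≤
      M * ∫ x, |c k x| ∂μ + M ^ (1 - p) * (B * C) := by
    intro M hM k
    have i1 : Integrable (fun x => M * |c k x| + M ^ (1 - p) * (B * |g k x| ^ p)) μ :=
      ((hci k).const_mul M).add (((hg.integrable_rpow k).const_mul B).const_mul _)
    calc ∫ x, |c k x * g k x| ∂μ ≤ ∫ x, (M * |c k x| + M ^ (1 - p) * (B * |g k x| ^ p)) ∂μ := by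
          refine integral_mono (((hg.integrable hp k).test_mul (hc k) (hB k)).abs) i1 fun x => ?_
          show |c k x * g k x| ≤ _
          rw [abs_mul]
          have h1 := le_add_rpow hM hp (abs_nonneg (g k x))
          have h2 := mul_le_mul_of_nonneg_left h1 (abs_nonneg (c k x))
          have h3 := mul_le_mul_of_nonneg_right (hB k x)
            (by positivity : 0 ≤ M ^ (1 - p) * |g k x| ^ p)
          nlinarith
      _ = M * ∫ x, |c k x| ∂μ + M ^ (1 - p) * (B * ∫ x, |g k x| ^ p ∂μ) := by
          rw [integral_add ((hci k).const_mul M)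
            (((hg.integrable_rpow k).const_mul B).const_mul _)]
          simp only [integral_const_mul]
      _ ≤ _ := by gcongr; exact hg.integral_rpow_le k
  rw [Metric.tendsto_atTop]
  intro ε hε
  have hdecay : Tendsto (fun M : ℝ => M ^ (1 - p) * (B * C)) atTop (𝓝 0) := by
    have h1 := (tendsto_rpow_neg_atTop (by linarith : 0 < p - 1)).mul_const (B * C)
    simpa [neg_sub] using h1
  obtain ⟨M, hM1, hM0⟩ := (((tendsto_order.1 hdecay).2 (ε / 2) (by positivity)).and
    (eventually_gt_atTop 0)).exists
  have h1 : Tendsto (fun k => M * ∫ x, |c k x| ∂μ) atTop (𝓝 0) := by simpa using h0.const_mul M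
  obtain ⟨n, hn⟩ := ((tendsto_order.1 h1).2 (ε / 2) (by positivity)).exists_forall_of_atTop
  refine ⟨n, fun k hk => ?_⟩
  rw [Real.dist_eq, sub_zero, abs_of_nonneg (integral_nonneg fun x => abs_nonneg _)]
  have := hbound M hM0 k
  have := hn k hk
  linarith

/-- The product of a bounded sequence which converges almost everywhere and of a weakly convergent
sequence converges weakly. -/
theorem TendstoWeakly.mul {p C : ℝ} (hp : 1 < p) {g : ℕ → X → ℝ} {G : X → ℝ}
    (hw : TendstoWeakly μ g G) (hg : BoundedInLp μ p C g)
    {b : ℕ → X → ℝ} {b₀ : X → ℝ} (hb : ∀ k, AEStronglyMeasurable (b k) μ)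
    (hb₀ : AEStronglyMeasurable b₀ μ) {B : ℝ} (hB : ∀ k x, |b k x| ≤ B) (hB₀ : ∀ x, |b₀ x| ≤ B)
    (hlim : ∀ᵐ x ∂μ, Tendsto (fun k => b k x) atTop (𝓝 (b₀ x))) :
    TendstoWeakly μ (fun k x => b k x * g k x) (fun x => b₀ x * G x) := by
  intro ψ hψ B' hB'
  have h1 : Tendsto (fun k => ∫ x, ψ x * b₀ x * g k x ∂μ) atTop (𝓝 (∫ x, ψ x * b₀ x * G x ∂μ)) :=
    hw _ (hψ.mul hb₀) (B' * B) fun x => by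
      rw [abs_mul]
      exact mul_le_mul (hB' x) (hB₀ x) (abs_nonneg _) ((abs_nonneg _).trans (hB' x))
  have h2 : Tendsto (fun k => ∫ x, |(b k x - b₀ x) * g k x| ∂μ) atTop (𝓝 0) := by
    refine hg.tendsto_integral_abs_mul hp (fun k => (hb k).sub hb₀) (B := B + B) (fun k x => ?_)
      (hlim.mono fun x hx => ?_)
    · exact (abs_sub _ _).trans (add_le_add (hB k x) (hB₀ x))
    · simpa using hx.sub_const (b₀ x)
  have h3 : Tendsto (fun k => ∫ x, ψ x * ((b k x - b₀ x) * g k x) ∂μ) atTop (𝓝 0) := by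
    refine squeeze_zero_norm (fun k => ?_) (by simpa only [mul_zero] using h2.const_mul B')
    exact ((hg.integrable hp k).test_mul ((hb k).sub hb₀) (B := B + B) fun x =>
      (abs_sub _ _).trans (add_le_add (hB k x) (hB₀ x))).abs_integral_test_mul_le hB'
  have h4 := h1.add h3
  simp only [add_zero, mul_assoc] at h4
  refine h4.congr fun k => ?_
  rw [← integral_add]
  · refine integral_congr_ae (ae_of_all _ fun x => ?_)
    ring
  · exact ((hg.integrable hp k).test_mul hb₀ hB₀).test_mul hψ hB'
  · exact ((hg.integrable hp k).test_mul ((hb k).sub hb₀) (B := B + B) fun x =>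
      (abs_sub _ _).trans (add_le_add (hB k x) (hB₀ x))).test_mul hψ hB'

/-- A form of Fatou's lemma. -/
theorem MeasureTheory.lintegral_le_of_ae_tendsto {X : Type*} [MeasurableSpace X]
    {μ : Measure X} {f : ℕ → X → ℝ≥0∞} {F : X → ℝ≥0∞}
    (hf : ∀ k, AEMeasurable (f k) μ) {C : ℝ≥0∞} (hC : ∀ k, ∫⁻ x, f k x ∂μ ≤ C)
    (hlim : ∀ᵐ x ∂μ, Tendsto (fun k => f k x) atTop (𝓝 (F x))) : ∫⁻ x, F x ∂μ ≤ C := by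
  calc ∫⁻ x, F x ∂μ = ∫⁻ x, liminf (fun k => f k x) atTop ∂μ :=
        lintegral_congr_ae (hlim.mono fun x hx => hx.liminf_eq.symm)
    _ ≤ liminf (fun k => ∫⁻ x, f k x ∂μ) atTop := lintegral_liminf_le' hf
    _ ≤ C := liminf_le_of_frequently_le' (Eventually.of_forall hC).frequently

/-- Weak limits of sequences that are bounded in `L^p` are in `L^p`. -/
theorem TendstoWeakly.memLp {p C : ℝ} (hp : 1 < p) {g : ℕ → X → ℝ} {G : X → ℝ}
    (hw : TendstoWeakly μ g G) (hg : BoundedInLp μ p C g) (hG : Integrable G μ) :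
    MemLp G (ENNReal.ofReal p) μ := by
  have hp0 : 0 < p := by linarith
  have hq : p.HolderConjugate (p / (p - 1)) := Real.HolderConjugate.conjExponent hp
  have hmeas : ∀ m : ℕ, AEStronglyMeasurable (fun x => min |G x| m) μ := fun m =>
    (hG.1.norm.inf aestronglyMeasurable_const)
  have ht0 : ∀ (m : ℕ) x, 0 ≤ min |G x| m := fun m x => le_min (abs_nonneg _) (Nat.cast_nonneg _)
  have hpow : ∀ (m : ℕ) (s : ℝ), 0 ≤ s → Integrable (fun x => (min |G x| m) ^ s) μ := by
    intro m s hs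
    refine (integrable_const ((m : ℝ) ^ s)).mono' ((hmeas m).aemeasurable.pow_const s).aestronglyMeasurable
      (ae_of_all _ fun x => ?_)
    rw [Real.norm_of_nonneg (Real.rpow_nonneg (ht0 m x) s)]
    exact Real.rpow_le_rpow (ht0 m x) (min_le_right _ _) hs
  -- test against `sign G * min |G| m ^ (p - 1)` and apply Young's inequality
  have key : ∀ m : ℕ, ∫ x, (min |G x| m) ^ p ∂μ ≤ C := by
    intro m
    set ψ : X → ℝ := fun x => (SignType.sign (G x) : ℝ) * (min |G x| m) ^ (p - 1) with hψd
    have hψ : AEStronglyMeasurable ψ μ := (aestronglyMeasurable_sign hG.1).mul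
      ((hmeas m).aemeasurable.pow_const _).aestronglyMeasurable
    have hψle : ∀ x, |ψ x| ≤ (min |G x| m) ^ (p - 1) := fun x => by
      rw [hψd, abs_mul, abs_of_nonneg (Real.rpow_nonneg (ht0 m x) (p - 1))]
      exact mul_le_of_le_one_left (Real.rpow_nonneg (ht0 m x) _) (abs_sign_le_one _)
    have hψB : ∀ x, |ψ x| ≤ (m : ℝ) ^ (p - 1) := fun x => (hψle x).trans
      (Real.rpow_le_rpow (ht0 m x) (min_le_right _ _) (by linarith))
    have h1 := hw ψ hψ _ hψB
    have h2 : ∫ x, (min |G x| m) ^ p ∂μ ≤ ∫ x, ψ x * G x ∂μ := by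
      refine integral_mono (hpow m p hp0.le) (hG.test_mul hψ hψB) fun x => ?_
      show (min |G x| m) ^ p ≤ (SignType.sign (G x) : ℝ) * (min |G x| m) ^ (p - 1) * G x
      calc (min |G x| m) ^ p = (min |G x| m) ^ (p - 1) * min |G x| m := by
            conv_rhs => rw [← Real.rpow_one (min |G x| m), Real.rpow_one]
            rcases (ht0 m x).eq_or_lt with h | h
            · rw [← h, Real.zero_rpow hp0.ne', mul_zero]
            · rw [Real.rpow_sub_one h.ne', div_mul_cancel₀ _ h.ne']
        _ ≤ (min |G x| m) ^ (p - 1) * |G x| :=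
            mul_le_mul_of_nonneg_left (min_le_left _ _) (Real.rpow_nonneg (ht0 m x) _)
        _ = _ := by rw [← sign_mul_self (G x)]; ring
    have h3 : ∀ k, ∫ x, ψ x * g k x ∂μ ≤
        C / p + (∫ x, (min |G x| m) ^ p ∂μ) / (p / (p - 1)) := by
      intro k
      calc ∫ x, ψ x * g k x ∂μ
          ≤ ∫ x, (|g k x| ^ p / p + (min |G x| m) ^ p / (p / (p - 1))) ∂μ := by
            refine integral_mono ((hg.integrable hp k).test_mul hψ hψB)
              (((hg.integrable_rpow k).div_const _).add ((hpow m p hp0.le).div_const _)) fun x => ?_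
            have hy := Real.young_inequality_of_nonneg (abs_nonneg (g k x))
              (Real.rpow_nonneg (ht0 m x) (p - 1)) hq
            rw [← Real.rpow_mul (ht0 m x), mul_div_cancel₀ _ (by linarith : p - 1 ≠ 0)] at hy
            refine le_trans ?_ hy
            refine (le_abs_self _).trans ?_
            rw [abs_mul, mul_comm]
            exact mul_le_mul_of_nonneg_left (hψle x) (abs_nonneg _)
        _ = (∫ x, |g k x| ^ p ∂μ) / p + (∫ x, (min |G x| m) ^ p ∂μ) / (p / (p - 1)) := by
            rw [integral_add ((hg.integrable_rpow k).div_const _) ((hpow m p hp0.le).div_const _),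
              integral_div, integral_div]
        _ ≤ _ := by gcongr; exact hg.integral_rpow_le k
    have h4 := h2.trans (le_of_tendsto' h1 h3)
    set S := ∫ x, (min |G x| m) ^ p ∂μ
    have h5 : S / (p / (p - 1)) = S - S / p := by field_simp
    rw [h5] at h4
    have h6 : S / p ≤ C / p := by linarith
    exact (div_le_div_iff_of_pos_right hp0).1 h6
  have hle : ∫⁻ x, ENNReal.ofReal (|G x| ^ p) ∂μ ≤ ENNReal.ofReal C := by
    refine lintegral_le_of_ae_tendsto (f := fun (m : ℕ) x => ENNReal.ofReal ((min |G x| m) ^ p))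
      (fun m => ((hmeas m).aemeasurable.pow_const p).ennreal_ofReal) (fun m => ?_)
      (ae_of_all _ fun x => ?_)
    · rw [← ofReal_integral_eq_lintegral_ofReal (hpow m p hp0.le)
        (ae_of_all _ fun x => Real.rpow_nonneg (ht0 m x) p)]
      exact ENNReal.ofReal_le_ofReal (key m)
    · obtain ⟨m₀, hm₀⟩ := exists_nat_ge |G x|
      refine tendsto_const_nhds.congr' ((eventually_ge_atTop m₀).mono fun m hm => ?_)
      beta_reduce
      rw [min_eq_left (hm₀.trans (Nat.cast_le.2 hm))]
  rw [← integrable_norm_rpow_iff hG.1 (by simpa using hp0) ENNReal.ofReal_ne_top,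
    ENNReal.toReal_ofReal hp0.le]
  refine ⟨(hG.1.norm.aemeasurable.pow_const p).aestronglyMeasurable, ?_⟩
  rw [hasFiniteIntegral_iff_ofReal (ae_of_all _ fun x => by positivity)]
  exact hle.trans_lt ENNReal.ofReal_lt_top

end WeakConvergence

/-! ### Globally defined coordinate functions -/

section Coordinates

/-- The functions `f a ∈ C^1_c(N)`, for `a : Fin n`, are coordinate functions on the open set `V`:
their differentials are a basis of the cotangent space at each point of `V`, in which the
Riemannian metric and the differentials of the `C^1` functions have continuous coefficients. -/
structure IsCoordinateSystem {n : ℕ} {N : Type*} [TopologicalSpace N]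
    [ChartedSpace (EuclideanSpace ℝ (Fin n)) N]
    [RiemannianBundle (fun q : N => TangentSpace (𝓡 n) q)] (V : Set N) (f : Fin n → N → ℝ) :
    Prop where
  isOpen : IsOpen V
  contMDiff : ∀ a, ContMDiff (𝓡 n) 𝓘(ℝ, ℝ) 1 (f a)
  hasCompactSupport : ∀ a, HasCompactSupport (f a)
  abs_dirDeriv_le : ∀ q ∈ V, ∀ (a : Fin n) (ξ : TangentSpace (𝓡 n) q),
    |dirDeriv (f a) q ξ| ≤ 2 * ‖ξ‖
  norm_le : ∀ q ∈ V, ∀ ξ : TangentSpace (𝓡 n) q, ‖ξ‖ ≤ 2 * ∑ a, |dirDeriv (f a) q ξ|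
  exists_dirDeriv_eq : ∀ q ∈ V, ∀ t : Fin n → ℝ, ∃ ξ : TangentSpace (𝓡 n) q,
    ∀ a, dirDeriv (f a) q ξ = t a
  metric : ∃ g : Fin n → Fin n → N → ℝ, (∀ a b, ContinuousOn (g a b) V) ∧
    ∀ q ∈ V, ∀ ξ : TangentSpace (𝓡 n) q,
      ‖ξ‖ ^ 2 = ∑ a, ∑ b, g a b q * dirDeriv (f a) q ξ * dirDeriv (f b) q ξ
  dirDeriv_eq_sum : ∀ F : N → ℝ, ContMDiff (𝓡 n) 𝓘(ℝ, ℝ) 1 F →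
    ∃ β : Fin n → N → ℝ, (∀ a, ContinuousOn (β a) V) ∧ ∀ q ∈ V, ∀ ξ : TangentSpace (𝓡 n) q,
      dirDeriv F q ξ = ∑ a, β a q * dirDeriv (f a) q ξ

variable {n : ℕ} {N : Type*} [MetricSpace N]
    [ChartedSpace (EuclideanSpace ℝ (Fin n)) N] [IsManifold (𝓡 n) ∞ N]
    [RiemannianBundle (fun q : N => TangentSpace (𝓡 n) q)]
    [IsContinuousRiemannianBundle (EuclideanSpace ℝ (Fin n))
      (fun q : N => TangentSpace (𝓡 n) q)]

theorem EuclideanSpace.norm_le_sum_abs {n : ℕ} (x : EuclideanSpace ℝ (Fin n)) :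
    ‖x‖ ≤ ∑ a, |x a| := by
  calc ‖x‖ = ‖∑ a, x a • EuclideanSpace.basisFun (Fin n) ℝ a‖ := by
        conv_lhs => rw [← (EuclideanSpace.basisFun (Fin n) ℝ).sum_repr x]
        simp
    _ ≤ ∑ a, |x a| := (norm_sum_le _ _).trans_eq (Finset.sum_congr rfl fun a _ => by
        rw [norm_smul, OrthonormalBasis.norm_eq_one, mul_one, Real.norm_eq_abs])

/-- Coordinate functions on `V` are the components of an adapted chart, multiplied by a bump function
which is equal to `1` on `V`. -/
theorem exists_isCoordinateSystem (x : N) :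
    ∃ (V : Set N) (f : Fin n → N → ℝ), IsCoordinateSystem V f ∧ x ∈ V := by
  obtain ⟨c, τ, hc, hx⟩ := exists_isAdaptedChart (n := n) x
  obtain ⟨ρ, -, hρ⟩ := (SmoothBumpFunction.nhds_basis_tsupport (I := 𝓡 n) x).mem_iff.1
    (c.open_source.mem_nhds hx)
  have hρ1 : ContMDiff (𝓡 n) 𝓘(ℝ, ℝ) 1 ρ := ρ.contMDiff.of_le (by simp)
  obtain ⟨V, hV1, hV, hxV⟩ := mem_nhds_iff.1 (inter_mem ρ.eventuallyEq_one
    (c.open_source.mem_nhds hx))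
  have hVc : V ⊆ c.source := fun q hq => (hV1 hq).2
  let f : Fin n → N → ℝ := fun a q => ρ q * (c q) a
  have hf : ∀ a, ContMDiff (𝓡 n) 𝓘(ℝ, ℝ) 1 (f a) := by
    intro a
    refine contMDiff_of_tsupport fun q hq => ?_
    have hq' : q ∈ c.source := hρ (tsupport_mul_subset_left hq)
    have h1 : ContMDiffAt (𝓡 n) 𝓘(ℝ, ℝ) 1 (fun q => (c q) a) q :=
      ((EuclideanSpace.proj (𝕜 := ℝ) a).contMDiff.contMDiffAt (x := c q)).comp q
        ((hc.contMDiffOn q hq').contMDiffAt (c.open_source.mem_nhds hq'))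
    exact (hρ1 q).mul h1
  have hfd : ∀ q ∈ V, ∀ (ξ : TangentSpace (𝓡 n) q) a, dirDeriv (f a) q ξ = τ q ξ a := by
    intro q hq ξ a
    have hqc := hVc hq
    rw [hc.dirDeriv_eq hqc (hf a)]
    have h5 : (fun y => f a (c.symm y)) =ᶠ[𝓝 (c q)] fun y => EuclideanSpace.proj (𝕜 := ℝ) a y := by
      have h6 : c.symm ⁻¹' V ∈ 𝓝 (c q) :=
        (c.continuousAt_symm (c.map_source hqc)).preimage_mem_nhds
          (by rw [c.left_inv hqc]; exact hV.mem_nhds hq)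
      filter_upwards [c.open_target.mem_nhds (c.map_source hqc), h6] with y hy hyV
      have h7 : ρ (c.symm y) = 1 := (hV1 hyV).1
      simp only [f]
      rw [h7, c.right_inv hy, one_mul]
      rfl
    rw [h5.fderiv_eq, ContinuousLinearMap.fderiv]
    rfl
  refine ⟨V, f, ⟨hV, hf, fun a => ?_, fun q hq a ξ => ?_, fun q hq ξ => ?_, fun q hq t => ?_,
    ?_, ?_⟩, hxV⟩
  · exact ρ.hasCompactSupport.mul_right
  · rw [hfd q hq]
    exact (PiLp.norm_apply_le _ a).trans (hc.norm_le q (hVc hq) ξ)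
  · simp only [hfd q hq]
    refine (hc.le_norm q (hVc hq) ξ).trans ?_
    have := EuclideanSpace.norm_le_sum_abs (τ q ξ)
    linarith
  · refine ⟨(τ q).symm (WithLp.toLp 2 t), fun a => ?_⟩
    rw [hfd q hq, ContinuousLinearEquiv.apply_symm_apply]
  · obtain ⟨g, hg, hgm⟩ := hc.metric
    refine ⟨g, fun a b => (hg a b).mono hVc, fun q hq ξ => ?_⟩
    simp only [hfd q hq]
    exact hgm q (hVc hq) ξ
  · intro F hF
    refine ⟨fun a q => fderiv ℝ (fun y => F (c.symm y)) (c q) (EuclideanSpace.basisFun (Fin n) ℝ a),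
      fun a => ?_, fun q hq ξ => ?_⟩
    · have h1 := (hc.contDiffOn_comp_symm hF).continuousOn_fderiv_of_isOpen c.open_target le_rfl
      have h2 : ContinuousOn (fun q => fderiv ℝ (fun y => F (c.symm y)) (c q)) V :=
        h1.comp (c.continuousOn.mono hVc) fun q hq => c.map_source (hVc hq)
      exact h2.clm_apply continuousOn_const
    · simp only [hfd q hq]
      rw [hc.dirDeriv_eq (hVc hq) hF]
      conv_lhs => rw [← (EuclideanSpace.basisFun (Fin n) ℝ).sum_repr (τ q ξ)]
      rw [map_sum]
      refine Finset.sum_congr rfl fun a _ => ?_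
      rw [map_smul, smul_eq_mul, mul_comm]
      simp

end Coordinates

/-! ### Measurability -/

section Measurability

theorem ContinuousOn.measurable_indicator {N : Type*} [TopologicalSpace N] [MeasurableSpace N]
    [BorelSpace N] {V : Set N} (hV : IsOpen V) {g : N → ℝ} (hg : ContinuousOn g V) :
    Measurable (V.indicator g) := by
  classical
  rw [← Set.piecewise_eq_indicator]
  exact hg.measurable_piecewise continuousOn_const hV.measurableSet

/-- Jensen's inequality for the power function and a probability measure. -/
theorem MeasureTheory.rpow_lintegral_le_lintegral_rpow {X : Type*} [MeasurableSpace X]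
    {μ : Measure X} [IsProbabilityMeasure μ] {p : ℝ} (hp : 1 ≤ p) {f : X → ℝ≥0∞}
    (hf : AEMeasurable f μ) : (∫⁻ x, f x ∂μ) ^ p ≤ ∫⁻ x, f x ^ p ∂μ := by
  have h1 := eLpNorm'_le_eLpNorm'_of_exponent_le one_pos hp μ hf.aestronglyMeasurable
  simp only [eLpNorm'_eq_lintegral_enorm, enorm_eq_self, ENNReal.rpow_one, one_div, inv_one] at h1
  calc (∫⁻ x, f x ∂μ) ^ p ≤ ((∫⁻ x, f x ^ p ∂μ) ^ p⁻¹) ^ p := by gcongr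
    _ = _ := by rw [← ENNReal.rpow_mul, inv_mul_cancel₀ (by linarith), ENNReal.rpow_one]

variable {d n : ℕ} {N : Type*} [MetricSpace N] [ChartedSpace (EuclideanSpace ℝ (Fin n)) N]
    [RiemannianBundle (fun q : N => TangentSpace (𝓡 n) q)]

variable (n N) in
theorem exists_countable_isCoordinateSystem [Nonempty N] [SecondCountableTopology N]
    [IsManifold (𝓡 n) ∞ N] [IsContinuousRiemannianBundle (EuclideanSpace ℝ (Fin n))
      (fun q : N => TangentSpace (𝓡 n) q)] :
    ∃ (V : ℕ → Set N) (f : ℕ → Fin n → N → ℝ), (∀ i, IsCoordinateSystem (V i) (f i)) ∧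
      ∀ q, ∃ i, q ∈ V i := by
  choose V f hVf hx using fun x : N => exists_isCoordinateSystem (n := n) x
  obtain ⟨s, hs, hsV⟩ := TopologicalSpace.countable_cover_nhds fun x =>
    (hVf x).isOpen.mem_nhds (hx x)
  have hsn : s.Nonempty := by
    obtain ⟨q⟩ := ‹Nonempty N›
    have : q ∈ ⋃ x ∈ s, V x := hsV ▸ Set.mem_univ q
    simp only [Set.mem_iUnion] at this
    exact ⟨_, this.choose_spec.choose⟩
  obtain ⟨e, rfl⟩ := hs.exists_eq_range hsn
  refine ⟨fun i => V (e i), fun i => f (e i), fun i => hVf _, fun q => ?_⟩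
  have : q ∈ ⋃ x ∈ Set.range e, V x := hsV ▸ Set.mem_univ q
  simpa using this

/-- The distance of `N` is the supremum of the differences `|Φ m a - Φ m b|`, up to the gradient
bound: it is enough to bound these differences in order to bound the distance. -/
theorem IsApproxFamily.edist_le {Φ : ℕ → N → ℝ} (hΦ : IsApproxFamily n Φ) {a b : N} {K : ℝ≥0∞}
    (h : ∀ m, ENNReal.ofReal |Φ m a - Φ m b| ≤ K) : edist a b ≤ K := by
  rcases eq_or_ne K ⊤ with rfl | hK
  · exact le_top
  lift K to ℝ≥0 using hK
  rw [edist_dist, ← ENNReal.ofReal_coe_nnreal]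
  refine ENNReal.ofReal_le_ofReal (le_of_forall_pos_le_add fun ε hε => ?_)
  rcases (dist_nonneg (x := a) (y := b)).eq_or_lt with h0 | h0
  · rw [← h0]; positivity
  obtain ⟨m, hm⟩ := hΦ.exists_approx b (dist a b) (ε / 2) h0 (by positivity)
  have h1 := hm a
  have h2 := hm b
  have h3 := h m
  rw [← ENNReal.ofReal_coe_nnreal, ENNReal.ofReal_le_ofReal_iff K.coe_nonneg] at h3
  rw [sub_self, max_self, sub_zero] at h1
  rw [dist_self, sub_zero, max_eq_left h0.le] at h2
  linarith [abs_le.1 h1, abs_le.1 h2, abs_le.1 h3]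

theorem IsApproxFamily.injective {Φ : ℕ → N → ℝ} (hΦ : IsApproxFamily n Φ) :
    Function.Injective fun (q : N) m => Φ m q := by
  intro a b hab
  have := hΦ.edist_le (a := a) (b := b) (K := 0) fun m => by simp [congrFun hab m]
  simpa using this

/-- A map is measurable if its compositions with the `Φ m` are, because the `Φ m` form a continuous
injection of `N`, which is a Polish space, into `ℝ^ℕ`. -/
theorem IsApproxFamily.aemeasurable [CompleteSpace N] [SecondCountableTopology N] [Nonempty N]
    [MeasurableSpace N] [BorelSpace N] {Φ : ℕ → N → ℝ} (hΦ : IsApproxFamily n Φ)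
    {X : Type*} [MeasurableSpace X] {μ : Measure X}
    {u : X → N} (hu : ∀ m, AEMeasurable (fun x => Φ m (u x)) μ) : AEMeasurable u μ := by
  have h1 : MeasurableEmbedding fun (q : N) m => Φ m q :=
    (continuous_pi fun m => (hΦ.contMDiff m).continuous).measurableEmbedding hΦ.injective
  obtain ⟨g, hg, hgΦ⟩ := h1.exists_measurable_extend measurable_id fun _ => ‹_›
  have h2 : u = fun x => g fun m => Φ m (u x) := funext fun x => (congrFun hgΦ (u x)).symm
  rw [h2]
  exact hg.comp_aemeasurable (aemeasurable_pi_lambda _ hu)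

theorem HasWeakDerivOn.aestronglyMeasurable_apply {D : Set (EuclideanSpace ℝ (Fin d))}
    {w : EuclideanSpace ℝ (Fin d) → ℝ}
    {g : EuclideanSpace ℝ (Fin d) → EuclideanSpace ℝ (Fin d) →L[ℝ] ℝ}
    (h : HasWeakDerivOn D w g) (v : EuclideanSpace ℝ (Fin d)) :
    AEStronglyMeasurable (fun x => g x v) (volume.restrict D) :=
  (ContinuousLinearMap.apply ℝ ℝ v).continuous.comp_aestronglyMeasurable h.2.1.aestronglyMeasurable

theorem norm_apply_le_frobeniusNormAt (q : N)
    (T : EuclideanSpace ℝ (Fin d) →L[ℝ] TangentSpace (𝓡 n) q) (v : EuclideanSpace ℝ (Fin d)) :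
    ‖T v‖ ≤ frobeniusNormAt q T * ‖v‖ := by
  calc ‖T v‖ = ‖∑ i, v i • T (EuclideanSpace.basisFun (Fin d) ℝ i)‖ := by
        conv_lhs => rw [← (EuclideanSpace.basisFun (Fin d) ℝ).sum_repr v]
        simp
    _ ≤ ∑ i, ‖v i‖ * ‖T (EuclideanSpace.basisFun (Fin d) ℝ i)‖ :=
        (norm_sum_le _ _).trans_eq (Finset.sum_congr rfl fun i _ => norm_smul _ _)
    _ ≤ √(∑ i, ‖v i‖ ^ 2) * √(∑ i, ‖T (EuclideanSpace.basisFun (Fin d) ℝ i)‖ ^ 2) :=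
        Real.sum_mul_le_sqrt_mul_sqrt _ _ _
    _ = _ := by rw [mul_comm, frobeniusNormAt, EuclideanSpace.norm_eq]

theorem frobeniusNormAt_nonneg (q : N) (T : EuclideanSpace ℝ (Fin d) →L[ℝ] TangentSpace (𝓡 n) q) :
    0 ≤ frobeniusNormAt q T := Real.sqrt_nonneg _

/-- The norm of a field of linear maps along `u` is measurable if its coordinates are: on the set
where `u` takes its values in `V i`, it is expressed by the coefficients of the metric. -/
theorem aemeasurable_frobeniusNormAt [MeasurableSpace N] [BorelSpace N]
    {V : ℕ → Set N} {f : ℕ → Fin n → N → ℝ} (hV : ∀ i, IsCoordinateSystem (V i) (f i))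
    (hcov : ∀ q, ∃ i, q ∈ V i) {X : Type*} [MeasurableSpace X] {μ : Measure X} {u : X → N}
    (hu : AEMeasurable u μ) {T : ∀ x, EuclideanSpace ℝ (Fin d) →L[ℝ] TangentSpace (𝓡 n) (u x)}
    (hT : ∀ i a v, AEMeasurable (fun x => dirDeriv (f i a) (u x) (T x v)) μ) :
    AEMeasurable (fun x => frobeniusNormAt (u x) (T x)) μ := by
  have hmk := hu.measurable_mk
  have hcov' : ⋃ i, hu.mk u ⁻¹' V i = Set.univ := Set.eq_univ_of_forall fun x => by
    simpa using hcov (hu.mk u x)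
  rw [← Measure.restrict_univ (μ := μ), ← hcov', aemeasurable_iUnion_iff]
  intro i
  obtain ⟨g, hg, hgm⟩ := (hV i).metric
  have h1 : AEMeasurable (fun x => √(∑ j : Fin d, ∑ a, ∑ b, (V i).indicator (g a b) (hu.mk u x) *
      dirDeriv (f i a) (u x) (T x (EuclideanSpace.basisFun (Fin d) ℝ j)) *
      dirDeriv (f i b) (u x) (T x (EuclideanSpace.basisFun (Fin d) ℝ j))))
      (μ.restrict (hu.mk u ⁻¹' V i)) := by
    refine AEMeasurable.sqrt ?_
    refine Finset.aemeasurable_fun_sum _ fun j _ => Finset.aemeasurable_fun_sum _ fun a _ =>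
      Finset.aemeasurable_fun_sum _ fun b _ => ?_
    exact ((((hg a b).measurable_indicator (hV i).isOpen).comp hmk).aemeasurable.mul
      (hT i a _).restrict).mul (hT i b _).restrict
  refine h1.congr ?_
  filter_upwards [ae_restrict_of_ae hu.ae_eq_mk, ae_restrict_mem (hmk (hV i).isOpen.measurableSet)]
    with x hx hxV
  rw [Set.mem_preimage, ← hx] at hxV
  rw [frobeniusNormAt]
  congr 1
  refine Finset.sum_congr rfl fun j _ => ?_
  rw [hgm _ hxV]
  simp only [← hx, Set.indicator_of_mem hxV]

end Measurability

/-! ### Estimates on the translates of a map -/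

section Translation

variable {d n : ℕ} {N : Type*} [MetricSpace N] [ChartedSpace (EuclideanSpace ℝ (Fin n)) N]
    [RiemannianBundle (fun q : N => TangentSpace (𝓡 n) q)]

theorem MeasureTheory.ae_ae_translate {P : EuclideanSpace ℝ (Fin d) → Prop} (hP : ∀ᵐ x, P x)
    (v : EuclideanSpace ℝ (Fin d)) (ν : Measure ℝ) [SFinite ν] :
    ∀ᵐ y : EuclideanSpace ℝ (Fin d), ∀ᵐ s ∂ν, P (y + s • v) := by
  have h1 : ∀ᵐ z : ℝ × EuclideanSpace ℝ (Fin d) ∂(ν.prod volume), P (z.2 + z.1 • v) :=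
    ((Measure.quasiMeasurePreserving_snd.comp
      (measurePreserving_shear v ν).quasiMeasurePreserving).ae hP)
  exact Measure.ae_ae_of_ae_prod
    ((Measure.measurePreserving_swap (μ := volume) (ν := ν)).quasiMeasurePreserving.ae h1)

/-- The displacement of `u` along a segment is bounded by the integral of `|du|`, as one sees by
composing `u` with the functions `Φ m`. -/
theorem IsColocalWeakDerivOn.ae_edist_translate_le {Φ : ℕ → N → ℝ} (hΦ : IsApproxFamily n Φ)
    {D : Set (EuclideanSpace ℝ (Fin d))} {u : EuclideanSpace ℝ (Fin d) → N}
    {du : ∀ x, EuclideanSpace ℝ (Fin d) →L[ℝ] TangentSpace (𝓡 n) (u x)}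
    (h : IsColocalWeakDerivOn D u du) {U : Set (EuclideanSpace ℝ (Fin d))} (hU : IsOpen U)
    (v : EuclideanSpace ℝ (Fin d)) (hUD : ∀ y ∈ U, ∀ s ∈ Set.Icc (0 : ℝ) 1, y + s • v ∈ D) :
    ∀ᵐ y, y ∈ U → edist (u (y + v)) (u y) ≤ ENNReal.ofReal (5 * ‖v‖) *
      ∫⁻ s in Set.Icc (0 : ℝ) 1,
        ENNReal.ofReal (frobeniusNormAt (u (y + s • v)) (du (y + s • v))) := by
  have h1 : ∀ᵐ y, ∀ m, y ∈ U → Φ m (u (y + v)) - Φ m (u y) =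
      ∫ s in Set.Icc (0 : ℝ) 1, dirDeriv (Φ m) (u (y + s • v)) (du (y + s • v) v) :=
    ae_all_iff.2 fun m =>
      (h (Φ m) (hΦ.contMDiff m) (hΦ.hasCompactSupport m)).ae_translate_sub_eq hU v hUD
  filter_upwards [h1] with y hy hyU
  refine hΦ.edist_le fun m => ?_
  rw [hy m hyU, ← Real.enorm_eq_ofReal_abs, ← lintegral_const_mul' _ _ ENNReal.ofReal_ne_top]
  refine (enorm_integral_le_lintegral_enorm _).trans (lintegral_mono fun s => ?_)
  rw [Real.enorm_eq_ofReal_abs, ← ENNReal.ofReal_mul (by positivity)]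
  refine ENNReal.ofReal_le_ofReal ((hΦ.hasGradientBound m _ _).trans ?_)
  have := norm_apply_le_frobeniusNormAt (u (y + s • v)) (du (y + s • v)) v
  linarith

/-- The `L^p` distance between `u` and its translates is controlled by the energy of `u`. -/
theorem IsColocalWeakDerivOn.lintegral_edist_translate_le {Φ : ℕ → N → ℝ}
    (hΦ : IsApproxFamily n Φ) {D : Set (EuclideanSpace ℝ (Fin d))} (hD : IsOpen D)
    {u : EuclideanSpace ℝ (Fin d) → N}
    {du : ∀ x, EuclideanSpace ℝ (Fin d) →L[ℝ] TangentSpace (𝓡 n) (u x)}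
    (h : IsColocalWeakDerivOn D u du)
    (hdu : AEMeasurable (fun x => frobeniusNormAt (u x) (du x)) (volume.restrict D))
    {U : Set (EuclideanSpace ℝ (Fin d))} (hU : IsOpen U)
    (v : EuclideanSpace ℝ (Fin d)) (hUD : ∀ y ∈ U, ∀ s ∈ Set.Icc (0 : ℝ) 1, y + s • v ∈ D)
    {p : ℝ} (hp : 1 ≤ p) :
    ∫⁻ y in U, edist (u (y + v)) (u y) ^ p ≤
      ENNReal.ofReal (5 * ‖v‖) ^ p * derivEnergy D p u du := by
  -- a measurable representative of `|du|`, extended by `0` outside of `D`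
  have hm := (hdu.ennreal_ofReal.measurable_mk).indicator hD.measurableSet
  set G : EuclideanSpace ℝ (Fin d) → ℝ≥0∞ := D.indicator (hdu.ennreal_ofReal.mk _) with hGdef
  have hG : ∀ᵐ x, x ∈ D → ENNReal.ofReal (frobeniusNormAt (u x) (du x)) = G x := by
    have := (ae_restrict_iff' hD.measurableSet).1 hdu.ennreal_ofReal.ae_eq_mk
    filter_upwards [this] with x hx hxD
    rw [hx hxD, hGdef, Set.indicator_of_mem hxD]
  have hp0 : 0 < p := by linarith
  have : IsProbabilityMeasure (volume.restrict (Set.Icc (0 : ℝ) 1)) := ⟨by simp⟩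
  have h2 : ∀ᵐ y, y ∈ U → edist (u (y + v)) (u y) ^ p ≤ ENNReal.ofReal (5 * ‖v‖) ^ p *
      ∫⁻ s in Set.Icc (0 : ℝ) 1, G (y + s • v) ^ p := by
    filter_upwards [h.ae_edist_translate_le hΦ hU v hUD,
      ae_ae_translate hG v (volume.restrict (Set.Icc (0 : ℝ) 1))] with y hy1 hy2 hyU
    have e : ∫⁻ s in Set.Icc (0 : ℝ) 1,
        ENNReal.ofReal (frobeniusNormAt (u (y + s • v)) (du (y + s • v))) =
        ∫⁻ s in Set.Icc (0 : ℝ) 1, G (y + s • v) := by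
      refine lintegral_congr_ae ?_
      filter_upwards [hy2, ae_restrict_mem measurableSet_Icc] with s hs hs1
      exact hs (hUD y hyU s hs1)
    have h3 := hy1 hyU
    rw [e] at h3
    calc _ ≤ (ENNReal.ofReal (5 * ‖v‖) * ∫⁻ s in Set.Icc (0 : ℝ) 1, G (y + s • v)) ^ p := by gcongr
      _ = ENNReal.ofReal (5 * ‖v‖) ^ p * (∫⁻ s in Set.Icc (0 : ℝ) 1, G (y + s • v)) ^ p :=
          ENNReal.mul_rpow_of_nonneg _ _ hp0.le
      _ ≤ _ := by
          gcongr
          exact rpow_lintegral_le_lintegral_rpow hp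
            (hm.comp (by fun_prop : Measurable fun s : ℝ => y + s • v)).aemeasurable
  calc ∫⁻ y in U, edist (u (y + v)) (u y) ^ p
      ≤ ∫⁻ y in U, ENNReal.ofReal (5 * ‖v‖) ^ p * ∫⁻ s in Set.Icc (0 : ℝ) 1, G (y + s • v) ^ p :=
        lintegral_mono_ae ((ae_restrict_iff' hU.measurableSet).2 h2)
    _ = ENNReal.ofReal (5 * ‖v‖) ^ p *
        ∫⁻ y in U, ∫⁻ s in Set.Icc (0 : ℝ) 1, G (y + s • v) ^ p :=
        lintegral_const_mul' _ _ (ENNReal.rpow_ne_top_of_nonneg hp0.le ENNReal.ofReal_ne_top)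
    _ ≤ _ := by
        gcongr
        rw [lintegral_lintegral_swap
          ((hm.comp (by fun_prop : Measurable fun z : EuclideanSpace ℝ (Fin d) × ℝ =>
            z.1 + z.2 • v)).pow_const p).aemeasurable]
        calc ∫⁻ s in Set.Icc (0 : ℝ) 1, ∫⁻ y in U, G (y + s • v) ^ p
            ≤ ∫⁻ s in Set.Icc (0 : ℝ) 1, ∫⁻ y, G y ^ p := by
              refine lintegral_mono fun s => (setLIntegral_le_lintegral _ _).trans_eq ?_
              exact lintegral_add_right_eq_self (fun y => G y ^ p) (s • v)
          _ = ∫⁻ y, G y ^ p := by simp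
          _ = derivEnergy D p u du := by
              rw [derivEnergy, ← lintegral_indicator hD.measurableSet]
              refine lintegral_congr_ae ?_
              filter_upwards [hG] with x hx
              by_cases hxD : x ∈ D
              · rw [Set.indicator_of_mem hxD, hx hxD]
              · rw [Set.indicator_of_notMem hxD, hGdef, Set.indicator_of_notMem hxD,
                  ENNReal.zero_rpow_of_pos hp0]

end Translation

/-! ### Compactness for maps into a metric space -/

section Compactness

variable {d : ℕ} {D U : Set (EuclideanSpace ℝ (Fin d))}

/-- If the functions `g k` converge weakly, then their averages over the translates of a fixed ball
converge pointwise. -/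
theorem TendstoWeakly.tendsto_integral_ball {g : ℕ → EuclideanSpace ℝ (Fin d) → ℝ}
    {G : EuclideanSpace ℝ (Fin d) → ℝ} (hw : TendstoWeakly (volume.restrict D) g G)
    {y h₀ : EuclideanSpace ℝ (Fin d)} {r : ℝ} (hy : ∀ h ∈ Metric.ball h₀ r, y + h ∈ D) :
    ∃ L, Tendsto (fun k => ∫ h in Metric.ball h₀ r, g k (y + h)) atTop (𝓝 L) := by
  have hsub : Metric.ball (y + h₀) r ⊆ D := fun x hx => by
    have := hy (x - y) (by
      rw [Metric.mem_ball, dist_eq_norm] at hx ⊢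
      rwa [sub_sub])
    rwa [add_sub_cancel] at this
  refine ⟨_, (hw ((Metric.ball (y + h₀) r).indicator fun _ => 1)
    ((stronglyMeasurable_const.indicator Metric.isOpen_ball.measurableSet).aestronglyMeasurable) 1
    fun x => ?_).congr fun k => ?_⟩
  · by_cases hx : x ∈ Metric.ball (y + h₀) r <;> simp [hx]
  · have e1 : ∀ x, (Metric.ball (y + h₀) r).indicator (fun _ => (1 : ℝ)) x * g k x =
        (Metric.ball (y + h₀) r).indicator (g k) x := fun x => by
      by_cases hx : x ∈ Metric.ball (y + h₀) r <;> simp [hx]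
    simp only [e1]
    rw [setIntegral_indicator Metric.isOpen_ball.measurableSet, Set.inter_eq_right.2 hsub,
      ← integral_indicator Metric.isOpen_ball.measurableSet,
      ← integral_indicator Metric.isOpen_ball.measurableSet,
      ← integral_add_left_eq_self _ y]
    refine integral_congr_ae (ae_of_all _ fun h => ?_)
    simp only [Set.indicator, Metric.mem_ball, dist_add_left]

/-- Comparison of two functions through their averages over the translates of a ball. -/
theorem volume_mul_enorm_sub_le {g₁ g₂ : EuclideanSpace ℝ (Fin d) → ℝ} (hg₁ : Measurable g₁)
    (hg₂ : Measurable g₂) (hB₁ : ∀ x, |g₁ x| ≤ 1) (hB₂ : ∀ x, |g₂ x| ≤ 1)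
    (y h₀ : EuclideanSpace ℝ (Fin d)) (r : ℝ) :
    volume (Metric.ball h₀ r) * ‖g₁ y - g₂ y‖ₑ ≤
      (∫⁻ h in Metric.ball h₀ r, ‖g₁ (y + h) - g₁ y‖ₑ) +
      (∫⁻ h in Metric.ball h₀ r, ‖g₂ (y + h) - g₂ y‖ₑ) +
      ‖(∫ h in Metric.ball h₀ r, g₁ (y + h)) - ∫ h in Metric.ball h₀ r, g₂ (y + h)‖ₑ := by
  have hfin : IsFiniteMeasure (volume.restrict (Metric.ball h₀ r)) :=
    ⟨by simpa using measure_ball_lt_top⟩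
  have hint : ∀ g : EuclideanSpace ℝ (Fin d) → ℝ, Measurable g → (∀ x, |g x| ≤ 1) →
      IntegrableOn (fun h => g (y + h)) (Metric.ball h₀ r) := fun g hg hB =>
    (integrable_const (1 : ℝ)).mono' (hg.comp (by fun_prop)).aestronglyMeasurable
      (ae_of_all _ fun h => hB _)
  have e : ∀ g : EuclideanSpace ℝ (Fin d) → ℝ, Measurable g → (∀ x, |g x| ≤ 1) →
      ∫ h in Metric.ball h₀ r, (g (y + h) - g y) =
        (∫ h in Metric.ball h₀ r, g (y + h)) - volume.real (Metric.ball h₀ r) * g y := by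
    intro g hg hB
    rw [integral_sub (hint g hg hB) (integrable_const _), setIntegral_const, smul_eq_mul]
  have h1 : volume (Metric.ball h₀ r) * ‖g₁ y - g₂ y‖ₑ =
      ‖volume.real (Metric.ball h₀ r) * (g₁ y - g₂ y)‖ₑ := by
    rw [enorm_mul, Real.enorm_of_nonneg measureReal_nonneg, Measure.real,
      ENNReal.ofReal_toReal measure_ball_lt_top.ne]
  have h2 : volume.real (Metric.ball h₀ r) * (g₁ y - g₂ y) =
      -(∫ h in Metric.ball h₀ r, (g₁ (y + h) - g₁ y)) +
      (∫ h in Metric.ball h₀ r, (g₂ (y + h) - g₂ y)) +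
      ((∫ h in Metric.ball h₀ r, g₁ (y + h)) - ∫ h in Metric.ball h₀ r, g₂ (y + h)) := by
    rw [e g₁ hg₁ hB₁, e g₂ hg₂ hB₂]; ring
  rw [h1, h2]
  refine (enorm_add_le _ _).trans (add_le_add_left ((enorm_add_le _ _).trans ?_) _)
  rw [enorm_neg]
  exact add_le_add (enorm_integral_le_lintegral_enorm _) (enorm_integral_le_lintegral_enorm _)

theorem lintegral_lintegral_ball_le {F : EuclideanSpace ℝ (Fin d) → EuclideanSpace ℝ (Fin d) → ℝ≥0∞}
    (hF : Measurable (Function.uncurry F)) {h₀ : EuclideanSpace ℝ (Fin d)} {r : ℝ} {K : ℝ≥0∞}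
    (hK : ∀ h ∈ Metric.ball h₀ r, ∫⁻ y in U, F y h ≤ K) :
    ∫⁻ y in U, ∫⁻ h in Metric.ball h₀ r, F y h ≤ K * volume (Metric.ball h₀ r) := by
  rw [lintegral_lintegral_swap hF.aemeasurable]
  calc ∫⁻ h in Metric.ball h₀ r, ∫⁻ y in U, F y h ≤ ∫⁻ h in Metric.ball h₀ r, K :=
        setLIntegral_mono' Metric.isOpen_ball.measurableSet hK
    _ = _ := setLIntegral_const _ _

/-- Weakly convergent bounded functions which satisfy a uniform estimate on their translates
form a Cauchy sequence in `L¹`. -/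
theorem HasInwardBalls.tendsto_lintegral_enorm_sub (hU : HasInwardBalls D U)
    (hD : volume D ≠ ⊤) {g : ℕ → EuclideanSpace ℝ (Fin d) → ℝ}
    {G : EuclideanSpace ℝ (Fin d) → ℝ} (hw : TendstoWeakly (volume.restrict D) g G)
    (hg : ∀ k, Measurable (g k)) (hB : ∀ k x, |g k x| ≤ 1) {C : ℝ≥0}
    (htr : ∀ v, (∀ y ∈ U, ∀ s ∈ Set.Icc (0 : ℝ) 1, y + s • v ∈ D) → ∀ k,
      ∫⁻ y in U, ‖g k (y + v) - g k y‖ₑ ≤ ENNReal.ofReal ‖v‖ * C) :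
    Tendsto (fun i : ℕ × ℕ => ∫⁻ y in U, ‖g i.1 y - g i.2 y‖ₑ) (atTop ×ˢ atTop) (𝓝 0) := by
  rw [ENNReal.tendsto_nhds_zero]
  intro ε hε
  obtain ⟨η, hη, hηε⟩ := ENNReal.lt_iff_exists_nnreal_btwn.1 hε
  have hη0 : (0 : ℝ) < η := by exact_mod_cast hη
  obtain ⟨h₀, r, hr, hrδ, hball⟩ := hU.exists_ball (η / (4 * (C + 1))) (by positivity)
  set H := Metric.ball h₀ r
  have hHv : 0 < volume H := Metric.measure_ball_pos _ _ hr
  have hHt : volume H ≠ ⊤ := measure_ball_lt_top.ne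
  have hUfin : IsFiniteMeasure (volume.restrict U) :=
    ⟨by simpa using (measure_mono hU.subset).trans_lt hD.lt_top⟩
  have hmB : ∀ k, Measurable fun y => ∫ h in H, g k (y + h) := fun k =>
    (StronglyMeasurable.integral_prod_right' (f := fun z : EuclideanSpace ℝ (Fin d) ×
      EuclideanSpace ℝ (Fin d) => g k (z.1 + z.2)) (by
        exact ((hg k).comp (by fun_prop)).stronglyMeasurable)).measurable
  have hBk : ∀ k y, |∫ h in H, g k (y + h)| ≤ volume.real H := by
    intro k y
    have := norm_setIntegral_le_of_norm_le_const (μ := volume) (s := H) (f := fun h => g k (y + h))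
      (C := 1) measure_ball_lt_top fun h _ => hB k _
    simpa using this
  -- the averages converge in `L¹(U)`
  have hav : Tendsto (fun i : ℕ × ℕ => ∫⁻ y in U,
      ‖(∫ h in H, g i.1 (y + h)) - ∫ h in H, g i.2 (y + h)‖ₑ) (atTop ×ˢ atTop) (𝓝 0) := by
    have := tendsto_lintegral_filter_of_dominated_convergence (μ := volume.restrict U)
      (l := (atTop ×ˢ atTop : Filter (ℕ × ℕ)))
      (F := fun (i : ℕ × ℕ) y => ‖(∫ h in H, g i.1 (y + h)) - ∫ h in H, g i.2 (y + h)‖ₑ)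
      (f := fun _ => 0) (fun _ => ENNReal.ofReal (volume.real H + volume.real H))
      (Eventually.of_forall fun i => ((hmB i.1).sub (hmB i.2)).enorm)
      (Eventually.of_forall fun i => ae_of_all _ fun y => ?_) ?_ ?_
    · simpa using this
    · rw [Real.enorm_eq_ofReal_abs]
      exact ENNReal.ofReal_le_ofReal ((abs_sub _ _).trans (add_le_add (hBk _ _) (hBk _ _)))
    · rw [lintegral_const]
      exact ENNReal.mul_ne_top ENNReal.ofReal_ne_top (measure_ne_top _ _)
    · filter_upwards [ae_restrict_mem hU.isOpen.measurableSet] with y hy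
      obtain ⟨L, hL⟩ := hw.tendsto_integral_ball (y := y) (h₀ := h₀) (r := r) fun h hh => by
        simpa using hball y hy h hh 1 (by simp)
      have := ((hL.comp tendsto_fst).sub (hL.comp tendsto_snd)).enorm
      simpa using this
  have hbd : ∀ k, ∫⁻ y in U, ∫⁻ h in H, ‖g k (y + h) - g k y‖ₑ ≤
      ENNReal.ofReal (η / 4) * volume H := by
    intro k
    refine lintegral_lintegral_ball_le
      (((hg k).comp (by fun_prop)).sub ((hg k).comp measurable_fst)).enorm fun h hh => ?_
    refine (htr h (fun y hy s hs => hball y hy h hh s hs) k).trans ?_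
    rw [← ENNReal.ofReal_coe_nnreal, ← ENNReal.ofReal_mul (norm_nonneg _)]
    refine ENNReal.ofReal_le_ofReal ?_
    have h1 : ‖h‖ ≤ η / (4 * (C + 1)) := by
      have := hrδ hh
      rw [mem_ball_zero_iff] at this
      exact this.le
    calc ‖h‖ * C ≤ η / (4 * (C + 1)) * (C + 1) := by gcongr; linarith
      _ = η / 4 := by field_simp
  have hlim := (ENNReal.tendsto_nhds_zero.1 hav) (ENNReal.ofReal (η / 2) * volume H)
    (ENNReal.mul_pos (by simpa using hη0) hHv.ne')
  filter_upwards [hlim] with i hi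
  refine le_trans ?_ hηε.le
  rw [← ENNReal.mul_le_mul_iff_right hHv.ne' hHt, ← lintegral_const_mul' _ _ hHt]
  calc ∫⁻ y in U, volume H * ‖g i.1 y - g i.2 y‖ₑ
      ≤ ∫⁻ y in U, ((∫⁻ h in H, ‖g i.1 (y + h) - g i.1 y‖ₑ) +
        (∫⁻ h in H, ‖g i.2 (y + h) - g i.2 y‖ₑ) +
        ‖(∫ h in H, g i.1 (y + h)) - ∫ h in H, g i.2 (y + h)‖ₑ) :=
        lintegral_mono fun y => volume_mul_enorm_sub_le (hg _) (hg _) (hB _) (hB _) y h₀ r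
    _ = (∫⁻ y in U, ∫⁻ h in H, ‖g i.1 (y + h) - g i.1 y‖ₑ) +
        (∫⁻ y in U, ∫⁻ h in H, ‖g i.2 (y + h) - g i.2 y‖ₑ) +
        ∫⁻ y in U, ‖(∫ h in H, g i.1 (y + h)) - ∫ h in H, g i.2 (y + h)‖ₑ := by
        have hm : ∀ k, Measurable fun y => ∫⁻ h in H, ‖g k (y + h) - g k y‖ₑ := fun k =>
          Measurable.lintegral_prod_right' (f := fun z : EuclideanSpace ℝ (Fin d) ×
            EuclideanSpace ℝ (Fin d) => ‖g k (z.1 + z.2) - g k z.1‖ₑ)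
            (((hg k).comp (by fun_prop)).sub ((hg k).comp measurable_fst)).enorm
        have hm' : Measurable fun y =>
            ‖(∫ h in H, g i.1 (y + h)) - ∫ h in H, g i.2 (y + h)‖ₑ :=
          ((hmB i.1).sub (hmB i.2)).enorm
        rw [lintegral_add_right _ hm', lintegral_add_left (hm _)]
    _ ≤ ENNReal.ofReal (η / 4) * volume H + ENNReal.ofReal (η / 4) * volume H +
        ENNReal.ofReal (η / 2) * volume H := by gcongr <;> exact hbd _
    _ = volume H * η := by
        rw [← add_mul, ← add_mul, ← ENNReal.ofReal_add (by positivity) (by positivity),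
          ← ENNReal.ofReal_add (by positivity) (by positivity), mul_comm,
          ← ENNReal.ofReal_coe_nnreal]
        congr 2
        ring

end Compactness

section Compactness

variable {d : ℕ} {D : Set (EuclideanSpace ℝ (Fin d))}

theorem setLIntegral_le_sum_of_subset_biUnion {ι X : Type*} [MeasurableSpace X] {μ : Measure X}
    {D : Set X} {s : Finset ι} {U : ι → Set X} (h : D ⊆ ⋃ i ∈ s, U i) (F : X → ℝ≥0∞) :
    ∫⁻ x in D, F x ∂μ ≤ ∑ i ∈ s, ∫⁻ x in U i, F x ∂μ := by
  classical
  refine (lintegral_mono_set h).trans ?_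
  clear h
  induction s using Finset.induction_on with
  | empty => simp
  | insert a s ha ih =>
    rw [Finset.set_biUnion_insert, Finset.sum_insert ha]
    exact (lintegral_union_le _ _ _).trans (add_le_add_right ih _)

theorem MeasureTheory.Integrable.lintegral_enorm_le_iff {X : Type*} [MeasurableSpace X]
    {μ : Measure X} {f : X → ℝ} (hf : Integrable f μ) {c : ℝ≥0} :
    ∫⁻ x, ‖f x‖ₑ ∂μ ≤ c ↔ ∫ x, |f x| ∂μ ≤ c := by
  rw [← ofReal_integral_norm_eq_lintegral_enorm hf, ← ENNReal.ofReal_coe_nnreal,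
    ENNReal.ofReal_le_ofReal_iff c.coe_nonneg]
  rfl

/-- A form of the Kolmogorov–Riesz–Fréchet theorem: weakly convergent bounded functions converge
in `L¹` as soon as they satisfy a uniform estimate on their translates. -/
theorem TendstoWeakly.tendsto_lintegral_enorm_sub {ι : Type*} {s : Finset ι}
    {U : ι → Set (EuclideanSpace ℝ (Fin d))} (hU : ∀ i ∈ s, HasInwardBalls D (U i))
    (hcov : D ⊆ ⋃ i ∈ s, U i) (hD : volume D ≠ ⊤) {g : ℕ → EuclideanSpace ℝ (Fin d) → ℝ}
    {G : EuclideanSpace ℝ (Fin d) → ℝ} (hw : TendstoWeakly (volume.restrict D) g G)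
    (hG : IntegrableOn G D) (hg : ∀ k, Measurable (g k)) (hB : ∀ k x, |g k x| ≤ 1) {C : ℝ≥0}
    (htr : ∀ i ∈ s, ∀ v, (∀ y ∈ U i, ∀ s ∈ Set.Icc (0 : ℝ) 1, y + s • v ∈ D) → ∀ k,
      ∫⁻ y in U i, ‖g k (y + v) - g k y‖ₑ ≤ ENNReal.ofReal ‖v‖ * C) :
    Tendsto (fun k => ∫⁻ y in D, ‖g k y - G y‖ₑ) atTop (𝓝 0) := by
  have hfin : IsFiniteMeasure (volume.restrict D) := ⟨by simpa using hD.lt_top⟩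
  have hgi : ∀ k, IntegrableOn (g k) D := fun k =>
    (integrable_const (1 : ℝ)).mono' (hg k).aestronglyMeasurable (ae_of_all _ (hB k))
  have hcauchy : Tendsto (fun i : ℕ × ℕ => ∫⁻ y in D, ‖g i.1 y - g i.2 y‖ₑ)
      (atTop ×ˢ atTop) (𝓝 0) := by
    have h1 : Tendsto (fun i : ℕ × ℕ => ∑ x ∈ s, ∫⁻ y in U x, ‖g i.1 y - g i.2 y‖ₑ)
        (atTop ×ˢ atTop) (𝓝 (∑ x ∈ s, 0)) := tendsto_finsetSum _ fun x hx =>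
      (hU x hx).tendsto_lintegral_enorm_sub hD hw hg hB (htr x hx)
    rw [Finset.sum_const_zero] at h1
    exact tendsto_of_tendsto_of_tendsto_of_le_of_le tendsto_const_nhds h1 (fun _ => zero_le)
      fun i => setLIntegral_le_sum_of_subset_biUnion hcov _
  rw [ENNReal.tendsto_nhds_zero]
  intro ε hε
  obtain ⟨η, hη, hηε⟩ := ENNReal.lt_iff_exists_nnreal_btwn.1 hε
  have h2 := ENNReal.tendsto_nhds_zero.1 hcauchy η hη
  rw [prod_atTop_atTop_eq, eventually_atTop] at h2
  obtain ⟨n, hn⟩ := h2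
  refine eventually_atTop.2 ⟨max n.1 n.2, fun k hk => le_trans ?_ hηε.le⟩
  -- let `l → ∞` in the estimate for `g k - g l`
  have hwk : TendstoWeakly (volume.restrict D) (fun l x => g k x - g (l + max n.1 n.2) x)
      (fun x => g k x - G x) := by
    refine TendstoWeakly.sub (g := fun _ => g k) (fun ψ hψ B hB => tendsto_const_nhds)
      (hw.comp_strictMono (strictMono_id.add_const _)) (fun _ => hgi k) (fun l => hgi _) (hgi k) hG
  have h3 := hwk.integral_abs_le (fun l => (hgi k).sub (hgi _)) ((hgi k).sub hG) (c := η) fun l => by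
    have h4 := hn (k, l + max n.1 n.2) ⟨(le_max_left _ _).trans hk,
      (le_max_right _ _).trans (Nat.le_add_left _ _)⟩
    exact Integrable.lintegral_enorm_le_iff ((hgi k).sub (hgi _)) |>.1 h4
  exact Integrable.lintegral_enorm_le_iff ((hgi k).sub hG) |>.2 h3

/-- A sequence in a proper metric space converges if it has a bounded subsequence and if its truncated
distances to the points of a dense sequence converge. -/
theorem exists_tendsto_of_tendsto_min_dist {N : Type*} [MetricSpace N] [ProperSpace N]
    {q : ℕ → N} (hq : DenseRange q) {x : ℕ → N} {q₀ : N} {R : ℝ}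
    (hR : ∃ᶠ k in atTop, dist (x k) q₀ ≤ R)
    (hx : ∀ j, ∃ L, Tendsto (fun k => min (dist (x k) (q j)) 1) atTop (𝓝 L)) :
    ∃ a, Tendsto x atTop (𝓝 a) := by
  obtain ⟨a, -, φ, hφ, ha⟩ := (isCompact_closedBall q₀ R).tendsto_subseq' hR
  refine ⟨a, Metric.tendsto_nhds.2 fun ε hε => ?_⟩
  obtain ⟨j, hj⟩ := hq.exists_dist_lt a (by positivity : 0 < min ε 1 / 2)
  obtain ⟨L, hL⟩ := hx j
  have h1 : Tendsto (fun k => min (dist (x (φ k)) (q j)) 1) atTop (𝓝 (min (dist a (q j)) 1)) :=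
    (ha.dist tendsto_const_nhds).min tendsto_const_nhds
  rw [tendsto_nhds_unique (hL.comp hφ.tendsto_atTop) h1] at hL
  have h2 : min (dist a (q j)) 1 < min ε 1 / 2 := (min_le_left _ _).trans_lt hj
  have h4 : min ε 1 ≤ 1 := min_le_right _ _
  filter_upwards [(tendsto_order.1 hL).2 _ h2] with k hk
  have h5 : dist (x k) (q j) < min ε 1 / 2 := by
    rcases min_lt_iff.1 hk with h | h
    · exact h
    · linarith
  have h6 := dist_triangle_right (x k) a (q j)
  linarith [min_le_left ε 1]

/-- Countably many sequences that converge in `L¹` converge almost everywhere along a common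
subsequence. -/
theorem exists_subseq_ae_tendsto_of_forall_tendsto_lintegral {X : Type*} [MeasurableSpace X]
    {μ : Measure X} {g : ℕ → ℕ → X → ℝ} {G : ℕ → X → ℝ}
    (hm : ∀ j k, AEMeasurable (fun x => ‖g j k x - G j x‖ₑ) μ)
    (hg : ∀ j, Tendsto (fun k => ∫⁻ x, ‖g j k x - G j x‖ₑ ∂μ) atTop (𝓝 0)) :
    ∃ φ : ℕ → ℕ, StrictMono φ ∧
      ∀ j, ∀ᵐ x ∂μ, Tendsto (fun k => g j (φ k) x) atTop (𝓝 (G j x)) := by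
  have h1 : ∀ n : ℕ, ∀ᶠ k in atTop, ∀ j ∈ Finset.range (n + 1),
      ∫⁻ x, ‖g j k x - G j x‖ₑ ∂μ ≤ 2⁻¹ ^ n := fun n =>
    (Finset.eventually_all _).2 fun j _ => ENNReal.tendsto_nhds_zero.1 (hg j) _
      (ENNReal.pow_pos (by simp) n)
  obtain ⟨φ, hφ, h2⟩ := extraction_forall_of_eventually h1
  refine ⟨φ, hφ, fun j => ?_⟩
  have h3 : ∫⁻ x, ∑' n, ‖g j (φ (n + j)) x - G j x‖ₑ ∂μ ≠ ⊤ := by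
    rw [lintegral_tsum fun n => hm _ _]
    refine ne_top_of_le_ne_top (b := ∑' n : ℕ, 2⁻¹ ^ n) ?_ (ENNReal.tsum_le_tsum fun n => ?_)
    · rw [ENNReal.tsum_geometric, ENNReal.one_sub_inv_two, inv_inv]
      exact ENNReal.ofNat_ne_top
    · refine (h2 (n + j) j (by simp)).trans ?_
      exact pow_le_pow_of_le_one zero_le (by simp) (Nat.le_add_right _ _)
  filter_upwards [ae_lt_top' (AEMeasurable.tsum fun n => hm _ _) h3] with x hx
  have h4 := ENNReal.tendsto_atTop_zero_of_tsum_ne_top hx.ne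
  rw [← tendsto_add_atTop_iff_nat j, tendsto_iff_edist_tendsto_0]
  simpa only [edist_eq_enorm_sub] using h4

/-- Maps with values in a proper metric space which are bounded in `L^p` and satisfy a uniform
estimate on their translates converge almost everywhere along a subsequence. -/
theorem exists_subseq_ae_tendsto {ι : Type*} {s : Finset ι}
    {U : ι → Set (EuclideanSpace ℝ (Fin d))} (hU : ∀ i ∈ s, HasInwardBalls D (U i))
    (hcov : D ⊆ ⋃ i ∈ s, U i) (hD : volume D ≠ ⊤) {N : Type*} [MetricSpace N] [ProperSpace N]
    [MeasurableSpace N] [BorelSpace N] {u : ℕ → EuclideanSpace ℝ (Fin d) → N}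
    (hu : ∀ k, Measurable (u k)) {q₀ : N} {p : ℝ} (hp : 0 < p) {C : ℝ≥0}
    (hC : ∀ k, ∫⁻ x in D, edist (u k x) q₀ ^ p ≤ C)
    (htr : ∀ i ∈ s, ∀ v, (∀ y ∈ U i, ∀ s ∈ Set.Icc (0 : ℝ) 1, y + s • v ∈ D) → ∀ k,
      ∫⁻ y in U i, edist (u k (y + v)) (u k y) ≤ ENNReal.ofReal ‖v‖ * C) :
    ∃ φ : ℕ → ℕ, StrictMono φ ∧ ∃ v : EuclideanSpace ℝ (Fin d) → N, Measurable v ∧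
      ∀ᵐ x ∂volume.restrict D, Tendsto (fun k => u (φ k) x) atTop (𝓝 (v x)) := by
  have : Nonempty N := ⟨q₀⟩
  have hfin : IsFiniteMeasure (volume.restrict D) := ⟨by simpa using hD.lt_top⟩
  let q := TopologicalSpace.denseSeq N
  have hlip : ∀ j, LipschitzWith 1 fun b => min (dist b (q j)) 1 := fun j =>
    (LipschitzWith.dist_left (q j)).min_const 1
  -- bounded functions that are sufficient to detect convergence in `N`
  let g : ℕ → ℕ → EuclideanSpace ℝ (Fin d) → ℝ := fun j k x => min (dist (u k x) (q j)) 1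
  have hg : ∀ j k, Measurable (g j k) := fun j k => (hlip j).continuous.measurable.comp (hu k)
  have hB : ∀ j k x, |g j k x| ≤ 1 := fun j k x => by
    rw [abs_of_nonneg (le_min dist_nonneg zero_le_one)]
    exact min_le_right _ _
  obtain ⟨φ, hφ, G, hG⟩ := exists_subseq_tendstoWeakly_of_bounded (μ := volume.restrict D)
    (fun j k => (hg j k).aestronglyMeasurable) (M := fun _ => 1) hB
  have hstrong : ∀ j, Tendsto (fun k => ∫⁻ y in D, ‖g j (φ k) y - G j y‖ₑ) atTop (𝓝 0) := fun j =>
    (hG j).2.tendsto_lintegral_enorm_sub hU hcov hD (hG j).1 (fun k => hg _ _) (fun k => hB _ _)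
      (C := C) fun i hi v hv k => by
        refine le_trans (lintegral_mono fun y => ?_) (htr i hi v hv (φ k))
        rw [← edist_eq_enorm_sub]
        simpa using hlip j (u (φ k) (y + v)) (u (φ k) y)
  obtain ⟨ψ, hψ, hae⟩ := exists_subseq_ae_tendsto_of_forall_tendsto_lintegral
    (g := fun j k => g j (φ k)) (fun j k => ((hg j (φ k)).aemeasurable.sub
      (hG j).1.1.aemeasurable).enorm) hstrong
  refine ⟨fun k => φ (ψ k), hφ.comp hψ, ?_⟩
  -- Fatou's lemma: almost every sequence of values has a bounded subsequence
  have hliminf : ∀ᵐ x ∂volume.restrict D,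
      liminf (fun k => edist (u (φ (ψ k)) x) q₀ ^ p) atTop < ⊤ := by
    have hm : ∀ k, Measurable fun x => edist (u (φ (ψ k)) x) q₀ ^ p := fun k =>
      ((hu _).edist measurable_const).pow_const p
    refine ae_lt_top (Measurable.liminf hm) ?_
    refine ne_top_of_le_ne_top (ENNReal.coe_ne_top (r := C)) ((lintegral_liminf_le hm).trans ?_)
    exact liminf_le_of_frequently_le' (Eventually.of_forall fun k => hC _).frequently
  refine measurable_limit_of_tendsto_metrizable_ae (fun k => (hu _).aemeasurable) ?_
  filter_upwards [hliminf, ae_all_iff.2 hae] with x hx1 hx2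
  obtain ⟨R, hR1, hR2⟩ := ENNReal.lt_iff_exists_nnreal_btwn.1 hx1
  have hR3 := frequently_lt_of_liminf_lt (by isBoundedDefault) hR1
  refine exists_tendsto_of_tendsto_min_dist (TopologicalSpace.denseRange_denseSeq N)
    (q₀ := q₀) (R := (R : ℝ) ^ p⁻¹) (hR3.mono fun k hk => ?_) fun j => ⟨_, hx2 j⟩
  have h1 : edist (u (φ (ψ k)) x) q₀ ≤ (R : ℝ≥0∞) ^ p⁻¹ := by
    rw [ENNReal.le_rpow_inv_iff hp]
    exact hk.le
  rw [← ENNReal.coe_rpow_of_nonneg _ (by positivity), edist_nndist, ENNReal.coe_le_coe] at h1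
  exact_mod_cast h1

end Compactness

section Compactness

/-- A form of Vitali's convergence theorem: the functions are dominated by an integrable function up
to a remainder which is uniformly small in `L¹`. -/
theorem tendsto_lintegral_zero_of_le_add {X : Type*} [MeasurableSpace X] {μ : Measure X}
    {f : ℕ → X → ℝ≥0∞} (hf : ∀ k, AEMeasurable (f k) μ)
    (hlim : ∀ᵐ x ∂μ, Tendsto (fun k => f k x) atTop (𝓝 0))
    (h : ∀ ε : ℝ≥0∞, 0 < ε → ∃ F : X → ℝ≥0∞, AEMeasurable F μ ∧ ∫⁻ x, F x ∂μ ≠ ⊤ ∧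
      ∀ k, ∃ b : X → ℝ≥0∞, AEMeasurable b μ ∧ (∀ᵐ x ∂μ, f k x ≤ F x + b x) ∧ ∫⁻ x, b x ∂μ ≤ ε) :
    Tendsto (fun k => ∫⁻ x, f k x ∂μ) atTop (𝓝 0) := by
  rw [ENNReal.tendsto_nhds_zero]
  intro ε hε
  have hε2 : 0 < ε / 2 := ENNReal.half_pos hε.ne'
  obtain ⟨F, hF, hFi, hb⟩ := h (ε / 2) hε2
  have h1 : Tendsto (fun k => ∫⁻ x, min (f k x) (F x) ∂μ) atTop (𝓝 0) := by
    have := tendsto_lintegral_of_dominated_convergence' (μ := μ)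
      (F := fun k x => min (f k x) (F x)) (f := fun _ => 0) F (fun k => (hf k).min hF)
      (fun k => ae_of_all _ fun x => min_le_right _ _) hFi
      (hlim.mono fun x hx => tendsto_of_tendsto_of_tendsto_of_le_of_le tendsto_const_nhds hx
        (fun _ => zero_le) fun _ => min_le_left _ _)
    simpa using this
  filter_upwards [ENNReal.tendsto_nhds_zero.1 h1 _ hε2] with k hk
  obtain ⟨b, hbm, hle, hbi⟩ := hb k
  calc ∫⁻ x, f k x ∂μ ≤ ∫⁻ x, (min (f k x) (F x) + b x) ∂μ := by
        refine lintegral_mono_ae (hle.mono fun x hx => ?_)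
        rcases le_total (f k x) (F x) with h | h
        · rw [min_eq_left h]; exact le_self_add
        · rwa [min_eq_right h]
    _ = (∫⁻ x, min (f k x) (F x) ∂μ) + ∫⁻ x, b x ∂μ := lintegral_add_right' _ hbm
    _ ≤ ε / 2 + ε / 2 := add_le_add hk hbi
    _ = ε := ENNReal.add_halves ε

theorem edist_rpow_le {N : Type*} [PseudoEMetricSpace N] {p : ℝ} (hp : 1 ≤ p) (a b c : N) :
    edist a b ^ p ≤ 2 ^ (p - 1) * (edist a c ^ p + edist b c ^ p) := by
  calc edist a b ^ p ≤ (edist a c + edist b c) ^ p := by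
        gcongr; exact edist_triangle_right a b c
    _ ≤ _ := ENNReal.rpow_add_le_mul_rpow_add_rpow _ _ hp

variable {d : ℕ} {D U : Set (EuclideanSpace ℝ (Fin d))} {N : Type*} [MetricSpace N]
  [SecondCountableTopology N] [MeasurableSpace N] [BorelSpace N]

/-- Uniform integrability: a bound in `L^p` and an estimate on the translates control the distance
to a point by a constant, up to a remainder which is uniformly small in `L^p`. The bound holds
because the values of `u` at `y` and at `y + h` can be compared for all `h` in a fixed ball. -/
theorem HasInwardBalls.exists_edist_rpow_le (hU : HasInwardBalls D U)
    {p : ℝ} (hp : 1 ≤ p) (C : ℝ≥0) (q₀ : N) {ε : ℝ≥0∞} (hε : 0 < ε) :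
    ∃ M : ℝ≥0∞, M ≠ ⊤ ∧ ∀ u : EuclideanSpace ℝ (Fin d) → N, Measurable u →
      ∫⁻ x in D, edist (u x) q₀ ^ p ≤ C →
      (∀ v, (∀ y ∈ U, ∀ s ∈ Set.Icc (0 : ℝ) 1, y + s • v ∈ D) →
        ∫⁻ y in U, edist (u (y + v)) (u y) ^ p ≤ ENNReal.ofReal ‖v‖ ^ p * C) →
      ∃ b : EuclideanSpace ℝ (Fin d) → ℝ≥0∞, Measurable b ∧
        (∀ y ∈ U, edist (u y) q₀ ^ p ≤ M + b y) ∧ ∫⁻ y in U, b y ≤ ε := by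
  have hp0 : 0 < p := by linarith
  set A : ℝ≥0∞ := 2 ^ (p - 1) with hA
  have hAt : A ≠ ⊤ := ENNReal.rpow_ne_top_of_nonneg (by linarith) ENNReal.ofNat_ne_top
  obtain ⟨δ, hδ, hδε⟩ : ∃ δ : ℝ, 0 < δ ∧ A * (ENNReal.ofReal δ ^ p * C) ≤ ε := by
    have h1 : Tendsto (fun δ : ℝ => A * (ENNReal.ofReal δ ^ p * C)) (𝓝[>] 0) (𝓝 (A * (0 * C))) := by
      refine ENNReal.Tendsto.const_mul (ENNReal.Tendsto.mul_const ?_ (Or.inr ENNReal.coe_ne_top))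
        (Or.inr hAt)
      have h2 : Tendsto (fun δ : ℝ => ENNReal.ofReal δ ^ p) (𝓝 0) (𝓝 (ENNReal.ofReal 0 ^ p)) :=
        ((ENNReal.continuous_rpow_const).comp ENNReal.continuous_ofReal).tendsto 0
      rw [ENNReal.ofReal_zero, ENNReal.zero_rpow_of_pos hp0] at h2
      exact h2.mono_left nhdsWithin_le_nhds
    rw [zero_mul, mul_zero] at h1
    obtain ⟨δ, h2, h3⟩ := ((ENNReal.tendsto_nhds_zero.1 h1 ε hε).and self_mem_nhdsWithin).exists
    exact ⟨δ, h3, h2⟩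
  obtain ⟨h₀, r, hr, hrδ, hball⟩ := hU.exists_ball δ hδ
  set H := Metric.ball h₀ r
  have hHv : volume H ≠ 0 := (Metric.measure_ball_pos _ _ hr).ne'
  have hHt : volume H ≠ ⊤ := measure_ball_lt_top.ne
  refine ⟨(volume H)⁻¹ * (A * C), ENNReal.mul_ne_top (ENNReal.inv_ne_top.2 hHv)
    (ENNReal.mul_ne_top hAt ENNReal.coe_ne_top), fun u hu hC htr => ?_⟩
  have hm1 : Measurable fun z : EuclideanSpace ℝ (Fin d) × EuclideanSpace ℝ (Fin d) =>
      edist (u (z.1 + z.2)) (u z.1) ^ p :=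
    ((hu.comp (by fun_prop)).edist (hu.comp measurable_fst)).pow_const p
  have hm2 : Measurable fun x => edist (u x) q₀ ^ p := (hu.edist measurable_const).pow_const p
  have hm3 : ∀ y, Measurable fun h => edist (u (y + h)) q₀ ^ p := fun y =>
    hm2.comp (measurable_const_add y)
  refine ⟨fun y => (volume H)⁻¹ * (A * ∫⁻ h in H, edist (u (y + h)) (u y) ^ p),
    (hm1.lintegral_prod_right'.const_mul _).const_mul _, fun y hy => ?_, ?_⟩
  · have h1 : ∫⁻ h in H, edist (u (y + h)) q₀ ^ p ≤ C := by
      calc ∫⁻ h in H, edist (u (y + h)) q₀ ^ p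
          ≤ ∫⁻ h in H, D.indicator (fun x => edist (u x) q₀ ^ p) (y + h) := by
            refine setLIntegral_mono' Metric.isOpen_ball.measurableSet fun h hh => ?_
            have : y + h ∈ D := by simpa using hball y hy h hh 1 (by simp)
            rw [Set.indicator_of_mem this]
        _ ≤ ∫⁻ h, D.indicator (fun x => edist (u x) q₀ ^ p) (y + h) := setLIntegral_le_lintegral _ _
        _ = ∫⁻ x, D.indicator (fun x => edist (u x) q₀ ^ p) x :=
            lintegral_add_left_eq_self (D.indicator fun x => edist (u x) q₀ ^ p) y
        _ ≤ ∫⁻ x in D, edist (u x) q₀ ^ p := lintegral_indicator_le _ _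
        _ ≤ C := hC
    rw [← mul_add, ← mul_add, ← ENNReal.div_eq_inv_mul, ENNReal.le_div_iff_mul_le (Or.inl hHv)
      (Or.inl hHt), ← setLIntegral_const]
    calc ∫⁻ h in H, edist (u y) q₀ ^ p
        ≤ ∫⁻ h in H, A * (edist (u (y + h)) q₀ ^ p + edist (u (y + h)) (u y) ^ p) := by
          refine lintegral_mono fun h => ?_
          refine (edist_rpow_le hp _ _ (u (y + h))).trans_eq ?_
          rw [edist_comm (u y), edist_comm q₀, add_comm]
      _ = A * ((∫⁻ h in H, edist (u (y + h)) q₀ ^ p) +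
            ∫⁻ h in H, edist (u (y + h)) (u y) ^ p) := by
          rw [lintegral_const_mul' _ _ hAt, lintegral_add_left (hm3 y)]
      _ ≤ _ := by gcongr
  · rw [lintegral_const_mul' _ _ (ENNReal.inv_ne_top.2 hHv), lintegral_const_mul' _ _ hAt]
    have h1 : ∫⁻ y in U, ∫⁻ h in H, edist (u (y + h)) (u y) ^ p ≤
        ENNReal.ofReal δ ^ p * C * volume H := by
      refine lintegral_lintegral_ball_le (F := fun y h => edist (u (y + h)) (u y) ^ p) hm1
        fun h hh => (htr h fun y hy s hs => hball y hy h hh s hs).trans ?_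
      have := hrδ hh
      rw [mem_ball_zero_iff] at this
      gcongr
    calc _ ≤ (volume H)⁻¹ * (A * (ENNReal.ofReal δ ^ p * C * volume H)) := by gcongr
      _ = ((volume H)⁻¹ * volume H) * (A * (ENNReal.ofReal δ ^ p * C)) := by ring
      _ ≤ ε := by rwa [ENNReal.inv_mul_cancel hHv hHt, one_mul]

/-- Under a bound in `L^p` and a uniform estimate on the translates, almost everywhere convergence
implies convergence in `L^p`. -/
theorem tendsto_lintegral_edist_rpow {ι : Type*} {s : Finset ι}
    {U : ι → Set (EuclideanSpace ℝ (Fin d))} (hU : ∀ i ∈ s, HasInwardBalls D (U i))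
    (hcov : D ⊆ ⋃ i ∈ s, U i) (hD : volume D ≠ ⊤) {p : ℝ} (hp : 1 ≤ p) {C : ℝ≥0} {q₀ : N}
    {u : ℕ → EuclideanSpace ℝ (Fin d) → N} (hu : ∀ k, Measurable (u k))
    {v : EuclideanSpace ℝ (Fin d) → N} (hv : Measurable v)
    (hlim : ∀ᵐ x ∂volume.restrict D, Tendsto (fun k => u k x) atTop (𝓝 (v x)))
    (hC : ∀ k, ∫⁻ x in D, edist (u k x) q₀ ^ p ≤ C)
    (htr : ∀ i ∈ s, ∀ v, (∀ y ∈ U i, ∀ s ∈ Set.Icc (0 : ℝ) 1, y + s • v ∈ D) → ∀ k,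
      ∫⁻ y in U i, edist (u k (y + v)) (u k y) ^ p ≤ ENNReal.ofReal ‖v‖ ^ p * C) :
    Tendsto (fun k => ∫⁻ x in D, edist (u k x) (v x) ^ p) atTop (𝓝 0) := by
  have hp0 : 0 < p := by linarith
  set A : ℝ≥0∞ := 2 ^ (p - 1) with hA
  have hAt : A ≠ ⊤ := ENNReal.rpow_ne_top_of_nonneg (by linarith) ENNReal.ofNat_ne_top
  have hA0 : A ≠ 0 := (ENNReal.rpow_pos (by norm_num) ENNReal.ofNat_ne_top).ne'
  have hm : ∀ k, Measurable fun x => edist (u k x) (v x) ^ p := fun k =>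
    ((hu k).edist hv).pow_const p
  have hmv : Measurable fun x => edist (v x) q₀ ^ p := (hv.edist measurable_const).pow_const p
  have hvC : ∫⁻ x in D, edist (v x) q₀ ^ p ≤ C := by
    refine lintegral_le_of_ae_tendsto (f := fun k x => edist (u k x) q₀ ^ p)
      (fun k => (((hu k).edist measurable_const).pow_const p).aemeasurable) hC
      (hlim.mono fun x hx => ?_)
    exact (ENNReal.continuous_rpow_const.tendsto _).comp (hx.edist tendsto_const_nhds)
  have key : ∀ i ∈ s, Tendsto (fun k => ∫⁻ x in U i, edist (u k x) (v x) ^ p) atTop (𝓝 0) := by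
    intro i hi
    have hUfin : volume (U i) ≠ ⊤ := ((measure_mono (hU i hi).subset).trans_lt hD.lt_top).ne
    refine tendsto_lintegral_zero_of_le_add (fun k => (hm k).aemeasurable) ?_ fun ε hε => ?_
    · filter_upwards [ae_restrict_of_ae_restrict_of_subset (hU i hi).subset hlim] with x hx
      have h1 := (ENNReal.continuous_rpow_const (y := p)).tendsto 0 |>.comp
        (tendsto_iff_edist_tendsto_0.1 hx)
      rw [ENNReal.zero_rpow_of_pos hp0] at h1
      exact h1
    · obtain ⟨M, hM, h⟩ := (hU i hi).exists_edist_rpow_le hp C q₀ (ENNReal.div_pos hε.ne' hAt)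
      refine ⟨fun x => A * (M + edist (v x) q₀ ^ p),
        ((hmv.const_add M).const_mul A).aemeasurable, ?_, fun k => ?_⟩
      · rw [lintegral_const_mul' _ _ hAt, lintegral_add_left measurable_const, setLIntegral_const]
        refine ENNReal.mul_ne_top hAt (ENNReal.add_ne_top.2 ⟨ENNReal.mul_ne_top hM hUfin, ?_⟩)
        exact ne_top_of_le_ne_top ENNReal.coe_ne_top
          ((lintegral_mono_set (hU i hi).subset).trans hvC)
      · obtain ⟨b, hb, hle, hbε⟩ := h (u k) (hu k) (hC k) fun v hv => htr i hi v hv k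
        refine ⟨fun x => A * b x, (hb.const_mul A).aemeasurable, ?_, ?_⟩
        · filter_upwards [ae_restrict_mem (hU i hi).isOpen.measurableSet] with x hx
          refine (edist_rpow_le hp (u k x) (v x) q₀).trans ?_
          calc A * (edist (u k x) q₀ ^ p + edist (v x) q₀ ^ p)
              ≤ A * (M + b x + edist (v x) q₀ ^ p) := by gcongr; exact hle x hx
            _ = _ := by ring
        · rw [lintegral_const_mul' _ _ hAt]
          calc A * ∫⁻ x in U i, b x ≤ A * (ε / A) := by gcongr
            _ = ε := ENNReal.mul_div_cancel hA0 hAt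
  have h1 : Tendsto (fun k => ∑ i ∈ s, ∫⁻ x in U i, edist (u k x) (v x) ^ p) atTop
      (𝓝 (∑ i ∈ s, 0)) := tendsto_finsetSum _ key
  rw [Finset.sum_const_zero] at h1
  exact tendsto_of_tendsto_of_tendsto_of_le_of_le tendsto_const_nhds h1 (fun _ => zero_le)
    fun k => setLIntegral_le_sum_of_subset_biUnion hcov _

end Compactness

/-! ### Closedness of the colocal weak derivative -/

section LimitDerivative

section WeakLimits

variable {X : Type*} [MeasurableSpace X] {μ : Measure X}

theorem BoundedInLp.of_abs_le {p C : ℝ} (hp : 0 ≤ p) {g h : ℕ → X → ℝ} (hh : BoundedInLp μ p C h)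
    (hg : ∀ k, AEStronglyMeasurable (g k) μ) {K : ℝ} (hK : 0 ≤ K)
    (hgh : ∀ k x, |g k x| ≤ K * |h k x|) : BoundedInLp μ p (K ^ p * C) g := by
  have h1 : ∀ k x, |g k x| ^ p ≤ K ^ p * |h k x| ^ p := fun k x => by
    rw [← Real.mul_rpow hK (abs_nonneg _)]
    exact Real.rpow_le_rpow (abs_nonneg _) (hgh k x) hp
  have h2 : ∀ k, Integrable (fun x => |g k x| ^ p) μ := fun k =>
    ((hh.integrable_rpow k).const_mul (K ^ p)).mono'
      ((hg k).aemeasurable.abs.pow_const p).aestronglyMeasurable (ae_of_all _ fun x => by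
        rw [Real.norm_of_nonneg (by positivity)]; exact h1 k x)
  refine ⟨hg, h2, fun k => ?_⟩
  calc ∫ x, |g k x| ^ p ∂μ ≤ ∫ x, K ^ p * |h k x| ^ p ∂μ :=
        integral_mono (h2 k) ((hh.integrable_rpow k).const_mul _) (h1 k)
    _ = K ^ p * ∫ x, |h k x| ^ p ∂μ := integral_const_mul _ _
    _ ≤ _ := by gcongr; exact hh.integral_rpow_le k

theorem TendstoWeakly.sum {ι : Type*} (s : Finset ι) {g : ι → ℕ → X → ℝ} {G : ι → X → ℝ}
    (hg : ∀ i ∈ s, TendstoWeakly μ (g i) (G i)) (hgi : ∀ i ∈ s, ∀ k, Integrable (g i k) μ)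
    (hG : ∀ i ∈ s, Integrable (G i) μ) :
    TendstoWeakly μ (fun k x => ∑ i ∈ s, g i k x) (fun x => ∑ i ∈ s, G i x) := by
  intro ψ hψ B hB
  have h1 := tendsto_finsetSum s fun i hi => hg i hi ψ hψ B hB
  simp only [Finset.mul_sum]
  rw [integral_finsetSum s fun i hi => (hG i hi).test_mul hψ hB]
  refine h1.congr fun k => ?_
  rw [integral_finsetSum s fun i hi => (hgi i hi k).test_mul hψ hB]

theorem TendstoWeakly.ae_eq {g : ℕ → X → ℝ} {G G' : X → ℝ} (hg : TendstoWeakly μ g G)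
    (hg' : TendstoWeakly μ g G') (hgi : ∀ k, Integrable (g k) μ) (hG : Integrable G μ)
    (hG' : Integrable G' μ) : G =ᵐ[μ] G' :=
  (hg.ae_le hg' hgi hgi hG hG' fun _ => EventuallyLE.rfl).antisymm
    (hg'.ae_le hg hgi hgi hG' hG fun _ => EventuallyLE.rfl)

variable {N : Type*} [IsFiniteMeasure μ] [TopologicalSpace N] [MeasurableSpace N] [BorelSpace N]

/-- The weight `b (u k)` converges to `b v` at those points where `v` takes its values in the open
set `V`, so that products with these weights converge weakly after a restriction to `{v ∈ V}`. -/
theorem TendstoWeakly.mul_comp {p C : ℝ} (hp : 1 < p) {g : ℕ → X → ℝ} {G : X → ℝ}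
    (hw : TendstoWeakly μ g G) (hg : BoundedInLp μ p C g)
    {u : ℕ → X → N} {v : X → N} (hu : ∀ k, AEMeasurable (u k) μ) (hv : Measurable v)
    (hlim : ∀ᵐ x ∂μ, Tendsto (fun k => u k x) atTop (𝓝 (v x))) {V : Set N} (hV : IsOpen V)
    {b : N → ℝ} (hb : ContinuousOn b V) (hb1 : ∀ q, |b q| ≤ 1) :
    TendstoWeakly μ (fun k x => (v ⁻¹' V).indicator (fun x => V.indicator b (u k x)) x * g k x)
      (fun x => (v ⁻¹' V).indicator (fun x => b (v x)) x * G x) := by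
  have hbm := hb.measurable_indicator hV
  have hvV := hv hV.measurableSet
  have hb2 : ∀ q, |V.indicator b q| ≤ 1 := fun q => by
    by_cases hq : q ∈ V <;> simp [hq, hb1 q]
  have e : (v ⁻¹' V).indicator (fun x => b (v x)) = fun x => V.indicator b (v x) := by
    ext x
    by_cases hx : v x ∈ V <;> simp [Set.indicator, hx]
  rw [e]
  refine hw.mul hp hg (B := 1) (fun k => ?_) (hbm.comp hv).aestronglyMeasurable (fun k x => ?_)
    (fun x => hb2 _) (hlim.mono fun x hx => ?_)
  · exact ((hbm.comp_aemeasurable (hu k)).indicator hvV).aestronglyMeasurable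
  · by_cases hx : x ∈ v ⁻¹' V
    · rw [Set.indicator_of_mem hx]; exact hb2 _
    · rw [Set.indicator_of_notMem hx]; simp
  · by_cases hxV : v x ∈ V
    · have h1 : ContinuousAt (V.indicator b) (v x) := by
        refine (hb.continuousAt (hV.mem_nhds hxV)).congr ?_
        filter_upwards [hV.mem_nhds hxV] with q hq
        rw [Set.indicator_of_mem hq]
      have h2 := h1.tendsto.comp hx
      refine h2.congr fun k => ?_
      rw [Set.indicator_of_mem (by exact hxV)]
      rfl
    · have : ∀ f : X → ℝ, (v ⁻¹' V).indicator f x = 0 := fun f =>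
        Set.indicator_of_notMem (show x ∉ v ⁻¹' V from hxV) f
      simp only [this, Set.indicator_of_notMem hxV]
      exact tendsto_const_nhds

end WeakLimits

variable {d n : ℕ} {D : Set (EuclideanSpace ℝ (Fin d))}

theorem EuclideanSpace.clm_apply_eq_sum (T : EuclideanSpace ℝ (Fin d) →L[ℝ] ℝ)
    (v : EuclideanSpace ℝ (Fin d)) :
    T v = ∑ m, v m * T (EuclideanSpace.basisFun (Fin d) ℝ m) := by
  conv_lhs => rw [← (EuclideanSpace.basisFun (Fin d) ℝ).sum_repr v]
  simp

theorem MeasureTheory.integrable_of_forall_ae_eq {X : Type*} [MeasurableSpace X] {μ : Measure X}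
    {g : X → EuclideanSpace ℝ (Fin d) →L[ℝ] ℝ} {G : Fin d → X → ℝ} (hG : ∀ m, Integrable (G m) μ)
    (hg : ∀ m, ∀ᵐ x ∂μ, g x (EuclideanSpace.basisFun (Fin d) ℝ m) = G m x) : Integrable g μ := by
  have hcont : Continuous fun c : Fin d → ℝ => ∑ m, c m • (EuclideanSpace.proj (𝕜 := ℝ) m :
      EuclideanSpace ℝ (Fin d) →L[ℝ] ℝ) := by fun_prop
  have hmeas : AEStronglyMeasurable g μ := by
    refine (hcont.comp_aestronglyMeasurable
      (aemeasurable_pi_lambda (fun x m => G m x)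
      fun m => (hG m).1.aemeasurable).aestronglyMeasurable).congr ?_
    filter_upwards [ae_all_iff.2 hg] with x hx
    ext v
    rw [EuclideanSpace.clm_apply_eq_sum (g x)]
    simp only [hx]
    simp [mul_comm]
  refine Integrable.mono' (integrable_finsetSum Finset.univ fun m _ => (hG m).abs) hmeas ?_
  filter_upwards [ae_all_iff.2 hg] with x hx
  refine ContinuousLinearMap.opNorm_le_bound _ (Finset.sum_nonneg fun m _ => abs_nonneg _) fun v => ?_
  rw [EuclideanSpace.clm_apply_eq_sum (g x), Finset.sum_mul]
  refine (norm_sum_le _ _).trans (Finset.sum_le_sum fun m _ => ?_)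
  rw [hx, norm_mul, mul_comm]
  exact mul_le_mul_of_nonneg_left (PiLp.norm_apply_le v m) (norm_nonneg _)

/-- Weak derivatives pass to the limit when the functions converge boundedly almost everywhere and the
components of their derivatives converge weakly. -/
theorem HasWeakDerivOn.of_tendsto (hDfin : volume D ≠ ⊤)
    {w : ℕ → EuclideanSpace ℝ (Fin d) → ℝ}
    {g : ℕ → EuclideanSpace ℝ (Fin d) → EuclideanSpace ℝ (Fin d) →L[ℝ] ℝ}
    (hw : ∀ k, HasWeakDerivOn D (w k) (g k)) {M : ℝ} (hM : ∀ k x, |w k x| ≤ M)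
    {w₀ : EuclideanSpace ℝ (Fin d) → ℝ}
    (hlim : ∀ᵐ x ∂volume.restrict D, Tendsto (fun k => w k x) atTop (𝓝 (w₀ x)))
    {g₀ : EuclideanSpace ℝ (Fin d) → EuclideanSpace ℝ (Fin d) →L[ℝ] ℝ}
    (hgi : ∀ k v, IntegrableOn (fun x => g k x v) D)
    {G : Fin d → EuclideanSpace ℝ (Fin d) → ℝ} (hG : ∀ m, IntegrableOn (G m) D)
    (hgG : ∀ m, TendstoWeakly (volume.restrict D)
      (fun k x => g k x (EuclideanSpace.basisFun (Fin d) ℝ m)) (G m))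
    (hg₀ : ∀ m, ∀ᵐ x ∂volume.restrict D, g₀ x (EuclideanSpace.basisFun (Fin d) ℝ m) = G m x) :
    HasWeakDerivOn D w₀ g₀ := by
  have hfin : IsFiniteMeasure (volume.restrict D) := ⟨by simpa using hDfin.lt_top⟩
  have hwm : ∀ k, AEStronglyMeasurable (w k) (volume.restrict D) := fun k =>
    (hw k).1.aestronglyMeasurable
  have hw₀m : AEStronglyMeasurable w₀ (volume.restrict D) :=
    aestronglyMeasurable_of_tendsto_ae _ hwm hlim
  have hw₀M : ∀ᵐ x ∂volume.restrict D, ‖w₀ x‖ ≤ M := hlim.mono fun x hx =>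
    le_of_tendsto' hx.norm fun k => hM k x
  have hw₀ : IntegrableOn w₀ D := (integrable_const M).mono' hw₀m hw₀M
  have hg₀i : IntegrableOn g₀ D := integrable_of_forall_ae_eq hG hg₀
  refine ⟨hw₀.locallyIntegrableOn, hg₀i.locallyIntegrableOn, fun φ hφ hφc hφD v => ?_⟩
  have hφ' : Continuous fun x => fderiv ℝ φ x v :=
    (hφ.continuous_fderiv (by simp)).clm_apply continuous_const
  obtain ⟨B, hB⟩ := (hφ'.bounded_above_of_compact_support (hφc.fderiv_apply (𝕜 := ℝ) v))
  obtain ⟨B', hB'⟩ := hφ.continuous.bounded_above_of_compact_support hφc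
  have h1 : Tendsto (fun k => ∫ x in D, w k x * fderiv ℝ φ x v) atTop
      (𝓝 (∫ x in D, w₀ x * fderiv ℝ φ x v)) := by
    refine tendsto_integral_of_dominated_convergence (fun _ => M * B)
      (fun k => (hwm k).mul hφ'.aestronglyMeasurable) (integrable_const _)
      (fun k => ae_of_all _ fun x => ?_) (hlim.mono fun x hx => hx.mul_const _)
    rw [norm_mul]
    exact mul_le_mul (hM k x) (hB x) (norm_nonneg _) ((abs_nonneg _).trans (hM k x))
  have h2 : Tendsto (fun k => ∫ x in D, φ x * g k x v) atTop
      (𝓝 (∑ m, v m * ∫ x in D, φ x * G m x)) := by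
    have h3 : Tendsto (fun k => ∑ m, v m * ∫ x in D,
        φ x * g k x (EuclideanSpace.basisFun (Fin d) ℝ m)) atTop
        (𝓝 (∑ m, v m * ∫ x in D, φ x * G m x)) := tendsto_finsetSum _ fun m _ =>
      (hgG m φ hφ.continuous.aestronglyMeasurable B' hB').const_mul _
    refine h3.congr fun k => ?_
    simp only [← integral_const_mul]
    rw [← integral_finsetSum _ fun m _ => (Integrable.test_mul (hgi k _)
      hφ.continuous.aestronglyMeasurable hB').const_mul _]
    refine integral_congr_ae (ae_of_all _ fun x => ?_)
    beta_reduce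
    rw [EuclideanSpace.clm_apply_eq_sum (g k x) v, Finset.mul_sum]
    exact Finset.sum_congr rfl fun m _ => by ring
  have h3 : ∫ x in D, g₀ x v * φ x = ∑ m, v m * ∫ x in D, φ x * G m x := by
    simp only [← integral_const_mul]
    rw [← integral_finsetSum _ fun m _ => (Integrable.test_mul (hG m)
      hφ.continuous.aestronglyMeasurable hB').const_mul _]
    refine integral_congr_ae ?_
    filter_upwards [ae_all_iff.2 hg₀] with x hx
    rw [EuclideanSpace.clm_apply_eq_sum (g₀ x) v, Finset.sum_mul]
    exact Finset.sum_congr rfl fun m _ => by rw [hx]; ring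
  rw [h3]
  refine tendsto_nhds_unique h1 (h2.neg.congr fun k => ?_)
  rw [(hw k).2.2 φ hφ hφc hφD v]
  simp only [mul_comm]

end LimitDerivative

section LimitDerivative

variable {n : ℕ} {N : Type*} [MetricSpace N] [ChartedSpace (EuclideanSpace ℝ (Fin n)) N]
    [RiemannianBundle (fun q : N => TangentSpace (𝓡 n) q)] [MeasurableSpace N] [BorelSpace N]

section Fields

variable {X : Type*} [MeasurableSpace X] {μ : Measure X} [IsFiniteMeasure μ]
  {V : Set N} {f : Fin n → N → ℝ} {u : ℕ → X → N} {v : X → N}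
  {ξ : ∀ k x, TangentSpace (𝓡 n) (u k x)} {p : ℝ}

/-- Weak limits of the derivatives in the directions `ξ k` respect the expression of the
differential of `F` in the coordinates `f`. -/
theorem IsCoordinateSystem.ae_dirDeriv_eq (hf : IsCoordinateSystem V f) (hp : 1 < p)
    (hu : ∀ k, AEMeasurable (u k) μ) (hv : Measurable v)
    (hlim : ∀ᵐ x ∂μ, Tendsto (fun k => u k x) atTop (𝓝 (v x)))
    {C : Fin n → ℝ} (hfb : ∀ a, BoundedInLp μ p (C a) fun k x => dirDeriv (f a) (u k x) (ξ k x))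
    {A : Fin n → X → ℝ} (hA : ∀ a, Integrable (A a) μ)
    (hfA : ∀ a, TendstoWeakly μ (fun k x => dirDeriv (f a) (u k x) (ξ k x)) (A a))
    {F : N → ℝ} (hF : ContMDiff (𝓡 n) 𝓘(ℝ, ℝ) 1 F) {C' : ℝ}
    (hFb : BoundedInLp μ p C' fun k x => dirDeriv F (u k x) (ξ k x))
    {B : X → ℝ} (hB : Integrable B μ)
    (hFB : TendstoWeakly μ (fun k x => dirDeriv F (u k x) (ξ k x)) B) :
    ∀ᵐ x ∂μ, v x ∈ V → ∀ η : TangentSpace (𝓡 n) (v x),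
      (∀ a, dirDeriv (f a) (v x) η = A a x) → dirDeriv F (v x) η = B x := by
  obtain ⟨β, hβ, hβF⟩ := hf.dirDeriv_eq_sum F hF
  have hVm := hv hf.isOpen.measurableSet
  -- the coefficients, made bounded by a common factor
  let κ : N → ℝ := fun q => 1 + ∑ a, |β a q|
  have hκ : ∀ q, 0 < κ q := fun q => by positivity
  have hκc : ContinuousOn κ V :=
    continuousOn_const.add (continuousOn_finsetSum _ fun a _ => (hβ a).abs)
  have hb₀ : ContinuousOn (fun q => 1 / κ q) V := continuousOn_const.div hκc fun q _ => (hκ q).ne'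
  have hb : ∀ a, ContinuousOn (fun q => β a q / κ q) V := fun a =>
    (hβ a).div hκc fun q _ => (hκ q).ne'
  have hb₀1 : ∀ q, |1 / κ q| ≤ 1 := fun q => by
    rw [abs_of_pos (by have := hκ q; positivity), div_le_one (hκ q)]
    have : 0 ≤ ∑ a, |β a q| := by positivity
    simp only [κ]; linarith
  have hb1 : ∀ a q, |β a q / κ q| ≤ 1 := fun a q => by
    rw [abs_div, abs_of_pos (hκ q), div_le_one (hκ q)]
    have := Finset.single_le_sum (fun a _ => abs_nonneg (β a q)) (Finset.mem_univ a)
    simp only [κ]; linarith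
  have h1 := hFB.mul_comp hp hFb hu hv hlim hf.isOpen hb₀ hb₀1
  have h2 := fun a => (hfA a).mul_comp hp (hfb a) hu hv hlim hf.isOpen (hb a) (hb1 a)
  have hbm : ∀ {b : N → ℝ}, ContinuousOn b V → (∀ q, |b q| ≤ 1) → ∀ {g : X → ℝ}, Integrable g μ →
      ∀ k, Integrable (fun x => (v ⁻¹' V).indicator (fun x => V.indicator b (u k x)) x * g x) μ := by
    intro b hb hb1 g hg k
    refine hg.test_mul (B := 1) (((hb.measurable_indicator hf.isOpen).comp_aemeasurable
      (hu k)).indicator hVm).aestronglyMeasurable fun x => ?_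
    refine (norm_indicator_le_norm_self (fun x => V.indicator b (u k x)) x).trans ?_
    exact (norm_indicator_le_norm_self b _).trans (hb1 _)
  have hbm' : ∀ {b : N → ℝ}, ContinuousOn b V → (∀ q, |b q| ≤ 1) → ∀ {g : X → ℝ}, Integrable g μ →
      Integrable (fun x => (v ⁻¹' V).indicator (fun x => b (v x)) x * g x) μ := by
    intro b hb hb1 g hg
    have e : (v ⁻¹' V).indicator (fun x => b (v x)) = fun x => V.indicator b (v x) := by
      ext x
      by_cases hx : v x ∈ V <;> simp [Set.indicator, hx]
    rw [e]
    exact hg.test_mul (B := 1) ((hb.measurable_indicator hf.isOpen).comp hv).aestronglyMeasurable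
      fun x => (norm_indicator_le_norm_self b _).trans (hb1 _)
  have h3 := TendstoWeakly.sum Finset.univ (fun a _ => h2 a)
    (fun a _ k => hbm (hb a) (hb1 a) ((hfb a).integrable hp k) k)
    (fun a _ => hbm' (hb a) (hb1 a) (hA a))
  have e : (fun k x => (v ⁻¹' V).indicator (fun x => V.indicator (fun q => 1 / κ q) (u k x)) x *
      dirDeriv F (u k x) (ξ k x)) = fun k x => ∑ a, (v ⁻¹' V).indicator
        (fun x => V.indicator (fun q => β a q / κ q) (u k x)) x * dirDeriv (f a) (u k x) (ξ k x) := by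
    ext k x
    by_cases hx : x ∈ v ⁻¹' V
    · simp only [Set.indicator_of_mem hx]
      by_cases hq : u k x ∈ V
      · simp only [Set.indicator_of_mem hq]
        rw [hβF _ hq, Finset.mul_sum]
        exact Finset.sum_congr rfl fun a _ => by ring
      · simp [Set.indicator_of_notMem hq]
    · simp [Set.indicator_of_notMem hx]
  have h4 := h1
  rw [e] at h4
  have h5 := h4.ae_eq h3 (fun k => integrable_finsetSum _ fun a _ =>
    hbm (hb a) (hb1 a) ((hfb a).integrable hp k) k) (hbm' hb₀ hb₀1 hB)
    (integrable_finsetSum _ fun a _ => hbm' (hb a) (hb1 a) (hA a))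
  filter_upwards [h5] with x hx hxV η hη
  have hxV' : x ∈ v ⁻¹' V := hxV
  simp only [Set.indicator_of_mem hxV'] at hx
  rw [hβF _ hxV]
  simp only [hη]
  have h6 := (hκ (v x)).ne'
  calc ∑ a, β a (v x) * A a x = κ (v x) * ∑ a, β a (v x) / κ (v x) * A a x := by
        rw [Finset.mul_sum]
        exact Finset.sum_congr rfl fun a _ => by field_simp
    _ = B x := by rw [← hx]; field_simp

/-- Weak limits inherit the estimate of the coordinates of a vector by its norm. -/
theorem IsCoordinateSystem.ae_abs_le (hf : IsCoordinateSystem V f) (hp : 1 < p)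
    (hu : ∀ k, AEMeasurable (u k) μ) (hv : Measurable v)
    (hlim : ∀ᵐ x ∂μ, Tendsto (fun k => u k x) atTop (𝓝 (v x))) (a : Fin n)
    {C : ℝ} (hfb : BoundedInLp μ p C fun k x => dirDeriv (f a) (u k x) (ξ k x))
    {A : X → ℝ} (hA : Integrable A μ)
    (hfA : TendstoWeakly μ (fun k x => dirDeriv (f a) (u k x) (ξ k x)) A)
    {γ : ℕ → X → ℝ} {C' : ℝ} (hγ : BoundedInLp μ p C' γ) (hξγ : ∀ k x, ‖ξ k x‖ ≤ γ k x)
    {Γ : X → ℝ} (hΓ : Integrable Γ μ) (hγΓ : TendstoWeakly μ γ Γ) :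
    ∀ᵐ x ∂μ, v x ∈ V → |A x| ≤ 2 * Γ x := by
  have hVm := hv hf.isOpen.measurableSet
  have hone : ∀ q : N, |(1 : ℝ)| ≤ 1 := fun _ => abs_one.le
  have hdom : ∀ t : ℝ, |t| = 1 → ∀ᵐ x ∂μ, v x ∈ V → t * A x ≤ 2 * Γ x := by
    intro t ht
    have hfb' : BoundedInLp μ p (1 ^ p * C) fun k x => t * dirDeriv (f a) (u k x) (ξ k x) :=
      hfb.of_abs_le (by linarith) (fun k => (hfb.aestronglyMeasurable k).const_mul t) zero_le_one
        fun k x => by rw [abs_mul, ht]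
    have hγ' : BoundedInLp μ p (2 ^ p * C') fun k x => 2 * γ k x :=
      hγ.of_abs_le (by linarith) (fun k => (hγ.aestronglyMeasurable k).const_mul 2) zero_le_two
        fun k x => by rw [abs_mul, abs_two]
    have hconst : ∀ (t : ℝ) {g : ℕ → X → ℝ} {G : X → ℝ}, TendstoWeakly μ g G →
        TendstoWeakly μ (fun k x => t * g k x) (fun x => t * G x) := by
      intro t g G h ψ hψ B hB
      have := (h ψ hψ B hB).const_mul t
      simp only [← integral_const_mul] at this
      simpa only [mul_left_comm] using this
    have h1 := (hconst t hfA).mul_comp hp hfb' hu hv hlim hf.isOpen continuousOn_const hone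
    have h2 := (hconst 2 hγΓ).mul_comp hp hγ' hu hv hlim hf.isOpen continuousOn_const hone
    have hw : ∀ k, AEStronglyMeasurable
        ((v ⁻¹' V).indicator fun x => V.indicator (fun _ : N => (1 : ℝ)) (u k x)) μ := fun k =>
      ((((continuousOn_const (c := (1 : ℝ))).measurable_indicator hf.isOpen).comp_aemeasurable
        (hu k)).indicator hVm).aestronglyMeasurable
    have hw1 : ∀ k x,
        |(v ⁻¹' V).indicator (fun x => V.indicator (fun _ : N => (1 : ℝ)) (u k x)) x| ≤ 1 :=
      fun k x => (norm_indicator_le_norm_self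
        (fun x => V.indicator (fun _ => (1 : ℝ)) (u k x)) x).trans
        ((norm_indicator_le_norm_self (fun _ => (1 : ℝ)) _).trans abs_one.le)
    have hw' : AEStronglyMeasurable ((v ⁻¹' V).indicator fun _ => (1 : ℝ)) μ :=
      (measurable_const.indicator hVm).aestronglyMeasurable
    have hw1' : ∀ x, |(v ⁻¹' V).indicator (fun _ => (1 : ℝ)) x| ≤ 1 := fun x =>
      (norm_indicator_le_norm_self (fun _ => (1 : ℝ)) x).trans abs_one.le
    have h3 := h1.ae_le h2 (fun k => (hfb'.integrable hp k).test_mul (hw k) (hw1 k))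
      (fun k => (hγ'.integrable hp k).test_mul (hw k) (hw1 k))
      ((hA.const_mul t).test_mul hw' hw1') ((hΓ.const_mul 2).test_mul hw' hw1')
      fun k => ae_of_all _ fun x => ?_
    · filter_upwards [h3] with x hx hxV
      have hxV' : x ∈ v ⁻¹' V := hxV
      simpa only [Set.indicator_of_mem hxV', one_mul] using hx
    · beta_reduce
      by_cases hx : x ∈ v ⁻¹' V
      · simp only [Set.indicator_of_mem hx]
        by_cases hq : u k x ∈ V
        · simp only [Set.indicator_of_mem hq, one_mul]
          calc t * dirDeriv (f a) (u k x) (ξ k x) ≤ |t * dirDeriv (f a) (u k x) (ξ k x)| :=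
                le_abs_self _
            _ = |dirDeriv (f a) (u k x) (ξ k x)| := by rw [abs_mul, ht, one_mul]
            _ ≤ 2 * ‖ξ k x‖ := hf.abs_dirDeriv_le _ hq a _
            _ ≤ 2 * γ k x := by have := hξγ k x; linarith
        · simp [Set.indicator_of_notMem hq]
      · simp [Set.indicator_of_notMem hx]
  filter_upwards [hdom 1 abs_one, hdom (-1) (by simp)] with x h1 h2 hx
  have h3 := h1 hx
  have h4 := h2 hx
  exact abs_le.2 ⟨by linarith, by linarith⟩

end Fields

end LimitDerivative

section LimitDerivative

variable {d n : ℕ} {N : Type*} [MetricSpace N] [ChartedSpace (EuclideanSpace ℝ (Fin n)) N]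
    [RiemannianBundle (fun q : N => TangentSpace (𝓡 n) q)]

theorem norm_apply_basisFun_le (q : N) (T : EuclideanSpace ℝ (Fin d) →L[ℝ] TangentSpace (𝓡 n) q)
    (m : Fin d) : ‖T (EuclideanSpace.basisFun (Fin d) ℝ m)‖ ≤ frobeniusNormAt q T := by
  simpa using norm_apply_le_frobeniusNormAt q T (EuclideanSpace.basisFun (Fin d) ℝ m)

theorem frobeniusNormAt_le_sum (q : N)
    (T : EuclideanSpace ℝ (Fin d) →L[ℝ] TangentSpace (𝓡 n) q) :
    frobeniusNormAt q T ≤ ∑ m, ‖T (EuclideanSpace.basisFun (Fin d) ℝ m)‖ := by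
  refine Real.sqrt_le_iff.2 ⟨Finset.sum_nonneg fun _ _ => norm_nonneg _, ?_⟩
  exact Finset.sum_sq_le_sq_sum_of_nonneg fun _ _ => norm_nonneg _

/-- A family of linear maps along `v` with prescribed coordinates, where any coordinate system
around `v x` may be chosen. -/
theorem exists_clm_dirDeriv_eq {V : ℕ → Set N} {f : ℕ → Fin n → N → ℝ}
    (hV : ∀ i, IsCoordinateSystem (V i) (f i)) (hcov : ∀ q, ∃ i, q ∈ V i) {X : Type*} (v : X → N)
    (A : ℕ → Fin n → Fin d → X → ℝ) :
    ∃ dv : ∀ x, EuclideanSpace ℝ (Fin d) →L[ℝ] TangentSpace (𝓡 n) (v x), ∀ x, ∃ i, v x ∈ V i ∧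
      ∀ a m, dirDeriv (f i a) (v x) (dv x (EuclideanSpace.basisFun (Fin d) ℝ m)) = A i a m x := by
  have h1 : ∀ x, ∃ i, v x ∈ V i ∧ ∃ η : Fin d → TangentSpace (𝓡 n) (v x),
      ∀ a m, dirDeriv (f i a) (v x) (η m) = A i a m x := fun x => by
    obtain ⟨i, hi⟩ := hcov (v x)
    choose η hη using fun m => (hV i).exists_dirDeriv_eq _ hi fun a => A i a m x
    exact ⟨i, hi, η, fun a m => hη m a⟩
  choose i hi η hη using h1
  refine ⟨fun x => ∑ m, (EuclideanSpace.proj (𝕜 := ℝ) m : EuclideanSpace ℝ (Fin d) →L[ℝ] ℝ).smulRight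
    (η x m), fun x => ⟨i x, hi x, fun a m => ?_⟩⟩
  rw [← hη x a m]
  congr 1
  simp

variable [IsManifold (𝓡 n) ∞ N]
    [IsContinuousRiemannianBundle (EuclideanSpace ℝ (Fin n))
      (fun q : N => TangentSpace (𝓡 n) q)]

theorem BoundedInLp.dirDeriv {X : Type*} [MeasurableSpace X] {μ : Measure X} [IsFiniteMeasure μ]
    {u : ℕ → X → N} {du : ∀ k x, EuclideanSpace ℝ (Fin d) →L[ℝ] TangentSpace (𝓡 n) (u k x)}
    {p C : ℝ} (hp : 0 ≤ p) (h : BoundedInLp μ p C fun k x => frobeniusNormAt (u k x) (du k x))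
    {F : N → ℝ} (hF : ContMDiff (𝓡 n) 𝓘(ℝ, ℝ) 1 F) (hFc : HasCompactSupport F) :
    ∃ C', ∀ m, (∀ k, AEStronglyMeasurable
        (fun x => dirDeriv F (u k x) (du k x (EuclideanSpace.basisFun (Fin d) ℝ m))) μ) →
      BoundedInLp μ p C' fun k x =>
        dirDeriv F (u k x) (du k x (EuclideanSpace.basisFun (Fin d) ℝ m)) := by
  obtain ⟨L, hL, hLF⟩ := exists_hasGradientBound (n := n) hF hFc
  refine ⟨L ^ p * C, fun m hm => h.of_abs_le hp hm hL fun k x => (hLF _ _).trans ?_⟩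
  rw [abs_of_nonneg (frobeniusNormAt_nonneg _ _)]
  exact mul_le_mul_of_nonneg_left (norm_apply_basisFun_le _ _ _) hL

variable [MeasurableSpace N] [BorelSpace N]

/-- The derivative of the limit `v` is built from the weak limits `A` of the coordinates of the
derivatives: for `F ∈ C^1_c(N)`, every weak limit of the derivatives of `F ∘ u k` is expressed by the
`A i a m`, and is the weak derivative of `F ∘ v`. -/
theorem IsColocalWeakDerivOn.exists_limit_of_tendstoWeakly
    {D : Set (EuclideanSpace ℝ (Fin d))} (hDfin : volume D ≠ ⊤) {p C : ℝ}
    (hp : 1 < p) {V : ℕ → Set N} {f : ℕ → Fin n → N → ℝ}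
    (hV : ∀ i, IsCoordinateSystem (V i) (f i)) (hcov : ∀ q, ∃ i, q ∈ V i)
    {u : ℕ → EuclideanSpace ℝ (Fin d) → N} (hu : ∀ k, AEMeasurable (u k) (volume.restrict D))
    {v : EuclideanSpace ℝ (Fin d) → N} (hv : Measurable v)
    (hlim : ∀ᵐ x ∂volume.restrict D, Tendsto (fun k => u k x) atTop (𝓝 (v x)))
    {du : ∀ k x, EuclideanSpace ℝ (Fin d) →L[ℝ] TangentSpace (𝓡 n) (u k x)}
    (hdu : ∀ k, IsColocalWeakDerivOn D (u k) (du k))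
    (hfrob : BoundedInLp (volume.restrict D) p C fun k x => frobeniusNormAt (u k x) (du k x))
    {Γ : EuclideanSpace ℝ (Fin d) → ℝ} (hΓ : IntegrableOn Γ D)
    (hwΓ : TendstoWeakly (volume.restrict D) (fun k x => frobeniusNormAt (u k x) (du k x)) Γ)
    {A : ℕ → Fin n → Fin d → EuclideanSpace ℝ (Fin d) → ℝ} (hA : ∀ i a m, IntegrableOn (A i a m) D)
    (hwA : ∀ i a m, TendstoWeakly (volume.restrict D) (fun k x =>
      _root_.dirDeriv (f i a) (u k x) (du k x (EuclideanSpace.basisFun (Fin d) ℝ m))) (A i a m)) :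
    ∃ dv : ∀ x, EuclideanSpace ℝ (Fin d) →L[ℝ] TangentSpace (𝓡 n) (v x),
      IsColocalWeakDerivOn D v dv ∧
        MemLp (fun x => frobeniusNormAt (v x) (dv x)) (ENNReal.ofReal p) (volume.restrict D) := by
  have hfin : IsFiniteMeasure (volume.restrict D) := ⟨by simpa using hDfin.lt_top⟩
  have hFm : ∀ {F : N → ℝ}, ContMDiff (𝓡 n) 𝓘(ℝ, ℝ) 1 F → HasCompactSupport F → ∀ m k,
      AEStronglyMeasurable (fun x => _root_.dirDeriv F (u k x)
        (du k x (EuclideanSpace.basisFun (Fin d) ℝ m))) (volume.restrict D) := fun hF hFc m k =>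
    (hdu k _ hF hFc).aestronglyMeasurable_apply _
  obtain ⟨dv, hdv⟩ := exists_clm_dirDeriv_eq hV hcov v A
  have hcol : IsColocalWeakDerivOn D v dv := by
    intro F hF hFc
    obtain ⟨C', hC'⟩ := hfrob.dirDeriv (by linarith) hF hFc
    have hFb := fun m => hC' m (hFm hF hFc m)
    obtain ⟨φ, hφ, B, hB⟩ := BoundedInLp.exists_subseq_tendstoWeakly hp hFb
    have hlimφ : ∀ᵐ x ∂volume.restrict D, Tendsto (fun k => u (φ k) x) atTop (𝓝 (v x)) :=
      hlim.mono fun x hx => hx.comp hφ.tendsto_atTop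
    have h1 : ∀ᵐ x ∂volume.restrict D, ∀ i m, v x ∈ V i → ∀ η : TangentSpace (𝓡 n) (v x),
        (∀ a, _root_.dirDeriv (f i a) (v x) η = A i a m x) → _root_.dirDeriv F (v x) η = B m x := by
      refine ae_all_iff.2 fun i => ae_all_iff.2 fun m => ?_
      choose Cf hCf using fun a => hfrob.dirDeriv (by linarith) ((hV i).contMDiff a)
        ((hV i).hasCompactSupport a)
      exact (hV i).ae_dirDeriv_eq hp (fun k => hu (φ k)) hv hlimφ
        (fun a => (hCf a m (hFm ((hV i).contMDiff a) ((hV i).hasCompactSupport a) m)).comp φ)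
        (fun a => hA i a m) (fun a => (hwA i a m).comp_strictMono hφ) hF ((hFb m).comp φ)
        (hB m).1 (hB m).2
    obtain ⟨M, hM⟩ := hF.continuous.bounded_above_of_compact_support hFc
    refine HasWeakDerivOn.of_tendsto hDfin (w := fun k x => F (u (φ k) x))
      (fun k => hdu (φ k) F hF hFc) (fun k x => hM _)
      (hlimφ.mono fun x hx => (hF.continuous.tendsto _).comp hx) (fun k w => ?_)
      (fun m => (hB m).1) (fun m => (hB m).2) (fun m => ?_)
    · have h2 : Integrable (fun x => ∑ m, w m * _root_.dirDeriv F (u (φ k) x)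
          (du (φ k) x (EuclideanSpace.basisFun (Fin d) ℝ m))) (volume.restrict D) :=
        integrable_finsetSum _ fun m _ => ((hFb m).integrable hp (φ k)).const_mul _
      refine h2.congr (ae_of_all _ fun x => ?_)
      let T : EuclideanSpace ℝ (Fin d) →L[ℝ] ℝ :=
        (mfderiv (𝓡 n) 𝓘(ℝ, ℝ) F (u (φ k) x)).comp (du (φ k) x)
      exact (EuclideanSpace.clm_apply_eq_sum T w).symm
    · filter_upwards [h1] with x hx
      obtain ⟨i, hi, hia⟩ := hdv x
      exact hx i m hi _ fun a => hia a m
  refine ⟨dv, hcol, ?_⟩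
  have habs : ∀ᵐ x ∂volume.restrict D, ∀ i a m, v x ∈ V i → |A i a m x| ≤ 2 * Γ x := by
    refine ae_all_iff.2 fun i => ae_all_iff.2 fun a => ae_all_iff.2 fun m => ?_
    obtain ⟨Cf, hCf⟩ := hfrob.dirDeriv (by linarith) ((hV i).contMDiff a)
      ((hV i).hasCompactSupport a)
    exact (hV i).ae_abs_le hp hu hv hlim a
      (hCf m (hFm ((hV i).contMDiff a) ((hV i).hasCompactSupport a) m)) (hA i a m) (hwA i a m)
      hfrob (fun k x => norm_apply_basisFun_le _ _ _) hΓ hwΓ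
  refine ((hwΓ.memLp hp hfrob hΓ).const_mul (d * (4 * n))).mono' ?_ ?_
  · exact (aemeasurable_frobeniusNormAt hV hcov hv.aemeasurable fun i a w =>
      ((hcol _ ((hV i).contMDiff a) ((hV i).hasCompactSupport a)).aestronglyMeasurable_apply
        w).aemeasurable).aestronglyMeasurable
  · filter_upwards [habs] with x hx
    obtain ⟨i, hi, hia⟩ := hdv x
    rw [Real.norm_of_nonneg (frobeniusNormAt_nonneg _ _)]
    refine (frobeniusNormAt_le_sum _ _).trans ?_
    calc ∑ m, ‖dv x (EuclideanSpace.basisFun (Fin d) ℝ m)‖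
        ≤ ∑ m : Fin d, 2 * ∑ a : Fin n, 2 * Γ x := by
          refine Finset.sum_le_sum fun m _ => ((hV i).norm_le _ hi _).trans ?_
          gcongr with a
          rw [hia a m]
          exact hx i a m hi
      _ = d * (4 * n) * Γ x := by simp; ring

/-- Closedness of the colocal weak derivative: the almost everywhere limit of maps with bounded
`p`-energy has a colocal weak derivative in `L^p`. -/
theorem IsColocalWeakDerivOn.exists_limit [Nonempty N] [SecondCountableTopology N]
    {D : Set (EuclideanSpace ℝ (Fin d))} (hDfin : volume D ≠ ⊤) {p C : ℝ} (hp : 1 < p)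
    {u : ℕ → EuclideanSpace ℝ (Fin d) → N} (hu : ∀ k, AEMeasurable (u k) (volume.restrict D))
    {v : EuclideanSpace ℝ (Fin d) → N} (hv : Measurable v)
    (hlim : ∀ᵐ x ∂volume.restrict D, Tendsto (fun k => u k x) atTop (𝓝 (v x)))
    {du : ∀ k x, EuclideanSpace ℝ (Fin d) →L[ℝ] TangentSpace (𝓡 n) (u k x)}
    (hdu : ∀ k, IsColocalWeakDerivOn D (u k) (du k))
    (hfrob : BoundedInLp (volume.restrict D) p C fun k x => frobeniusNormAt (u k x) (du k x)) :
    ∃ dv : ∀ x, EuclideanSpace ℝ (Fin d) →L[ℝ] TangentSpace (𝓡 n) (v x),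
      IsColocalWeakDerivOn D v dv ∧
        MemLp (fun x => frobeniusNormAt (v x) (dv x)) (ENNReal.ofReal p) (volume.restrict D) := by
  have hfin : IsFiniteMeasure (volume.restrict D) := ⟨by simpa using hDfin.lt_top⟩
  obtain ⟨V, f, hV, hcov⟩ := exists_countable_isCoordinateSystem n N
  choose Cf hCf using fun i a => hfrob.dirDeriv (by linarith) ((hV i).contMDiff a)
    ((hV i).hasCompactSupport a)
  obtain ⟨φ, hφ, Γ, hΓ⟩ := BoundedInLp.exists_subseq_tendstoWeakly (ι := Unit) hp fun _ => hfrob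
  obtain ⟨ψ, hψ, A, hA⟩ := BoundedInLp.exists_subseq_tendstoWeakly (ι := ℕ × Fin n × Fin d) hp
    fun i => (hCf i.1 i.2.1 i.2.2 fun k => (hdu k _ ((hV i.1).contMDiff i.2.1)
      ((hV i.1).hasCompactSupport i.2.1)).aestronglyMeasurable_apply _).comp φ
  exact exists_limit_of_tendstoWeakly hDfin hp hV hcov (fun k => hu (φ (ψ k))) hv
    (hlim.mono fun x hx => hx.comp (hφ.comp hψ).tendsto_atTop) (fun k => hdu (φ (ψ k)))
    (hfrob.comp _) (hΓ ()).1 ((hΓ ()).2.comp_strictMono hψ) (A := fun i a m => A (i, a, m))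
    (fun i a m => (hA (i, a, m)).1) (fun i a m => (hA (i, a, m)).2)

end LimitDerivative

/-! ### Compactness of sequences of bounded energy -/

section Reduction

variable {d n : ℕ} {N : Type*} [MetricSpace N] [ChartedSpace (EuclideanSpace ℝ (Fin n)) N]
    [RiemannianBundle (fun q : N => TangentSpace (𝓡 n) q)] {D : Set (EuclideanSpace ℝ (Fin d))}

theorem derivEnergy_one_le {u : EuclideanSpace ℝ (Fin d) → N}
    (du : ∀ x, EuclideanSpace ℝ (Fin d) →L[ℝ] TangentSpace (𝓡 n) (u x)) {p : ℝ} (hp : 1 ≤ p) :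
    derivEnergy D 1 u du ≤ volume D + derivEnergy D p u du := by
  calc derivEnergy D 1 u du
      ≤ ∫⁻ x in D, (1 + ENNReal.ofReal (frobeniusNormAt (u x) (du x)) ^ p) := by
        refine lintegral_mono fun x => ?_
        rw [ENNReal.rpow_one]
        rcases le_total (ENNReal.ofReal (frobeniusNormAt (u x) (du x))) 1 with h | h
        · exact h.trans le_self_add
        · refine le_trans ?_ le_add_self
          conv_lhs => rw [← ENNReal.rpow_one (ENNReal.ofReal _)]
          exact ENNReal.rpow_le_rpow_of_exponent_le h hp
    _ = _ := by rw [lintegral_add_left measurable_const, setLIntegral_one, derivEnergy]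

theorem setLIntegral_edist_translate_congr {u w : EuclideanSpace ℝ (Fin d) → N}
    (hD : MeasurableSet D) (h : u =ᵐ[volume.restrict D] w) {U : Set (EuclideanSpace ℝ (Fin d))}
    (hU : MeasurableSet U) {v : EuclideanSpace ℝ (Fin d)}
    (hv : ∀ y ∈ U, ∀ s ∈ Set.Icc (0 : ℝ) 1, y + s • v ∈ D) (p : ℝ) :
    ∫⁻ y in U, edist (w (y + v)) (w y) ^ p = ∫⁻ y in U, edist (u (y + v)) (u y) ^ p := by
  have h1 := (ae_restrict_iff' hD).1 h
  have h2 := (measurePreserving_add_right volume v).quasiMeasurePreserving.ae h1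
  refine setLIntegral_congr_fun_ae hU ?_
  filter_upwards [h1, h2] with y hy1 hy2 hyU
  rw [hy1 (by simpa using hv y hyU 0 (by simp)), hy2 (by simpa using hv y hyU 1 (by simp))]

theorem eLpNorm_dist {X : Type*} [MeasurableSpace X] {μ : Measure X} {p : ℝ} (hp : 0 < p)
    (u v : X → N) : eLpNorm (fun x => dist (u x) (v x)) (ENNReal.ofReal p) μ =
      (∫⁻ x, edist (u x) (v x) ^ p ∂μ) ^ (1 / p) := by
  rw [eLpNorm_eq_lintegral_rpow_enorm_toReal (by simpa using hp) ENNReal.ofReal_ne_top,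
    ENNReal.toReal_ofReal hp.le]
  simp only [edist_dist, Real.enorm_of_nonneg dist_nonneg]

end Reduction

theorem theorem2p10 {d n : ℕ}
    -- `N` is a smooth (connected) Riemannian manifold of dimension `n`, complete for its distance
    {N : Type*} [MetricSpace N] [SecondCountableTopology N]
    [ChartedSpace (EuclideanSpace ℝ (Fin n)) N] [IsManifold (𝓡 n) ∞ N]
    [RiemannianBundle (fun q : N => TangentSpace (𝓡 n) q)]
    [IsContMDiffRiemannianBundle (𝓡 n) ∞ (EuclideanSpace ℝ (Fin n))
      (fun q : N => TangentSpace (𝓡 n) q)]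
    [IsRiemannianManifold (𝓡 n) N] [CompleteSpace N]
    -- `D` is a bounded open set with Lipschitz boundary
    (D : Set (EuclideanSpace ℝ (Fin d))) (hDo : IsOpen D) (hDb : Bornology.IsBounded D)
    (hDL : HasLipschitzBoundary D)
    (p : ℝ) (hp : 1 < p)
    (u : ℕ → EuclideanSpace ℝ (Fin d) → N) (hu : ∀ k, MemHomogeneousSobolev n D p (u k))
    -- `du k` is the colocal weak derivative of `u k`
    (du : ∀ k x, EuclideanSpace ℝ (Fin d) →L[ℝ] TangentSpace (𝓡 n) (u k x))
    (hdu : ∀ k, IsColocalWeakDerivOn D (u k) (du k))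
    (q₀ : N) (C : ℝ≥0)
    (hC : ∀ k, ∫⁻ x in D, edist (u k x) q₀ ^ p ≤ C)
    (hE : ∀ k, derivEnergy D p (u k) (du k) ≤ C) :
    ∃ (k : ℕ → ℕ) (v : EuclideanSpace ℝ (Fin d) → N), StrictMono k ∧
      MemHomogeneousSobolev n D p v ∧
      (∀ l, MemLp (fun x => dist (u (k l) x) (v x)) (ENNReal.ofReal p) (volume.restrict D)) ∧
      Tendsto (fun l => eLpNorm (fun x => dist (u (k l) x) (v x)) (ENNReal.ofReal p)
        (volume.restrict D)) atTop (𝓝 0) := by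
  have : Nonempty N := ⟨q₀⟩
  have : ProperSpace N := properSpace_of_isRiemannianManifold n N
  have : IsContinuousRiemannianBundle (EuclideanSpace ℝ (Fin n))
      (fun q : N => TangentSpace (𝓡 n) q) := by
    obtain ⟨g, hg, hg'⟩ := IsContMDiffRiemannianBundle.exists_contMDiff (IB := 𝓡 n) (n := ∞)
      (F := EuclideanSpace ℝ (Fin n)) (E := fun q : N => TangentSpace (𝓡 n) q)
    exact ⟨g, hg.continuous, hg'⟩
  let : MeasurableSpace N := borel N
  have : BorelSpace N := ⟨rfl⟩
  have hp0 : 0 < p := by linarith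
  have hDfin : volume D ≠ ⊤ := hDb.measure_lt_top.ne
  have hfin : IsFiniteMeasure (volume.restrict D) := ⟨by simpa using hDfin.lt_top⟩
  obtain ⟨Φ, hΦ⟩ := exists_isApproxFamily n N
  obtain ⟨V, f, hV, hcov⟩ := exists_countable_isCoordinateSystem n N
  obtain ⟨s, U, hU, hDU⟩ := hDL.exists_finite_cover hDo hDb
  have hum : ∀ k, AEMeasurable (u k) (volume.restrict D) := fun k => hΦ.aemeasurable fun m =>
    (hdu k _ (hΦ.contMDiff m) (hΦ.hasCompactSupport m)).1.aestronglyMeasurable.aemeasurable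
  have hfm : ∀ k, AEMeasurable (fun x => frobeniusNormAt (u k x) (du k x)) (volume.restrict D) :=
    fun k => aemeasurable_frobeniusNormAt hV hcov (hum k) fun i a w =>
      ((hdu k _ ((hV i).contMDiff a) ((hV i).hasCompactSupport a)).aestronglyMeasurable_apply
        w).aemeasurable
  have hfrob : BoundedInLp (volume.restrict D) p C
      fun k x => frobeniusNormAt (u k x) (du k x) := by
    refine .of_lintegral hp0.le (fun k => (hfm k).aestronglyMeasurable) fun k => ?_
    simp only [abs_of_nonneg (frobeniusNormAt_nonneg _ _)]
    exact hE k
  -- measurable representatives on all of `ℝ^d`, as the estimates on translates use Tonelli's theorem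
  let w : ℕ → EuclideanSpace ℝ (Fin d) → N := fun k => (hum k).mk (u k)
  have hw : ∀ k, Measurable (w k) := fun k => (hum k).measurable_mk
  have huw : ∀ k, u k =ᵐ[volume.restrict D] w k := fun k => (hum k).ae_eq_mk
  -- a common constant for the estimates on translates with exponents `1` and `p`
  obtain ⟨K, hK⟩ : ∃ K : ℝ≥0, (K : ℝ≥0∞) = C + 5 * (volume D + C) + 5 ^ p * C := by
    refine ⟨_, ENNReal.coe_toNNReal ?_⟩
    exact ENNReal.add_ne_top.2 ⟨ENNReal.add_ne_top.2 ⟨ENNReal.coe_ne_top, ENNReal.mul_ne_top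
      (by norm_num) (ENNReal.add_ne_top.2 ⟨hDfin, ENNReal.coe_ne_top⟩)⟩, ENNReal.mul_ne_top
      (ENNReal.rpow_ne_top_of_nonneg hp0.le (by norm_num)) ENNReal.coe_ne_top⟩
  have h5 : ENNReal.ofReal 5 = 5 := by norm_num
  have hwC : ∀ k, ∫⁻ x in D, edist (w k x) q₀ ^ p ≤ K := fun k => by
    have h1 : ∫⁻ x in D, edist (w k x) q₀ ^ p = ∫⁻ x in D, edist (u k x) q₀ ^ p :=
      lintegral_congr_ae ((huw k).mono fun x hx => by beta_reduce; rw [hx])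
    rw [h1, hK, add_assoc]
    exact (hC k).trans le_self_add
  have htr : ∀ r : ℝ, 1 ≤ r → ∀ i ∈ s, ∀ v,
      (∀ y ∈ U i, ∀ s ∈ Set.Icc (0 : ℝ) 1, y + s • v ∈ D) → ∀ k,
      ∫⁻ y in U i, edist (w k (y + v)) (w k y) ^ r ≤
        ENNReal.ofReal ‖v‖ ^ r * (5 ^ r * derivEnergy D r (u k) (du k)) := by
    intro r hr i hi v hv k
    rw [setLIntegral_edist_translate_congr hDo.measurableSet (huw k) (hU i hi).isOpen.measurableSet hv]
    refine ((hdu k).lintegral_edist_translate_le hΦ hDo (hfm k) (hU i hi).isOpen v hv hr).trans_eq ?_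
    rw [ENNReal.ofReal_mul (by norm_num), h5, ENNReal.mul_rpow_of_nonneg _ _ (by linarith)]
    ring
  have htr1 : ∀ i ∈ s, ∀ v, (∀ y ∈ U i, ∀ s ∈ Set.Icc (0 : ℝ) 1, y + s • v ∈ D) → ∀ k,
      ∫⁻ y in U i, edist (w k (y + v)) (w k y) ≤ ENNReal.ofReal ‖v‖ * K := by
    intro i hi v hv k
    have h1 := htr 1 le_rfl i hi v hv k
    simp only [ENNReal.rpow_one] at h1
    refine h1.trans ?_
    rw [hK]
    gcongr
    calc 5 * derivEnergy D 1 (u k) (du k) ≤ 5 * (volume D + C) := by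
          gcongr
          exact (derivEnergy_one_le (du k) hp.le).trans (add_le_add_right (hE k) _)
      _ ≤ _ := le_add_right le_add_self
  have htrp : ∀ i ∈ s, ∀ v, (∀ y ∈ U i, ∀ s ∈ Set.Icc (0 : ℝ) 1, y + s • v ∈ D) → ∀ k,
      ∫⁻ y in U i, edist (w k (y + v)) (w k y) ^ p ≤ ENNReal.ofReal ‖v‖ ^ p * K := by
    intro i hi v hv k
    refine (htr p hp.le i hi v hv k).trans ?_
    rw [hK]
    gcongr
    calc 5 ^ p * derivEnergy D p (u k) (du k) ≤ 5 ^ p * C := by gcongr; exact hE k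
      _ ≤ _ := le_add_self
  obtain ⟨φ, hφ, v, hv, hlim⟩ := exists_subseq_ae_tendsto hU hDU hDfin hw hp0 hwC htr1
  have hstrong := tendsto_lintegral_edist_rpow hU hDU hDfin hp.le (fun k => hw (φ k)) hv hlim
    (fun k => hwC (φ k)) fun i hi v hv k => htrp i hi v hv (φ k)
  have hvC : ∫⁻ x in D, edist (v x) q₀ ^ p ≤ K :=
    lintegral_le_of_ae_tendsto (f := fun k x => edist (w (φ k) x) q₀ ^ p)
      (fun k => (((hw _).edist measurable_const).pow_const p).aemeasurable) (fun k => hwC (φ k))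
      (hlim.mono fun x hx => (ENNReal.continuous_rpow_const.tendsto _).comp
        (hx.edist tendsto_const_nhds))
  have hlimu : ∀ᵐ x ∂volume.restrict D, Tendsto (fun k => u (φ k) x) atTop (𝓝 (v x)) := by
    filter_upwards [hlim, ae_all_iff.2 huw] with x hx1 hx2
    simpa only [hx2] using hx1
  obtain ⟨dv, hdv, hdvp⟩ := IsColocalWeakDerivOn.exists_limit hDfin hp (fun k => hum (φ k)) hv hlimu
    (fun k => hdu (φ k)) (hfrob.comp φ)
  refine ⟨φ, v, hφ, ⟨fun F hF hFc => ⟨_, hdv F hF hFc⟩, dv, hdv, hdvp⟩, fun l => ⟨?_, ?_⟩, ?_⟩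
  · exact ((hum (φ l)).dist hv.aemeasurable).aestronglyMeasurable
  · rw [eLpNorm_dist hp0]
    refine ENNReal.rpow_lt_top_of_nonneg (by positivity) ?_
    refine ne_top_of_le_ne_top (b := 2 ^ (p - 1) * (C + K)) (ENNReal.mul_ne_top
      (ENNReal.rpow_ne_top_of_nonneg (by linarith) ENNReal.ofNat_ne_top)
      (ENNReal.add_ne_top.2 ⟨ENNReal.coe_ne_top, ENNReal.coe_ne_top⟩)) ?_
    calc ∫⁻ x in D, edist (u (φ l) x) (v x) ^ p
        ≤ ∫⁻ x in D, 2 ^ (p - 1) * (edist (u (φ l) x) q₀ ^ p + edist (v x) q₀ ^ p) :=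
          lintegral_mono fun x => edist_rpow_le hp.le _ _ _
      _ = 2 ^ (p - 1) * ((∫⁻ x in D, edist (u (φ l) x) q₀ ^ p) +
            ∫⁻ x in D, edist (v x) q₀ ^ p) := by
          rw [lintegral_const_mul' _ _ (ENNReal.rpow_ne_top_of_nonneg (by linarith)
            ENNReal.ofNat_ne_top), lintegral_add_right _ ((hv.edist measurable_const).pow_const p)]
      _ ≤ _ := by gcongr; exact hC _
  · simp only [eLpNorm_dist hp0]
    have h1 : Tendsto (fun k => ∫⁻ x in D, edist (u (φ k) x) (v x) ^ p) atTop (𝓝 0) :=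
      hstrong.congr fun k => lintegral_congr_ae ((huw (φ k)).mono fun x hx => by
        beta_reduce; rw [hx])
    have h2 := (ENNReal.continuous_rpow_const (y := 1 / p)).tendsto 0 |>.comp h1
    rw [ENNReal.zero_rpow_of_pos (by positivity)] at h2
    exact h2
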